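/- Let $\Bbbk$ be an integral domain of characteristic $0$, let $\ell$ be a positive integer, let $\varepsilon^{1/2}$ be a primitive $\ell$-th root of unity in an algebraic closure of the fraction field of $\Bbbk$, and set $\mathcal A=\Bbbk[\varepsilon^{1/2}]$. Let $\widetilde B=\begin{bmatrix}0&1\\-1&0\end{bmatrix}$, with no frozen variables, and let $\Lambda(f,g)=f_1g_2-f_2g_1 \bmod \ell$ for $f,g\in\mathbb Z^2$. Let $M_\varepsilon:\mathbb Z^2\to\mathcal F_\varepsilon$ be a root of unity toric frame with matrix $\Lambda$ of a division $\mathcal A$-algebra $\mathcal F_\varepsilon$. This means that the elements $M_\varepsilon(f)$ are linearly independent over $\mathcal A$, that $M_\varepsilon(f)M_\varepsilon(g)=\varepsilon^{\Lambda(f,g)/2}M_\varepsilon(f+g)$, and that $\mathcal F_\varepsilon$ is the division algebra of fractions of $\mathcal T_\varepsilon(M_\varepsilon)=\mathrm{Span}_{\mathcal A}\{M_\varepsilon(f)\}$. Let $\mathsf A_\varepsilon(M_\varepsilon,\widetilde B)\subseteq\mathcal F_\varepsilon$ be the root of unity quantum cluster algebra, that is, the $\mathcal A$-subalgebra generated by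 the elements $M''_\varepsilon(e_1),M''_\varepsilon(e_2)$ for all seeds $(M''_\varepsilon,\widetilde B'')$ mutation-equivalent to $(M_\varepsilon,\widetilde B)$. Let $\mathsf U_\varepsilon(M_\varepsilon,\widetilde B)$ be the root of unity upper quantum cluster algebra, that is, the intersection of the quantum tori $\mathcal T_\varepsilon(M''_\varepsilon)$ of all these seeds. Put $$X_1=M_\varepsilon(e_1),\quad X_2=M_\varepsilon(e_2),\quad Y_1=M_\varepsilon(-e_1+e_2)+M_\varepsilon(-e_1),\quad Y_2=M_\varepsilon(e_1-e_2)+M_\varepsilon(-e_2).$$ Let $R$ be the $\mathcal A$-algebra with generators $x_1,x_2,y_1,y_2$ and relations $$x_2x_1=\varepsilon^{-1}x_1x_2,\quad y_2x_1=\varepsilon x_1y_2,\quad x_2y_1=\varepsilon y_1x_2,$$ $$x_1y_1=1+\varepsilon^{1/2}x_2,\quad y_1x_1=1+\varepsilon^{-1/2}x_2,\quad x_2y_2=1+\varepsilon^{-1/2}x_1,\quad y_2x_2=1+\varepsilon^{1/2}x_1,$$ $$y_2y_1=\varepsilon^{-1}y_1y_2+(1-\varepsilon^{-1}).$$ Then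 the following hold. 1. There is an isomorphism of $\mathcal A$-algebras $\theta:R\to\mathsf A_\varepsilon(M_\varepsilon,\widetilde B)$ with $\theta(x_k)=X_k$ and $\theta(y_k)=Y_k$ for $k=1,2$. Moreover, $\mathsf A_\varepsilon(M_\varepsilon,\widetilde B)=\mathsf U_\varepsilon(M_\varepsilon,\widetilde B)$. The monomials $y_1^{m_1}x_1^{n_1}x_2^{n_2}y_2^{m_2}$ with $m_1,n_1,n_2,m_2\in\mathbb N$ and $\min(m_1,n_1)=\min(m_2,n_2)=0$ form an $\mathcal A$-basis of $R$, and the corresponding monomials $Y_1^{m_1}X_1^{n_1}X_2^{n_2}Y_2^{m_2}$ form an $\mathcal A$-basis of $\mathsf A_\varepsilon(M_\varepsilon,\widetilde B)$. 2. If $\mathcal A$ is completely integrally closed (for example, if $\Bbbk$ is a field or $\Bbbk=\mathbb Z$), then $R$ is a maximal order in a central simple algebra. That is, $R$ embeds in a finite-dimensional simple algebra $S$ over its center such that every element of $S$ has the form $ab^{-1}$ and the form $c^{-1}d$ with $a,b,c,d\in R$, and $R$ is maximal among the orders $R'$ of $S$ that are equivalent to it (meaning $aRb\subseteq R'$ and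 $a'R'b'\subseteq R$ for some units $a,b,a',b'$ of $S$). -/

import Mathlib

universe u v w

namespace RootCluster

noncomputable section

/-! ## The coefficient ring -/

section BaseRing

variable (k : Type u) [CommRing k] {K : Type w} [Field K] [Algebra k K]

/-- For an element `ζ = ε^{1/2}` of an extension `K` of `k`, the subalgebra `k[ε^{1/2}]` of `K`,
as a ring. -/
def BaseRing (ζ : K) : Type w := (Algebra.adjoin k {ζ} : Subalgebra k K)

instance (ζ : K) : CommRing (BaseRing k ζ) :=
  inferInstanceAs (CommRing (Algebra.adjoin k {ζ} : Subalgebra k K))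

instance (ζ : K) : IsDomain (BaseRing k ζ) :=
  inferInstanceAs (IsDomain (Algebra.adjoin k {ζ} : Subalgebra k K))

/-- A root of unity `ε^{1/2}` as a unit of `k[ε^{1/2}]`. -/
def epsHalf {ℓ : ℕ} {ζ : K} (hℓ : 0 < ℓ) (hζ : IsPrimitiveRoot ζ ℓ) : (BaseRing k ζ)ˣ where
  val := ⟨ζ, Algebra.self_mem_adjoin_singleton k ζ⟩
  inv := ⟨ζ ^ (ℓ - 1), pow_mem (Algebra.self_mem_adjoin_singleton k ζ) _⟩
  val_inv := Subtype.ext (by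
    change ζ * ζ ^ (ℓ - 1) = 1
    rw [mul_pow_sub_one hℓ.ne', hζ.pow_eq_one])
  inv_val := Subtype.ext (by
    change ζ ^ (ℓ - 1) * ζ = 1
    rw [pow_sub_one_mul hℓ.ne', hζ.pow_eq_one])

end BaseRing

/-- A commutative domain `A` is completely integrally closed: an element `s` of its field of
fractions for which some nonzero `r` in `A` satisfies `r s ^ n ∈ A` for all `n` lies in `A`. -/
def IsCompletelyIntegrallyClosed (A : Type u) [CommRing A] [IsDomain A] : Prop :=
  completeIntegralClosure A (FractionRing A) = ⊥

/-! ## Orders in central simple algebras -/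

section Orders

variable {S : Type u} [Ring S]

/-- `R` is an order in `S`: every element of `S` is of the form `a b⁻¹` and of the form
`c⁻¹ d` with `a, b, c, d ∈ R`. -/
def IsOrderIn (R : Subring S) : Prop :=
  ∀ x : S,
    (∃ a ∈ R, ∃ b : Sˣ, (b : S) ∈ R ∧ x = a * ((b⁻¹ : Sˣ) : S)) ∧
    (∃ c : Sˣ, (c : S) ∈ R ∧ ∃ d ∈ R, x = ((c⁻¹ : Sˣ) : S) * d)

/-- Equivalence of orders: `a R b ⊆ R'` and `a' R' b' ⊆ R` for some units of `S`. -/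
def OrdersEquivalent (R R' : Subring S) : Prop :=
  ∃ a b a' b' : Sˣ,
    (∀ r ∈ R, (a : S) * r * (b : S) ∈ R') ∧ (∀ r ∈ R', (a' : S) * r * (b' : S) ∈ R)

/-- An order of `S` that is maximal, with respect to inclusion, in its equivalence class. -/
def IsMaximalOrderIn (R : Subring S) : Prop :=
  IsOrderIn R ∧
    ∀ R' : Subring S, IsOrderIn R' → OrdersEquivalent R R' → R ≤ R' → R' = R

/-- The ring `R` is a maximal order in a central simple algebra: it embeds in a finite
dimensional simple algebra `S` with center a field `Q`, as a maximal order of `S`. -/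
def IsMaximalOrder (R : Type u) [Ring R] : Prop :=
  ∃ (Q S : Type u) (_ : Field Q) (_ : Ring S) (_ : Algebra Q S),
    Algebra.IsCentral Q S ∧ IsSimpleRing S ∧ FiniteDimensional Q S ∧
      ∃ φ : R →+* S, Function.Injective φ ∧ IsMaximalOrderIn φ.range

end Orders

/-! ## Root of unity quantum cluster algebras without frozen variables -/

section Cluster

variable {A : Type u} [CommRing A] {ι : Type} [Fintype ι] [DecidableEq ι] {ℓ : ℕ}
variable {F : Type v} [DivisionRing F] [Algebra A F]

/-- The bicharacter `ℤ^N × ℤ^N → ℤ/ℓ` with matrix `Λ`. -/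
def bichar (Λ : Matrix ι ι (ZMod ℓ)) (f g : ι → ℤ) : ZMod ℓ :=
  ∑ i, ∑ j, (f i : ZMod ℓ) * Λ i j * (g j : ZMod ℓ)

/-- `(ε^{1/2})^c` for a residue class `c` modulo `ℓ`, where `q = ε^{1/2}` satisfies `q ^ ℓ = 1`. -/
def epsPow (q : Aˣ) (c : ZMod ℓ) : A := ((q ^ (ZMod.cast c : ℤ) : Aˣ) : A)

/-- The quantum torus `T(M)` of a toric frame `M`, the subalgebra of `F` spanned by the `M f`. -/
def quantumTorus (A : Type u) [CommRing A] [Algebra A F] (M : (ι → ℤ) → F) : Subalgebra A F :=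
  Algebra.adjoin A (Set.range M)

/-- `M` is a root of unity toric frame of `F` with matrix `Λ`. The quantum torus of `Λ` has the
`A`-basis `X^f`, `f ∈ ℤ^N`, with `X^f X^g = ε^{Λ(f,g)/2} X^{f+g}`; the first two fields say that
`X^f ↦ M f` is an embedding of algebras of it in `F`, and the third that `F` is the division
algebra of fractions of the image. -/
structure IsToricFrame (q : Aˣ) (Λ : Matrix ι ι (ZMod ℓ)) (M : (ι → ℤ) → F) : Prop where
  mul : ∀ f g, M f * M g = epsPow q (bichar Λ f g) • M (f + g)
  linearIndependent : LinearIndependent A M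
  fractions : ∀ x : F, ∃ a ∈ quantumTorus A M, ∃ b ∈ quantumTorus A M, b ≠ 0 ∧ x = a * b⁻¹

/-- The data of a root of unity quantum seed: a toric frame, its matrix, and the exchange
matrix. -/
structure Seed (ι : Type) (ℓ : ℕ) (F : Type v) where
  /-- The toric frame `M`. -/
  frame : (ι → ℤ) → F
  /-- The matrix `Λ` of the toric frame. -/
  form : Matrix ι ι (ZMod ℓ)
  /-- The exchange matrix `B`. -/
  exch : Matrix ι ι ℤ

/-- The standard basis vector `e_i` of `ℤ^N`. -/
def stdVec (i : ι) : ι → ℤ := Pi.single i 1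

/-- Mutation of exchange matrices. The division is exact. -/
def mutExch (k : ι) (B : Matrix ι ι ℤ) : Matrix ι ι ℤ :=
  Matrix.of fun i j =>
    if i = k ∨ j = k then -B i j
    else B i j + (|B i k| * B k j + B i k * |B k j|) / 2

/-- The vector `-e_k + [b^k]_+`, where `b^k` is the `k`-th column of `B`. -/
def posVec (k : ι) (B : Matrix ι ι ℤ) : ι → ℤ := -stdVec k + fun i => max (B i k) 0

/-- The vector `-e_k - [b^k]_-`, where `b^k` is the `k`-th column of `B`. -/
def negVec (k : ι) (B : Matrix ι ι ℤ) : ι → ℤ := -stdVec k - fun i => min (B i k) 0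

/-- The new cluster variable `M(-e_k + [b^k]_+) + M(-e_k - [b^k]_-)` of a mutation. -/
def newVar (k : ι) (s : Seed ι ℓ F) : F :=
  s.frame (posVec k s.exch) + s.frame (negVec k s.exch)

/-- The matrix of the mutated frame, `Eᵀ Λ E`, where `E` sends `e_k` to `-e_k + [b^k]_+` and
fixes the other basis vectors. -/
def mutForm (k : ι) (s : Seed ι ℓ F) : Matrix ι ι (ZMod ℓ) :=
  let E : ι → ι → ℤ := fun i => if i = k then posVec k s.exch else stdVec i
  Matrix.of fun i j => bichar s.form (E i) (E j)

/-- The mutated toric frame `M'` with matrix `Λ'`: its values at the `e_i` are `M(e_i)` for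
`i ≠ k` and the new variable for `i = k`. As `M'(g) M'(h) = ε^{Λ'(g,h)/2} M'(g+h)`, this
determines `M'`: writing `f = f° + f_k e_k` with `f°` of `k`-th coordinate zero, one has
`M'(f°) = M(f°)` and `M'(f) = ε^{-Λ'(f°, f_k e_k)/2} M(f°) M'(e_k)^{f_k}`. -/
def mutFrame (q : Aˣ) (k : ι) (s : Seed ι ℓ F) : (ι → ℤ) → F := fun f =>
  epsPow q (-bichar (mutForm k s) (Function.update f k 0) (f k • stdVec k)) •
    (s.frame (Function.update f k 0) * newVar k s ^ f k)

/-- Seed mutation in direction `k`. -/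
def Seed.mutate (q : Aˣ) (k : ι) (s : Seed ι ℓ F) : Seed ι ℓ F where
  frame := mutFrame q k s
  form := mutForm k s
  exch := mutExch k s.exch

/-- The second seed is obtained from the first by a finite sequence of mutations. -/
def MutEquiv (q : Aˣ) : Seed ι ℓ F → Seed ι ℓ F → Prop :=
  Relation.ReflTransGen fun s t => ∃ k, t = s.mutate q k

/-- The root of unity quantum cluster algebra: the subalgebra generated by the cluster variables
of all seeds that are mutation-equivalent to `s`. -/
def clusterAlgebra (q : Aˣ) (s : Seed ι ℓ F) : Subalgebra A F :=
  Algebra.adjoin A {x | ∃ t, MutEquiv q s t ∧ ∃ i, x = t.frame (stdVec i)}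

/-- The root of unity upper quantum cluster algebra: the intersection of the quantum tori of all
seeds that are mutation-equivalent to `s`. -/
def upperClusterAlgebra (q : Aˣ) (s : Seed ι ℓ F) : Subalgebra A F :=
  ⨅ (t : Seed ι ℓ F) (_ : MutEquiv q s t), quantumTorus A t.frame

end Cluster

/-! ## Type `A₂` -/

section TypeA2

variable {F : Type v}

/-- The exchange matrix of type `A₂`. -/
def exchA2 : Matrix (Fin 2) (Fin 2) ℤ := !![0, 1; -1, 0]

/-- The reduction modulo `ℓ` of the exchange matrix of type `A₂`. -/
def formA2 (ℓ : ℕ) : Matrix (Fin 2) (Fin 2) (ZMod ℓ) := exchA2.map (Int.cast : ℤ → ZMod ℓ)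

/-- The initial seed of type `A₂` with toric frame `M`. -/
def seedA2 (ℓ : ℕ) (M : (Fin 2 → ℤ) → F) : Seed (Fin 2) ℓ F where
  frame := M
  form := formA2 ℓ
  exch := exchA2

/-- The generators of the presented algebra. -/
inductive Gen
  | x1 | x2 | y1 | y2

variable {A : Type u} [CommRing A]

open FreeAlgebra in
/-- The defining relations, with `q = ε^{1/2}` and `ε = q ^ 2`. -/
inductive Rel (q : Aˣ) : FreeAlgebra A Gen → FreeAlgebra A Gen → Prop
  | x2x1 : Rel q (ι A Gen.x2 * ι A Gen.x1)
      (((q ^ (-2 : ℤ) : Aˣ) : A) • (ι A Gen.x1 * ι A Gen.x2))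
  | y2x1 : Rel q (ι A Gen.y2 * ι A Gen.x1)
      (((q ^ (2 : ℤ) : Aˣ) : A) • (ι A Gen.x1 * ι A Gen.y2))
  | x2y1 : Rel q (ι A Gen.x2 * ι A Gen.y1)
      (((q ^ (2 : ℤ) : Aˣ) : A) • (ι A Gen.y1 * ι A Gen.x2))
  | x1y1 : Rel q (ι A Gen.x1 * ι A Gen.y1) (1 + (q : A) • ι A Gen.x2)
  | y1x1 : Rel q (ι A Gen.y1 * ι A Gen.x1) (1 + ((q⁻¹ : Aˣ) : A) • ι A Gen.x2)
  | x2y2 : Rel q (ι A Gen.x2 * ι A Gen.y2) (1 + ((q⁻¹ : Aˣ) : A) • ι A Gen.x1)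
  | y2x2 : Rel q (ι A Gen.y2 * ι A Gen.x2) (1 + (q : A) • ι A Gen.x1)
  | y2y1 : Rel q (ι A Gen.y2 * ι A Gen.y1)
      (((q ^ (-2 : ℤ) : Aˣ) : A) • (ι A Gen.y1 * ι A Gen.y2) +
        algebraMap A (FreeAlgebra A Gen) (1 - ((q ^ (-2 : ℤ) : Aˣ) : A)))

/-- The `A`-algebra `R` with generators `x₁, x₂, y₁, y₂` and the relations above. -/
abbrev PresentedAlgebra (q : Aˣ) : Type u := RingQuot (Rel q)

/-- The class in `R` of a generator. -/
def gen (q : Aˣ) (g : Gen) : PresentedAlgebra q :=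
  RingQuot.mkAlgHom A (Rel q) (FreeAlgebra.ι A g)

/-- The exponents `(m₁, n₁, n₂, m₂)` with `min(m₁, n₁) = min(m₂, n₂) = 0`. -/
abbrev PBWIndex : Type :=
  {p : ℕ × ℕ × ℕ × ℕ // min p.1 p.2.1 = 0 ∧ min p.2.2.2 p.2.2.1 = 0}

/-- The monomial `y₁^{m₁} x₁^{n₁} x₂^{n₂} y₂^{m₂}` in elements of a monoid. -/
def pbwMonomial {T : Type*} [Monoid T] (x1 x2 y1 y2 : T) (p : PBWIndex) : T :=
  y1 ^ p.1.1 * x1 ^ p.1.2.1 * x2 ^ p.1.2.2.1 * y2 ^ p.1.2.2.2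

end TypeA2

end

end RootCluster

open RootCluster

/-! Write q = ε^{1/2}. The cluster variables of type A₂ form a cycle z₀, …, z₄ = y₂, x₁, x₂, y₁,
q⁻¹(y₁y₂ - 1), indexed modulo 5. Neighbours q²-commute, z_i z_{i+2} = 1 + q z_{i+1} and z_{i+2} z_i
= 1 + q⁻¹ z_{i+1}. Mutation moves along this cycle, so all seeds are known
(`Pentagon.exists_of_mutEquiv`) and x₁, x₂, y₁, y₂ generate the cluster algebra
(`Pentagon.clusterAlgebra_eq`).

Bases and isomorphism: the relations straighten every word into the stated monomials
(`A2Relations.span_pbwMonomial`). In the torus of (x₁, x₂), ordered so that y₁ leads with x₁⁻¹ and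
y₂ with x₂⁻¹, these monomials have the distinct leading exponents (n₁ - m₁, n₂ - m₂), hence are
independent (`linearIndependent_pbwMonomial`).

Upper bound: an element of the tori of (x₁, x₂) and (y₁, x₂) enters the cluster algebra after
multiplication by a power of x₂ (`exists_pow_mul_mem_of_mem_inter`). With (x₁, y₂) in place of (y₁,
x₂), a power of x₁ suffices. Since x₁y₁ - q x₂ = 1, the two denominators are coprime and can be
dropped (`mem_of_pow_mul_mem`). Thus three tori already cut out the cluster algebra.

Maximal order: all fractions have central denominators, so an equivalent order R' containing R
satisfies eR' ⊆ R for some central e ≠ 0. It remains to place R' in each of the three tori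
(`QuasiComm.mem_spanOn_of_mul_mem`). Inverting the central monomial u^ℓ v^ℓ turns R' into a ring
containing the torus T and multiplied into T by e. All powers of an element of this ring share the
denominator e. Comparing degrees of such powers, together with division with remainder by a central
element, replaces a denominator by a power of its leading part
(`TwistedBasis.exists_pow_lead_mul_mem`). Doing so for both exponents leaves a denominator in the
coefficient ring, and complete integral closedness removes it (`TwistedBasis.mem_of_smul_mem`). -/

set_option linter.unusedSectionVars false

namespace RootCluster

/-! ## Twisted group algebras of `ℤ²` -/

section Twisted

variable {A : Type*} [CommRing A] {E : Type*} [Ring E] [Algebra A E]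

/-- A linearly independent family indexed by `ℤ²` that multiplies as the standard basis of a
twisted group algebra. -/
structure TwistedBasis (c : ℤ × ℤ → ℤ × ℤ → Aˣ) (m : ℤ × ℤ → E) : Prop where
  one : m 0 = 1
  mul : ∀ f g, m f * m g = (c f g : A) • m (f + g)
  li : LinearIndependent A m

/-- The span of the members of a family with index in `S`. -/
def spanOn (A : Type*) [CommRing A] [Algebra A E] (m : ℤ × ℤ → E) (S : Set (ℤ × ℤ)) :
    Submodule A E :=
  Submodule.span A (m '' S)

theorem mem_spanOn (m : ℤ × ℤ → E) {S : Set (ℤ × ℤ)} {f : ℤ × ℤ} (h : f ∈ S) :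
    m f ∈ spanOn A m S :=
  Submodule.subset_span ⟨f, h, rfl⟩

theorem spanOn_mono {m : ℤ × ℤ → E} {S S' : Set (ℤ × ℤ)} (h : S ⊆ S') :
    spanOn A m S ≤ spanOn A m S' :=
  Submodule.span_mono (Set.image_mono h)

theorem exists_add_of_mem_spanOn {m : ℤ × ℤ → E} {S S₁ S₂ : Set (ℤ × ℤ)} (h : S ⊆ S₁ ∪ S₂)
    {x : E} (hx : x ∈ spanOn A m S) :
    ∃ y ∈ spanOn A m S₁, ∃ z ∈ spanOn A m S₂, x = y + z := by
  have := spanOn_mono h hx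
  rw [spanOn, Set.image_union, Submodule.span_union, Submodule.mem_sup] at this
  obtain ⟨y, hy, z, hz, rfl⟩ := this
  exact ⟨y, hy, z, hz, rfl⟩

theorem exists_finset_of_mem_spanOn {m : ℤ × ℤ → E} {S : Set (ℤ × ℤ)} {x : E}
    (hx : x ∈ spanOn A m S) : ∃ s : Finset (ℤ × ℤ), ↑s ⊆ S ∧ x ∈ spanOn A m (s : Set (ℤ × ℤ)) := by
  rw [spanOn, Finsupp.mem_span_image_iff_linearCombination] at hx
  obtain ⟨l, hl, rfl⟩ := hx
  refine ⟨l.support, hl, ?_⟩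
  rw [spanOn, Finsupp.mem_span_image_iff_linearCombination]
  exact ⟨l, (Finsupp.mem_supported A l).2 le_rfl, rfl⟩

theorem mem_spanOn_singleton {m : ℤ × ℤ → E} {f : ℤ × ℤ} {x : E} :
    x ∈ spanOn A m {f} ↔ ∃ a : A, x = a • m f := by
  rw [spanOn, Set.image_singleton, Submodule.mem_span_singleton]
  exact ⟨fun ⟨a, h⟩ => ⟨a, h.symm⟩, fun ⟨a, h⟩ => ⟨a, h.symm⟩⟩

theorem spanOn_empty_eq_zero {m : ℤ × ℤ → E} {x : E} (h : x ∈ spanOn A m ∅) : x = 0 := by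
  simpa [spanOn] using h

theorem spanOn_induction {m : ℤ × ℤ → E} {S : Set (ℤ × ℤ)} {N : Submodule A E}
    (h : ∀ f ∈ S, m f ∈ N) : spanOn A m S ≤ N :=
  Submodule.span_le.2 (by rintro _ ⟨f, hf, rfl⟩; exact h f hf)

namespace TwistedBasis

variable {c : ℤ × ℤ → ℤ × ℤ → Aˣ} {m : ℤ × ℤ → E}

theorem mul_mem (hm : TwistedBasis c m) {S S' U : Set (ℤ × ℤ)}
    (h : ∀ f ∈ S, ∀ g ∈ S', f + g ∈ U) {x y : E} (hx : x ∈ spanOn A m S)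
    (hy : y ∈ spanOn A m S') : x * y ∈ spanOn A m U := by
  have h2 : spanOn A m S * spanOn A m S' ≤ spanOn A m U := by
    rw [spanOn, spanOn, Submodule.span_mul_span, Submodule.span_le]
    rintro _ ⟨_, ⟨f, hf, rfl⟩, _, ⟨g, hg, rfl⟩, rfl⟩
    simp only [hm.mul]
    exact Submodule.smul_mem _ _ (mem_spanOn m (h f hf g hg))
  exact h2 (Submodule.mul_mem_mul hx hy)

theorem eq_zero_of_disjoint (hm : TwistedBasis c m) {S S' : Set (ℤ × ℤ)} (h : Disjoint S S')
    {x : E} (hx : x ∈ spanOn A m S) (hx' : x ∈ spanOn A m S') : x = 0 :=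
  Submodule.disjoint_def.1 (hm.li.disjoint_span_image h) x hx hx'

theorem one_mem (hm : TwistedBasis c m) : (1 : E) ∈ spanOn A m Set.univ :=
  hm.one ▸ mem_spanOn m (Set.mem_univ _)

theorem smul_neg_mul (hm : TwistedBasis c m) (f : ℤ × ℤ) :
    (((c (-f) f)⁻¹ : Aˣ) : A) • (m (-f) * m f) = 1 := by
  rw [hm.mul, neg_add_cancel, hm.one, smul_smul, Units.inv_mul, one_smul]

/-- The span of all members, as a subalgebra. -/
def torus (hm : TwistedBasis c m) : Subalgebra A E where
  carrier := spanOn A m Set.univ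
  mul_mem' := hm.mul_mem fun _ _ _ _ => Set.mem_univ _
  one_mem' := hm.one_mem
  add_mem' := Submodule.add_mem _
  zero_mem' := Submodule.zero_mem _
  algebraMap_mem' r := by
    rw [Algebra.algebraMap_eq_smul_one]
    exact Submodule.smul_mem _ _ hm.one_mem

end TwistedBasis

/-! ### Leading parts with respect to a degree on ℤ² -/

section Lead

variable {Γ : Type*} [AddCommGroup Γ] [LinearOrder Γ] [IsOrderedAddMonoid Γ]

/-- The element `h` is homogeneous of degree `γ` and `x - h` is a sum of terms of smaller degree. -/
structure HasLead (A : Type*) [CommRing A] [Algebra A E] (m : ℤ × ℤ → E) (d : ℤ × ℤ →+ Γ)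
    (γ : Γ) (h x : E) : Prop where
  lead : h ∈ spanOn A m {f | d f = γ}
  rest : x - h ∈ spanOn A m {f | d f < γ}

namespace HasLead

variable {m : ℤ × ℤ → E} {d : ℤ × ℤ →+ Γ} {γ δ : Γ} {h x k y : E}
variable {c : ℤ × ℤ → ℤ × ℤ → Aˣ}

theorem mem_le (hx : HasLead A m d γ h x) : x ∈ spanOn A m {f | d f ≤ γ} := by
  have := Submodule.add_mem _
    (spanOn_mono (S' := {f | d f ≤ γ}) (fun f (hf : d f = γ) => hf.le) hx.lead)
    (spanOn_mono (S' := {f | d f ≤ γ}) (fun f (hf : d f < γ) => hf.le) hx.rest)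
  rwa [add_sub_cancel] at this

theorem of_lead (hh : h ∈ spanOn A m {f | d f = γ}) : HasLead A m d γ h h :=
  ⟨hh, by simp⟩

theorem of_lt (hx : x ∈ spanOn A m {f | d f < γ}) : HasLead A m d γ 0 x :=
  ⟨Submodule.zero_mem _, by simpa using hx⟩

/-- The error splits as (x - h)y + h(y - k). A leading part is allowed to vanish, so nothing about
zero divisors enters here; in a division ring `h * k ≠ 0` is added where it is needed. -/
theorem mul (hm : TwistedBasis c m) (hx : HasLead A m d γ h x) (hy : HasLead A m d δ k y) :
    HasLead A m d (γ + δ) (h * k) (x * y) := by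
  refine ⟨hm.mul_mem ?_ hx.lead hy.lead, ?_⟩
  · intro f hf g hg
    simp only [Set.mem_ofPred_eq] at *
    rw [map_add, hf, hg]
  · have h1 : (x - h) * y ∈ spanOn A m {f | d f < γ + δ} :=
      hm.mul_mem (fun f hf g hg => by
        simp only [Set.mem_ofPred_eq] at *
        rw [map_add]; exact add_lt_add_of_lt_of_le hf hg) hx.rest hy.mem_le
    have h2 : h * (y - k) ∈ spanOn A m {f | d f < γ + δ} :=
      hm.mul_mem (fun f hf g hg => by
        simp only [Set.mem_ofPred_eq] at *
        rw [map_add]; exact add_lt_add_of_le_of_lt hf.le hg) hx.lead hy.rest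
    have := Submodule.add_mem _ h1 h2
    convert this using 1
    noncomm_ring

theorem one (hm : TwistedBasis c m) : HasLead A m d 0 1 1 :=
  of_lead (hm.one ▸ mem_spanOn m (map_zero d))

theorem pow (hm : TwistedBasis c m) (hx : HasLead A m d γ h x) (n : ℕ) :
    HasLead A m d (n • γ) (h ^ n) (x ^ n) := by
  induction n with
  | zero => simpa using one hm
  | succ n ih => simpa [pow_succ, succ_nsmul] using ih.mul hm hx

theorem unique (hm : TwistedBasis c m) (hx : HasLead A m d γ h x) (hy : HasLead A m d γ k x) :
    h = k := by
  rw [← sub_eq_zero]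
  refine hm.eq_zero_of_disjoint (S := {f | d f = γ}) (S' := {f | d f < γ}) ?_
    (Submodule.sub_mem _ hx.lead hy.lead) ?_
  · rw [Set.disjoint_left]
    intro f hf hf'
    exact absurd hf (ne_of_lt hf')
  · have := Submodule.sub_mem _ hy.rest hx.rest
    simpa using this

theorem add (hx : HasLead A m d γ h x) (hy : HasLead A m d γ k y) :
    HasLead A m d γ (h + k) (x + y) := by
  refine ⟨Submodule.add_mem _ hx.lead hy.lead, ?_⟩
  have := Submodule.add_mem _ hx.rest hy.rest
  convert this using 1
  abel

theorem smul (a : A) (hx : HasLead A m d γ h x) : HasLead A m d γ (a • h) (a • x) := by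
  refine ⟨Submodule.smul_mem _ _ hx.lead, ?_⟩
  rw [← smul_sub]
  exact Submodule.smul_mem _ _ hx.rest

theorem eq_zero_of_mem (hm : TwistedBasis c m) (hx : HasLead A m d γ h x) {S : Set (ℤ × ℤ)}
    (hS : ∀ f ∈ S, d f < γ) (h' : x ∈ spanOn A m S) : h = 0 :=
  hx.unique hm (of_lt (spanOn_mono hS h'))

theorem ne_zero (hm : TwistedBasis c m) (hx : HasLead A m d γ h x) (hh : h ≠ 0) : x ≠ 0 := by
  rintro rfl
  exact hh (hx.unique hm (of_lt (Submodule.zero_mem _)))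

/-- The degree of the leading part of an element of the span of `S` is attained in `S`. -/
theorem exists_mem (hm : TwistedBasis c m) (hx : HasLead A m d γ h x) (hh : h ≠ 0)
    {S : Set (ℤ × ℤ)} (h' : x ∈ spanOn A m S) : ∃ f ∈ S, γ ≤ d f := by
  by_contra! H
  exact hh (hx.eq_zero_of_mem hm H h')

end HasLead

/-- The family is not assumed independent, so the component of top degree may vanish; it is then
discarded and the argument repeated on a smaller index set. Both parts stay supported in `s`, which
later permits induction on the support. -/
theorem exists_hasLead_of_mem_finset (m : ℤ × ℤ → E) (d : ℤ × ℤ →+ Γ) (s : Finset (ℤ × ℤ)) :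
    ∀ {x : E}, x ∈ spanOn A m (s : Set (ℤ × ℤ)) → x ≠ 0 → ∃ γ h, h ≠ 0 ∧
      h ∈ spanOn A m {f | f ∈ s ∧ d f = γ} ∧ x - h ∈ spanOn A m {f | f ∈ s ∧ d f < γ} := by
  classical
  induction s using Finset.strongInduction with
  | H s ih =>
    intro x hx hx0
    rcases s.eq_empty_or_nonempty with rfl | hs
    · exact absurd (spanOn_empty_eq_zero (by simpa using hx)) hx0
    obtain ⟨f₀, hf₀, hmax⟩ := s.exists_max_image d hs
    obtain ⟨y, hy, z, hz, rfl⟩ := exists_add_of_mem_spanOn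
      (S₁ := {f | f ∈ s ∧ d f = d f₀}) (S₂ := {f | f ∈ s ∧ d f < d f₀})
      (fun f (hf : f ∈ s) => (hmax f hf).eq_or_lt.imp (fun h => ⟨hf, h⟩) (fun h => ⟨hf, h⟩)) hx
    by_cases hy0 : y = 0
    · subst hy0
      have hss : s.filter (fun f => d f < d f₀) ⊂ s :=
        Finset.filter_ssubset.2 ⟨f₀, hf₀, lt_irrefl _⟩
      rw [zero_add] at hx0
      obtain ⟨γ, h, h0, h1, h2⟩ := ih _ hss (x := z) (by simpa using hz) hx0
      refine ⟨γ, h, h0, spanOn_mono ?_ h1, ?_⟩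
      · intro f hf
        exact ⟨(Finset.mem_filter.1 hf.1).1, hf.2⟩
      · rw [zero_add]
        refine spanOn_mono ?_ h2
        intro f hf
        exact ⟨(Finset.mem_filter.1 hf.1).1, hf.2⟩
    · exact ⟨d f₀, y, hy0, hy, by simpa using hz⟩

theorem exists_hasLead (m : ℤ × ℤ → E) (d : ℤ × ℤ →+ Γ) {S : Set (ℤ × ℤ)} {x : E}
    (hx : x ∈ spanOn A m S) (hx0 : x ≠ 0) :
    ∃ γ h, h ≠ 0 ∧ h ∈ spanOn A m S ∧ HasLead A m d γ h x := by
  obtain ⟨s, hs, hx⟩ := exists_finset_of_mem_spanOn hx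
  obtain ⟨γ, h, h0, h1, h2⟩ := exists_hasLead_of_mem_finset m d s hx hx0
  exact ⟨γ, h, h0, spanOn_mono (fun f hf => hs hf.1) h1, spanOn_mono (fun f hf => hf.2) h1,
    spanOn_mono (fun f hf => hf.2) h2⟩

end Lead

/-- The degree on `ℤ²` with values in `ℤ²` with the lexicographic order. -/
def lexDegree : ℤ × ℤ →+ Lex (ℤ × ℤ) where
  toFun := toLex
  map_zero' := rfl
  map_add' _ _ := rfl

theorem lexDegree_injective : Function.Injective lexDegree := toLex.injective

/-- The leading part with respect to an injective degree is a multiple of a basis vector. -/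
theorem HasLead.exists_smul {Γ : Type*} [AddCommGroup Γ] [LinearOrder Γ] [IsOrderedAddMonoid Γ]
    {m : ℤ × ℤ → E} {d : ℤ × ℤ →+ Γ} (hd : Function.Injective d) {γ : Γ} {h x : E}
    (hx : HasLead A m d γ h x) (h0 : h ≠ 0) : ∃ f, γ = d f ∧ ∃ a : A, h = a • m f := by
  by_cases H : ∃ f, d f = γ
  · obtain ⟨f, rfl⟩ := H
    refine ⟨f, rfl, mem_spanOn_singleton.1 (spanOn_mono ?_ hx.lead)⟩
    intro g hg
    exact hd hg
  · refine absurd (spanOn_empty_eq_zero (A := A) (m := m) ?_) h0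
    refine spanOn_mono ?_ hx.lead
    intro g hg
    exact H ⟨g, hg⟩

/-- Families with pairwise distinct leading indices are linearly independent. -/
theorem linearIndependent_of_hasLead {Γ : Type*} [AddCommGroup Γ] [LinearOrder Γ]
    [IsOrderedAddMonoid Γ] {c : ℤ × ℤ → ℤ × ℤ → Aˣ} {m : ℤ × ℤ → E} (hm : TwistedBasis c m)
    {d : ℤ × ℤ →+ Γ} (hd : Function.Injective d) {ι : Type*} (b : ι → E) (e : ι → ℤ × ℤ)
    (he : Function.Injective e) (r : ι → Aˣ)
    (hb : ∀ i, HasLead A m d (d (e i)) ((r i : A) • m (e i)) (b i)) :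
    LinearIndependent A b := by
  classical
  rw [linearIndependent_iff']
  intro s g hg
  by_contra! H
  obtain ⟨i₁, hi₁, hgi₁⟩ := H
  obtain ⟨i₀, hi₀, hmax⟩ := (s.filter fun i => g i ≠ 0).exists_max_image (fun i => d (e i))
    ⟨i₁, Finset.mem_filter.2 ⟨hi₁, hgi₁⟩⟩
  rw [Finset.mem_filter] at hi₀
  have key : ∀ i ∈ s, i ≠ i₀ → g i • b i ∈ spanOn A m {f | d f < d (e i₀)} := by
    intro i hi hne
    by_cases h0 : g i = 0
    · simp [h0]
    have hle := hmax i (Finset.mem_filter.2 ⟨hi, h0⟩)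
    have hlt : d (e i) < d (e i₀) := lt_of_le_of_ne hle fun h => hne (he (hd h))
    refine Submodule.smul_mem _ _ (spanOn_mono ?_ (hb i).mem_le)
    intro f hf
    exact lt_of_le_of_lt hf hlt
  -- Among the nonzero coefficients, `i₀` has the largest leading degree. The vanishing sum
  -- therefore has leading part `g i₀ • r i₀ • m (e i₀)`, which must be zero.
  have h1 := ((hb i₀).smul (g i₀)).add (HasLead.of_lt (Submodule.sum_mem _
    (t := s.erase i₀) (f := fun i => g i • b i)
    fun i hi => key i (Finset.mem_of_mem_erase hi) (Finset.ne_of_mem_erase hi)))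
  rw [Finset.add_sum_erase s (fun i => g i • b i) hi₀.1, hg] at h1
  have h2 := h1.unique hm (HasLead.of_lt (Submodule.zero_mem _))
  rw [add_zero, smul_smul] at h2
  have h3 := (linearIndependent_iff'.1 hm.li) {e i₀} (fun _ => g i₀ * r i₀) (by simpa using h2)
    (e i₀) (Finset.mem_singleton_self _)
  exact hi₀.2 ((r i₀).isUnit.mul_left_eq_zero.1 h3)

end Twisted

/-! ## The presented algebra: monomials span -/

section Relations

variable {A : Type*} [CommRing A] {E : Type*} [Ring E] [Algebra A E]

/-- Four elements of an algebra that satisfy the defining relations of the presented algebra. -/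
structure A2Relations (q : Aˣ) (x1 x2 y1 y2 : E) : Prop where
  x2x1 : x2 * x1 = ((q ^ (-2 : ℤ) : Aˣ) : A) • (x1 * x2)
  y2x1 : y2 * x1 = ((q ^ (2 : ℤ) : Aˣ) : A) • (x1 * y2)
  x2y1 : x2 * y1 = ((q ^ (2 : ℤ) : Aˣ) : A) • (y1 * x2)
  x1y1 : x1 * y1 = 1 + (q : A) • x2
  y1x1 : y1 * x1 = 1 + ((q⁻¹ : Aˣ) : A) • x2
  x2y2 : x2 * y2 = 1 + ((q⁻¹ : Aˣ) : A) • x1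
  y2x2 : y2 * x2 = 1 + (q : A) • x1
  y2y1 : y2 * y1 = ((q ^ (-2 : ℤ) : Aˣ) : A) • (y1 * y2) +
    algebraMap A E (1 - ((q ^ (-2 : ℤ) : Aˣ) : A))

theorem mul_pow_of_mul_eq_smul {x y : E} {s : A} (h : x * y = s • (y * x)) (n : ℕ) :
    x * y ^ n = s ^ n • (y ^ n * x) := by
  induction n with
  | zero => simp
  | succ n ih =>
    rw [pow_succ, ← mul_assoc, ih, smul_mul_assoc, mul_assoc, h, mul_smul_comm, smul_smul,
      ← pow_succ, ← mul_assoc]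

theorem pow_mul_of_mul_eq_smul {x y : E} {s : A} (h : x * y = s • (y * x)) (n : ℕ) :
    x ^ n * y = s ^ n • (y * x ^ n) := by
  induction n with
  | zero => simp
  | succ n ih =>
    rw [pow_succ, mul_assoc, h, mul_smul_comm, ← mul_assoc, ih, smul_mul_assoc, smul_smul,
      mul_assoc, ← pow_succ']

theorem gen_relations (q : Aˣ) :
    A2Relations q (gen q Gen.x1) (gen q Gen.x2) (gen q Gen.y1) (gen q Gen.y2) := by
  constructor
  · simpa [gen] using RingQuot.mkAlgHom_rel A (Rel.x2x1 (q := q))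
  · simpa [gen] using RingQuot.mkAlgHom_rel A (Rel.y2x1 (q := q))
  · simpa [gen] using RingQuot.mkAlgHom_rel A (Rel.x2y1 (q := q))
  · simpa [gen] using RingQuot.mkAlgHom_rel A (Rel.x1y1 (q := q))
  · simpa [gen] using RingQuot.mkAlgHom_rel A (Rel.y1x1 (q := q))
  · simpa [gen] using RingQuot.mkAlgHom_rel A (Rel.x2y2 (q := q))
  · simpa [gen] using RingQuot.mkAlgHom_rel A (Rel.y2x2 (q := q))
  · have := RingQuot.mkAlgHom_rel A (Rel.y2y1 (q := q))
    simpa only [gen, map_mul, map_add, map_smul, AlgHom.commutes] using this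

theorem adjoin_gen (q : Aˣ) : Algebra.adjoin A
    {gen q Gen.x1, gen q Gen.x2, gen q Gen.y1, gen q Gen.y2} = ⊤ := by
  have h1 : Set.range (gen q : Gen → PresentedAlgebra q) =
      {gen q Gen.x1, gen q Gen.x2, gen q Gen.y1, gen q Gen.y2} := by
    ext x
    constructor
    · rintro ⟨g, rfl⟩
      cases g <;> simp
    · rintro (rfl | rfl | rfl | rfl) <;> exact ⟨_, rfl⟩
  have h2 : Set.range (gen q : Gen → PresentedAlgebra q) =
      RingQuot.mkAlgHom A (Rel q) '' Set.range (FreeAlgebra.ι A) := by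
    rw [← Set.range_comp]
    rfl
  rw [← h1, h2, ← AlgHom.map_adjoin, FreeAlgebra.adjoin_range_ι, Algebra.map_top,
    (AlgHom.range_eq_top _).2 (RingQuot.mkAlgHom_surjective A (Rel q))]

namespace A2Relations

variable {q : Aˣ} {x1 x2 y1 y2 : E}

/-- The homomorphism from the presented algebra given by elements that satisfy its relations. -/
noncomputable def toHom (h : A2Relations q x1 x2 y1 y2) : PresentedAlgebra q →ₐ[A] E :=
  RingQuot.liftAlgHom A ⟨FreeAlgebra.lift A fun g => match g with
      | Gen.x1 => x1
      | Gen.x2 => x2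
      | Gen.y1 => y1
      | Gen.y2 => y2, by
    intro a b hab
    cases hab
    · simpa using h.x2x1
    · simpa using h.y2x1
    · simpa using h.x2y1
    · simpa using h.x1y1
    · simpa using h.y1x1
    · simpa using h.x2y2
    · simpa using h.y2x2
    · simpa only [map_mul, map_add, map_smul, AlgHom.commutes, FreeAlgebra.lift_ι_apply]
        using h.y2y1⟩

theorem toHom_x1 (h : A2Relations q x1 x2 y1 y2) : h.toHom (gen q Gen.x1) = x1 := by
  simp [toHom, gen]

theorem toHom_x2 (h : A2Relations q x1 x2 y1 y2) : h.toHom (gen q Gen.x2) = x2 := by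
  simp [toHom, gen]

theorem toHom_y1 (h : A2Relations q x1 x2 y1 y2) : h.toHom (gen q Gen.y1) = y1 := by
  simp [toHom, gen]

theorem toHom_y2 (h : A2Relations q x1 x2 y1 y2) : h.toHom (gen q Gen.y2) = y2 := by
  simp [toHom, gen]

theorem range_toHom (h : A2Relations q x1 x2 y1 y2) :
    h.toHom.range = Algebra.adjoin A {x1, x2, y1, y2} := by
  rw [← Algebra.map_top, ← adjoin_gen, AlgHom.map_adjoin]
  simp only [Set.image_insert_eq, Set.image_singleton, toHom_x1, toHom_x2, toHom_y1, toHom_y2]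

theorem toHom_pbwMonomial (h : A2Relations q x1 x2 y1 y2) (p : PBWIndex) :
    h.toHom (pbwMonomial (gen q Gen.x1) (gen q Gen.x2) (gen q Gen.y1) (gen q Gen.y2) p) =
      pbwMonomial x1 x2 y1 y2 p := by
  simp only [pbwMonomial, map_mul, map_pow, toHom_x1, toHom_x2, toHom_y1, toHom_y2]

/-- Each of the replacements y₁x₁ = 1 + q⁻¹x₂ and x₂y₂ = 1 + q⁻¹x₁ shortens the word; the new letter
q-commutes to its place. Hence induction on the total length. -/
theorem word_mem (h : A2Relations q x1 x2 y1 y2) (n : ℕ) : ∀ a b c d : ℕ, a + b + c + d ≤ n →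
    y1 ^ a * x1 ^ b * x2 ^ c * y2 ^ d ∈
      Submodule.span A (Set.range (pbwMonomial x1 x2 y1 y2)) := by
  induction n with
  | zero =>
    intro a b c d hn
    obtain ⟨rfl, rfl, rfl, rfl⟩ : a = 0 ∧ b = 0 ∧ c = 0 ∧ d = 0 := by omega
    exact Submodule.subset_span ⟨⟨(0, 0, 0, 0), by simp⟩, rfl⟩
  | succ n ih =>
    intro a b c d hn
    by_cases hab : min a b = 0
    · by_cases hcd : min d c = 0
      · exact Submodule.subset_span ⟨⟨(a, b, c, d), hab, hcd⟩, rfl⟩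
      · obtain ⟨c, rfl⟩ : ∃ c', c = c' + 1 := ⟨c - 1, by omega⟩
        obtain ⟨d, rfl⟩ : ∃ d', d = d' + 1 := ⟨d - 1, by omega⟩
        have e : y1 ^ a * x1 ^ b * x2 ^ (c + 1) * y2 ^ (d + 1) =
            y1 ^ a * x1 ^ b * x2 ^ c * y2 ^ d +
              (((q⁻¹ : Aˣ) : A) * ((q ^ (-2 : ℤ) : Aˣ) : A) ^ c) •
                (y1 ^ a * x1 ^ (b + 1) * x2 ^ c * y2 ^ d) := by
          have h2 := pow_mul_of_mul_eq_smul h.x2x1 c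
          calc y1 ^ a * x1 ^ b * x2 ^ (c + 1) * y2 ^ (d + 1)
              = y1 ^ a * x1 ^ b * (x2 ^ c * (x2 * y2) * y2 ^ d) := by
                rw [pow_succ x2, pow_succ' y2]; simp only [mul_assoc]
            _ = y1 ^ a * x1 ^ b * (x2 ^ c * y2 ^ d) +
                ((q⁻¹ : Aˣ) : A) • (y1 ^ a * x1 ^ b * ((x2 ^ c * x1) * y2 ^ d)) := by
                rw [h.x2y2]
                simp only [mul_add, add_mul, mul_one, mul_smul_comm, smul_mul_assoc]
            _ = _ := by
                rw [h2, pow_succ x1]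
                simp only [mul_smul_comm, smul_mul_assoc, mul_assoc, smul_smul]
        rw [e]
        exact Submodule.add_mem _ (ih _ _ _ _ (by omega))
          (Submodule.smul_mem _ _ (ih _ _ _ _ (by omega)))
    · obtain ⟨a, rfl⟩ : ∃ a', a = a' + 1 := ⟨a - 1, by omega⟩
      obtain ⟨b, rfl⟩ : ∃ b', b = b' + 1 := ⟨b - 1, by omega⟩
      have e : y1 ^ (a + 1) * x1 ^ (b + 1) * x2 ^ c * y2 ^ d =
          y1 ^ a * x1 ^ b * x2 ^ c * y2 ^ d +
            (((q⁻¹ : Aˣ) : A) * ((q ^ (-2 : ℤ) : Aˣ) : A) ^ b) •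
              (y1 ^ a * x1 ^ b * x2 ^ (c + 1) * y2 ^ d) := by
        have h2 := mul_pow_of_mul_eq_smul h.x2x1 b
        calc y1 ^ (a + 1) * x1 ^ (b + 1) * x2 ^ c * y2 ^ d
            = y1 ^ a * ((y1 * x1) * x1 ^ b) * x2 ^ c * y2 ^ d := by
              rw [pow_succ y1, pow_succ' x1]; simp only [mul_assoc]
          _ = y1 ^ a * x1 ^ b * x2 ^ c * y2 ^ d +
              ((q⁻¹ : Aˣ) : A) • (y1 ^ a * (x2 * x1 ^ b) * x2 ^ c * y2 ^ d) := by
              rw [h.y1x1]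
              simp only [mul_add, add_mul, one_mul, mul_smul_comm, smul_mul_assoc]
          _ = _ := by
              rw [h2, pow_succ' x2]
              simp only [mul_smul_comm, smul_mul_assoc, mul_assoc, smul_smul]
      rw [e]
      exact Submodule.add_mem _ (ih _ _ _ _ (by omega))
        (Submodule.smul_mem _ _ (ih _ _ _ _ (by omega)))

theorem word_mem' (h : A2Relations q x1 x2 y1 y2) (a b c d : ℕ) :
    y1 ^ a * x1 ^ b * x2 ^ c * y2 ^ d ∈
      Submodule.span A (Set.range (pbwMonomial x1 x2 y1 y2)) :=
  h.word_mem _ a b c d le_rfl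

theorem mul_mem_span {x : E} (hx : ∀ a b c d : ℕ, x * (y1 ^ a * x1 ^ b * x2 ^ c * y2 ^ d) ∈
      Submodule.span A (Set.range (pbwMonomial x1 x2 y1 y2))) {y : E}
    (hy : y ∈ Submodule.span A (Set.range (pbwMonomial x1 x2 y1 y2))) :
    x * y ∈ Submodule.span A (Set.range (pbwMonomial x1 x2 y1 y2)) := by
  have : Submodule.span A (Set.range (pbwMonomial x1 x2 y1 y2)) ≤
      (Submodule.span A (Set.range (pbwMonomial x1 x2 y1 y2))).comap (LinearMap.mulLeft A x) := by
    rw [Submodule.span_le]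
    rintro _ ⟨p, rfl⟩
    exact hx _ _ _ _
  exact this hy

theorem y1_mul_mem (h : A2Relations q x1 x2 y1 y2) {y : E}
    (hy : y ∈ Submodule.span A (Set.range (pbwMonomial x1 x2 y1 y2))) :
    y1 * y ∈ Submodule.span A (Set.range (pbwMonomial x1 x2 y1 y2)) := by
  refine mul_mem_span (fun a b c d => ?_) hy
  have := h.word_mem' (a + 1) b c d
  rwa [pow_succ', mul_assoc, mul_assoc, mul_assoc, ← mul_assoc (y1 ^ a), ← mul_assoc (y1 ^ a * _)]
    at this

theorem x2_mul_word (h : A2Relations q x1 x2 y1 y2) (a b c d : ℕ) :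
    x2 * (y1 ^ a * x1 ^ b * x2 ^ c * y2 ^ d) =
      (((q ^ (2 : ℤ) : Aˣ) : A) ^ a * ((q ^ (-2 : ℤ) : Aˣ) : A) ^ b) •
        (y1 ^ a * x1 ^ b * x2 ^ (c + 1) * y2 ^ d) := by
  calc x2 * (y1 ^ a * x1 ^ b * x2 ^ c * y2 ^ d)
      = (x2 * y1 ^ a) * (x1 ^ b * x2 ^ c * y2 ^ d) := by simp only [mul_assoc]
    _ = ((q ^ (2 : ℤ) : Aˣ) : A) ^ a • (y1 ^ a * (x2 * x1 ^ b) * (x2 ^ c * y2 ^ d)) := by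
        rw [mul_pow_of_mul_eq_smul h.x2y1]
        simp only [smul_mul_assoc, mul_assoc]
    _ = _ := by
        rw [mul_pow_of_mul_eq_smul h.x2x1, pow_succ' x2]
        simp only [mul_smul_comm, smul_mul_assoc, mul_assoc, smul_smul]

theorem x2_mul_mem (h : A2Relations q x1 x2 y1 y2) {y : E}
    (hy : y ∈ Submodule.span A (Set.range (pbwMonomial x1 x2 y1 y2))) :
    x2 * y ∈ Submodule.span A (Set.range (pbwMonomial x1 x2 y1 y2)) := by
  refine mul_mem_span (fun a b c d => ?_) hy
  rw [h.x2_mul_word]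
  exact Submodule.smul_mem _ _ (h.word_mem' _ _ _ _)

theorem x1_mul_mem (h : A2Relations q x1 x2 y1 y2) {y : E}
    (hy : y ∈ Submodule.span A (Set.range (pbwMonomial x1 x2 y1 y2))) :
    x1 * y ∈ Submodule.span A (Set.range (pbwMonomial x1 x2 y1 y2)) := by
  refine mul_mem_span (fun a b c d => ?_) hy
  cases a with
  | zero =>
    have := h.word_mem' 0 (b + 1) c d
    simpa only [pow_zero, one_mul, pow_succ' x1, mul_assoc] using this
  | succ a =>
    have e : x1 * (y1 ^ (a + 1) * x1 ^ b * x2 ^ c * y2 ^ d) =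
        y1 ^ a * x1 ^ b * x2 ^ c * y2 ^ d +
          (q : A) • (x2 * (y1 ^ a * x1 ^ b * x2 ^ c * y2 ^ d)) := by
      calc x1 * (y1 ^ (a + 1) * x1 ^ b * x2 ^ c * y2 ^ d)
          = (x1 * y1) * (y1 ^ a * x1 ^ b * x2 ^ c * y2 ^ d) := by
            rw [pow_succ']; simp only [mul_assoc]
        _ = _ := by rw [h.x1y1, add_mul, one_mul, smul_mul_assoc]
    rw [e]
    exact Submodule.add_mem _ (h.word_mem' _ _ _ _)
      (Submodule.smul_mem _ _ (h.x2_mul_mem (h.word_mem' _ _ _ _)))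

theorem y2_mul_mem (h : A2Relations q x1 x2 y1 y2) {y : E}
    (hy : y ∈ Submodule.span A (Set.range (pbwMonomial x1 x2 y1 y2))) :
    y2 * y ∈ Submodule.span A (Set.range (pbwMonomial x1 x2 y1 y2)) := by
  refine mul_mem_span (fun a b c d => ?_) hy
  -- The relation for y₂y₁ moves y₂ past one y₁ and leaves a shorter word. Once no y₁ remains, y₂
  -- q-commutes past x₁ and then either joins the final power of y₂ or cancels against one x₂.
  induction a with
  | zero =>
    have e : y2 * (y1 ^ 0 * x1 ^ b * x2 ^ c * y2 ^ d) =
        ((q ^ (2 : ℤ) : Aˣ) : A) ^ b • (x1 ^ b * (y2 * (x2 ^ c * y2 ^ d))) := by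
      calc y2 * (y1 ^ 0 * x1 ^ b * x2 ^ c * y2 ^ d)
          = (y2 * x1 ^ b) * (x2 ^ c * y2 ^ d) := by simp only [pow_zero, one_mul, mul_assoc]
        _ = _ := by
          rw [mul_pow_of_mul_eq_smul h.y2x1]
          simp only [smul_mul_assoc, mul_assoc]
    rw [e]
    refine Submodule.smul_mem _ _ ?_
    cases c with
    | zero =>
      have := h.word_mem' 0 b 0 (d + 1)
      simpa only [pow_zero, one_mul, mul_one, pow_succ' y2, mul_assoc] using this
    | succ c =>
      have e2 : x1 ^ b * (y2 * (x2 ^ (c + 1) * y2 ^ d)) =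
          y1 ^ 0 * x1 ^ b * x2 ^ c * y2 ^ d +
            (q : A) • (y1 ^ 0 * x1 ^ (b + 1) * x2 ^ c * y2 ^ d) := by
        calc x1 ^ b * (y2 * (x2 ^ (c + 1) * y2 ^ d))
            = x1 ^ b * ((y2 * x2) * (x2 ^ c * y2 ^ d)) := by
              rw [pow_succ']; simp only [mul_assoc]
          _ = _ := by
              rw [h.y2x2, pow_succ x1]
              simp only [add_mul, mul_add, one_mul, pow_zero, smul_mul_assoc, mul_smul_comm,
                mul_assoc]
      rw [e2]
      exact Submodule.add_mem _ (h.word_mem' _ _ _ _)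
        (Submodule.smul_mem _ _ (h.word_mem' _ _ _ _))
  | succ a ih =>
    have e : y2 * (y1 ^ (a + 1) * x1 ^ b * x2 ^ c * y2 ^ d) =
        ((q ^ (-2 : ℤ) : Aˣ) : A) • (y1 * (y2 * (y1 ^ a * x1 ^ b * x2 ^ c * y2 ^ d))) +
          (1 - ((q ^ (-2 : ℤ) : Aˣ) : A)) • (y1 ^ a * x1 ^ b * x2 ^ c * y2 ^ d) := by
      calc y2 * (y1 ^ (a + 1) * x1 ^ b * x2 ^ c * y2 ^ d)
          = (y2 * y1) * (y1 ^ a * x1 ^ b * x2 ^ c * y2 ^ d) := by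
            rw [pow_succ']; simp only [mul_assoc]
        _ = _ := by
          rw [h.y2y1, add_mul, smul_mul_assoc, mul_assoc, Algebra.smul_def (1 - _ : A)]
    rw [e]
    exact Submodule.add_mem _ (Submodule.smul_mem _ _ (h.y1_mul_mem ih))
      (Submodule.smul_mem _ _ (h.word_mem' _ _ _ _))

/-- The span contains 1 and is stable under left multiplication by the four generators, hence by
everything they generate. -/
theorem span_pbwMonomial (h : A2Relations q x1 x2 y1 y2) :
    Submodule.span A (Set.range (pbwMonomial x1 x2 y1 y2)) =
      Subalgebra.toSubmodule (Algebra.adjoin A {x1, x2, y1, y2}) := by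
  apply le_antisymm
  · rw [Submodule.span_le]
    rintro _ ⟨p, rfl⟩
    have hs : ∀ {t}, t ∈ ({x1, x2, y1, y2} : Set E) → t ∈ Algebra.adjoin A {x1, x2, y1, y2} :=
      fun ht => Algebra.subset_adjoin ht
    change pbwMonomial x1 x2 y1 y2 p ∈ Algebra.adjoin A {x1, x2, y1, y2}
    exact mul_mem (mul_mem (mul_mem (pow_mem (hs (by simp)) _) (pow_mem (hs (by simp)) _))
      (pow_mem (hs (by simp)) _)) (pow_mem (hs (by simp)) _)
  · intro x hx
    have key : ∀ y ∈ Submodule.span A (Set.range (pbwMonomial x1 x2 y1 y2)),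
        x * y ∈ Submodule.span A (Set.range (pbwMonomial x1 x2 y1 y2)) := by
      rw [Subalgebra.mem_toSubmodule] at hx
      induction hx using Algebra.adjoin_induction with
      | mem x hx =>
        rcases hx with rfl | rfl | rfl | rfl
        · exact fun y => h.x1_mul_mem
        · exact fun y => h.x2_mul_mem
        · exact fun y => h.y1_mul_mem
        · exact fun y => h.y2_mul_mem
      | algebraMap r =>
        intro y hy
        rw [← Algebra.smul_def]
        exact Submodule.smul_mem _ _ hy
      | add x x' _ _ hx hx' =>
        intro y hy
        rw [add_mul]
        exact Submodule.add_mem _ (hx y hy) (hx' y hy)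
      | mul x x' _ _ hx hx' =>
        intro y hy
        rw [mul_assoc]
        exact hx _ (hx' y hy)
    have := key 1 (by simpa using h.word_mem' 0 0 0 0)
    rwa [mul_one] at this

/-- If the monomials are linearly independent in some algebra, they form a basis of the presented
algebra. -/
noncomputable def pbwBasis (h : A2Relations q x1 x2 y1 y2)
    (li : LinearIndependent A (pbwMonomial x1 x2 y1 y2)) :
    Module.Basis PBWIndex A (PresentedAlgebra q) :=
  Module.Basis.mk
    (v := pbwMonomial (gen q Gen.x1) (gen q Gen.x2) (gen q Gen.y1) (gen q Gen.y2))
    (LinearIndependent.of_comp h.toHom.toLinearMap (by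
      convert li using 1
      ext p
      exact h.toHom_pbwMonomial p))
    (by rw [(gen_relations q).span_pbwMonomial, adjoin_gen]; simp)

theorem pbwBasis_apply (h : A2Relations q x1 x2 y1 y2)
    (li : LinearIndependent A (pbwMonomial x1 x2 y1 y2)) (p : PBWIndex) :
    h.pbwBasis li p =
      pbwMonomial (gen q Gen.x1) (gen q Gen.x2) (gen q Gen.y1) (gen q Gen.y2) p :=
  Module.Basis.mk_apply _ _ _

/-- A basis of the source is carried to an independent family. -/
theorem toHom_injective (h : A2Relations q x1 x2 y1 y2)
    (li : LinearIndependent A (pbwMonomial x1 x2 y1 y2)) : Function.Injective h.toHom := by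
  rw [injective_iff_map_eq_zero]
  intro x hx
  have h2 : Finsupp.linearCombination A (pbwMonomial x1 x2 y1 y2) ((h.pbwBasis li).repr x) = 0 := by
    rw [← hx]
    conv_rhs => rw [← (h.pbwBasis li).linearCombination_repr x]
    rw [← AlgHom.toLinearMap_apply, Finsupp.apply_linearCombination]
    congr 2
    ext p
    simp only [Function.comp, pbwBasis_apply, AlgHom.toLinearMap_apply, toHom_pbwMonomial]
  have h3 : (h.pbwBasis li).repr x = 0 := by
    rw [LinearIndependent] at li
    exact li (by rw [h2, map_zero])
  simpa using h3

end A2Relations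

end Relations

/-! ## Quasi-commuting pairs and seeds -/

section Powers

variable {A : Type*} [CommRing A] {ℓ : ℕ}

/-- `epsPow` is defined through a chosen representative of the residue class; q^ℓ = 1 makes the
choice irrelevant. -/
theorem epsPow_intCast {q : Aˣ} (hq : q ^ ℓ = 1) (n : ℤ) :
    epsPow q (n : ZMod ℓ) = ((q ^ n : Aˣ) : A) := by
  rw [epsPow, ZMod.coe_intCast]
  congr 1
  conv_rhs => rw [← Int.emod_add_mul_ediv n ℓ, zpow_add, zpow_mul, zpow_natCast, hq, one_zpow,
    mul_one]

variable {F : Type*} [DivisionRing F] [Algebra A F]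

theorem mul_zpow_of_mul_eq_smul {x y : F} {s : Aˣ} (h : x * y = (s : A) • (y * x)) (n : ℤ) :
    x * y ^ n = ((s ^ n : Aˣ) : A) • (y ^ n * x) := by
  have hnat : ∀ n : ℕ, x * y ^ n = ((s ^ n : Aˣ) : A) • (y ^ n * x) := fun n => by
    rw [mul_pow_of_mul_eq_smul h]; push_cast; rfl
  rcases eq_or_ne y 0 with rfl | hy
  · rcases eq_or_ne n 0 with rfl | hn
    · simp
    · simp [zero_zpow _ hn]
  cases n with
  | ofNat n => simpa using hnat n
  | negSucc n =>
    rw [zpow_negSucc, zpow_negSucc]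
    have h1 := hnat (n + 1)
    have hy' : y ^ (n + 1) ≠ 0 := pow_ne_zero _ hy
    -- Negative exponents: the relation for the positive power is multiplied by its inverse on both
    -- sides.
    have h2 : (y ^ (n + 1))⁻¹ * (x * y ^ (n + 1)) * (y ^ (n + 1))⁻¹ =
      (y ^ (n + 1))⁻¹ * (((s ^ (n + 1) : Aˣ) : A) • (y ^ (n + 1) * x)) * (y ^ (n + 1))⁻¹ := by
      rw [h1]
    rw [mul_smul_comm, smul_mul_assoc, inv_mul_cancel_left₀ hy', mul_assoc,
      mul_inv_cancel_right₀ hy'] at h2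
    rw [h2, smul_smul, Units.inv_mul, one_smul]

theorem smul_symm {x y : F} {s : Aˣ} (h : x * y = (s : A) • (y * x)) :
    y * x = ((s⁻¹ : Aˣ) : A) • (x * y) := by
  rw [h, smul_smul, Units.inv_mul, one_smul]

theorem zpow_mul_of_mul_eq_smul {x y : F} {s : Aˣ} (h : x * y = (s : A) • (y * x)) (n : ℤ) :
    x ^ n * y = ((s ^ n : Aˣ) : A) • (y * x ^ n) := by
  have := smul_symm (mul_zpow_of_mul_eq_smul (smul_symm h) n)
  rwa [inv_zpow, inv_inv] at this

theorem zpow_mul_zpow_of_mul_eq_smul {x y : F} {s : Aˣ} (h : x * y = (s : A) • (y * x))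
    (i j : ℤ) : x ^ i * y ^ j = ((s ^ (i * j) : Aˣ) : A) • (y ^ j * x ^ i) := by
  rw [mul_zpow_of_mul_eq_smul (zpow_mul_of_mul_eq_smul h i) j, zpow_mul]

/-- The monomials `u^i v^j` of a pair of elements of a division ring. -/
def mon (u v : F) (p : ℤ × ℤ) : F := u ^ p.1 * v ^ p.2

/-- A pair of nonzero elements that commute up to a unit `s`. -/
structure QuasiComm (s : Aˣ) (u v : F) : Prop where
  left_ne : u ≠ 0
  right_ne : v ≠ 0
  comm : u * v = (s : A) • (v * u)

namespace QuasiComm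

variable {s : Aˣ} {u v : F}

theorem symm (h : QuasiComm s u v) : QuasiComm s⁻¹ v u :=
  ⟨h.right_ne, h.left_ne, smul_symm h.comm⟩

theorem zpow_comm (h : QuasiComm s u v) (i j : ℤ) :
    u ^ i * v ^ j = ((s ^ (i * j) : Aˣ) : A) • (v ^ j * u ^ i) :=
  zpow_mul_zpow_of_mul_eq_smul h.comm i j

theorem mon_mul (h : QuasiComm s u v) (f g : ℤ × ℤ) :
    mon u v f * mon u v g = ((s ^ (-(g.1 * f.2)) : Aˣ) : A) • mon u v (f + g) := by
  have e : v ^ f.2 * u ^ g.1 = ((s ^ (-(g.1 * f.2)) : Aˣ) : A) • (u ^ g.1 * v ^ f.2) := by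
    rw [zpow_neg]
    exact smul_symm (h.zpow_comm _ _)
  calc mon u v f * mon u v g = u ^ f.1 * (v ^ f.2 * u ^ g.1) * v ^ g.2 := by
        simp only [mon, mul_assoc]
    _ = _ := by
        rw [e, mon, Prod.fst_add, Prod.snd_add, zpow_add₀ h.left_ne, zpow_add₀ h.right_ne]
        simp only [mul_smul_comm, smul_mul_assoc, mul_assoc]

theorem mon_ne_zero (h : QuasiComm s u v) (p : ℤ × ℤ) : mon u v p ≠ 0 :=
  mul_ne_zero (zpow_ne_zero _ h.left_ne) (zpow_ne_zero _ h.right_ne)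

theorem twistedBasis (h : QuasiComm s u v) (li : LinearIndependent A (mon u v)) :
    TwistedBasis (fun f g => s ^ (-(g.1 * f.2))) (mon u v) where
  one := by simp [mon]
  mul := h.mon_mul
  li := li

end QuasiComm

/-- The toric frame with values `u` and `v` at the standard basis vectors. -/
def normFrame (t : Aˣ) (u v : F) : (Fin 2 → ℤ) → F := fun f =>
  ((t ^ (-(f 0 * f 1)) : Aˣ) : A) • (u ^ f 0 * v ^ f 1)

theorem normFrame_eq (t : Aˣ) (u v : F) (i j : ℤ) :
    normFrame t u v ![i, j] = ((t ^ (-(i * j)) : Aˣ) : A) • (u ^ i * v ^ j) := rfl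

/-- The normalising scalars are units, so the frame and the bare monomials have the same span, and
quasi-commutation closes this span under products. -/
theorem quantumTorus_normFrame (t : Aˣ) {s : Aˣ} {u v : F} (h : QuasiComm s u v) :
    Subalgebra.toSubmodule (quantumTorus A (normFrame t u v)) = spanOn A (mon u v) Set.univ := by
  apply le_antisymm
  · intro x hx
    rw [Subalgebra.mem_toSubmodule] at hx
    induction hx using Algebra.adjoin_induction with
    | mem x hx =>
      obtain ⟨f, rfl⟩ := hx
      exact Submodule.smul_mem _ _ (mem_spanOn (mon u v) (f := (f 0, f 1)) (Set.mem_univ _))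
    | algebraMap r =>
      rw [Algebra.algebraMap_eq_smul_one]
      refine Submodule.smul_mem _ _ ?_
      have := mem_spanOn (A := A) (mon u v) (f := (0, 0)) (Set.mem_univ _)
      simpa [mon] using this
    | add x y _ _ hx hy => exact Submodule.add_mem _ hx hy
    | mul x y _ _ hx hy =>
      have : spanOn A (mon u v) Set.univ * spanOn A (mon u v) Set.univ ≤
          spanOn A (mon u v) Set.univ := by
        rw [spanOn, Submodule.span_mul_span, Submodule.span_le]
        rintro _ ⟨_, ⟨f, -, rfl⟩, _, ⟨g, -, rfl⟩, rfl⟩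
        simp only [h.mon_mul]
        exact Submodule.smul_mem _ _ (mem_spanOn _ (Set.mem_univ _))
      exact this (Submodule.mul_mem_mul hx hy)
  · refine spanOn_induction fun f _ => ?_
    have h1 : normFrame t u v ![f.1, f.2] ∈ quantumTorus A (normFrame t u v) :=
      Algebra.subset_adjoin ⟨_, rfl⟩
    rw [normFrame_eq] at h1
    have h2 := Subalgebra.smul_mem _ h1 (((t ^ (-(f.1 * f.2)))⁻¹ : Aˣ) : A)
    rwa [smul_smul, Units.inv_mul, one_smul] at h2

theorem mem_quantumTorus_normFrame (t : Aˣ) {s : Aˣ} {u v : F} (h : QuasiComm s u v) {x : F} :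
    x ∈ quantumTorus A (normFrame t u v) ↔ x ∈ spanOn A (mon u v) Set.univ := by
  rw [← quantumTorus_normFrame t h, Subalgebra.mem_toSubmodule]

/-- The seed of type `A₂` with sign `s = ±1` and cluster `(u, v)`. -/
def signedSeed (ℓ : ℕ) (q : Aˣ) (s : ℤ) (u v : F) : Seed (Fin 2) ℓ F where
  frame := normFrame (q ^ s) u v
  form := (s : ZMod ℓ) • formA2 ℓ
  exch := s • exchA2

/-- Changing the sign of the exchange matrix swaps `posVec` and `negVec`, so the same two exponents
occur for both signs. -/
theorem newVar_zero (q : Aˣ) {s : ℤ} (hs : s = 1 ∨ s = -1) (u v : F) :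
    newVar 0 (signedSeed ℓ q s u v) =
      normFrame (q ^ s) u v ![-1, 1] + normFrame (q ^ s) u v ![-1, 0] := by
  have e1 : posVec (0 : Fin 2) exchA2 = ![-1, 0] := by
    ext i; fin_cases i <;> simp [posVec, exchA2, stdVec]
  have e2 : negVec (0 : Fin 2) exchA2 = ![-1, 1] := by
    ext i; fin_cases i <;> simp [negVec, exchA2, stdVec]
  have e3 : posVec (0 : Fin 2) (-exchA2) = ![-1, 1] := by
    ext i; fin_cases i <;> simp [posVec, exchA2, stdVec]
  have e4 : negVec (0 : Fin 2) (-exchA2) = ![-1, 0] := by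
    ext i; fin_cases i <;> simp [negVec, exchA2, stdVec]
  rcases hs with rfl | rfl
  · simp only [newVar, signedSeed, one_smul, e1, e2]
    rw [add_comm]
  · simp only [newVar, signedSeed, neg_smul, one_smul, e3, e4]

theorem newVar_one (q : Aˣ) {s : ℤ} (hs : s = 1 ∨ s = -1) (u v : F) :
    newVar 1 (signedSeed ℓ q s u v) =
      normFrame (q ^ s) u v ![1, -1] + normFrame (q ^ s) u v ![0, -1] := by
  have e1 : posVec (1 : Fin 2) exchA2 = ![1, -1] := by
    ext i; fin_cases i <;> simp [posVec, exchA2, stdVec]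
  have e2 : negVec (1 : Fin 2) exchA2 = ![0, -1] := by
    ext i; fin_cases i <;> simp [negVec, exchA2, stdVec]
  have e3 : posVec (1 : Fin 2) (-exchA2) = ![0, -1] := by
    ext i; fin_cases i <;> simp [posVec, exchA2, stdVec]
  have e4 : negVec (1 : Fin 2) (-exchA2) = ![1, -1] := by
    ext i; fin_cases i <;> simp [negVec, exchA2, stdVec]
  rcases hs with rfl | rfl
  · simp only [newVar, signedSeed, one_smul, e1, e2]
  · simp only [newVar, signedSeed, neg_smul, one_smul, e3, e4]
    rw [add_comm]

theorem mutForm_signedSeed (q : Aˣ) {s : ℤ} (hs : s = 1 ∨ s = -1) (u v : F) (k : Fin 2) :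
    mutForm k (signedSeed ℓ q s u v) = ((-s : ℤ) : ZMod ℓ) • formA2 ℓ := by
  ext i j
  rcases hs with rfl | rfl <;> fin_cases k <;> fin_cases i <;> fin_cases j <;>
    simp [mutForm, signedSeed, bichar, formA2, posVec, exchA2, stdVec, Fin.sum_univ_two]

theorem mutExch_signedSeed {s : ℤ} (hs : s = 1 ∨ s = -1) (k : Fin 2) :
    mutExch k (s • exchA2) = (-s) • exchA2 := by
  ext i j
  rcases hs with rfl | rfl <;> fin_cases k <;> fin_cases i <;> fin_cases j <;>
    simp [mutExch, exchA2]

theorem bichar_formA2 (s : ℤ) (f g : Fin 2 → ℤ) :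
    bichar ((s : ZMod ℓ) • formA2 ℓ) f g = ((s * (f 0 * g 1 - f 1 * g 0) : ℤ) : ZMod ℓ) := by
  simp [bichar, formA2, exchA2, Fin.sum_univ_two]
  ring

theorem seed_ext {s t : Seed (Fin 2) ℓ F} (h1 : s.frame = t.frame) (h2 : s.form = t.form)
    (h3 : s.exch = t.exch) : s = t := by
  cases s; cases t; simp_all

/-- The exchange relation identifies u' as the new variable, and both matrices change sign.
Quasi-commutation of u' and v is needed because the mutated frame puts the power of the new variable
on the right, while `normFrame` puts the first variable on the left; in direction 1 the two orders
agree. -/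
theorem mutate_zero {q : Aˣ} (hq : q ^ ℓ = 1) {s : ℤ} (hs : s = 1 ∨ s = -1) {u v u' : F}
    (hu : u ≠ 0) (h : u * u' = 1 + ((q ^ s : Aˣ) : A) • v)
    (h' : QuasiComm (q ^ (-(2 * s))) u' v) :
    (signedSeed ℓ q s u v).mutate q 0 = signedSeed ℓ q (-s) u' v := by
  have hnew : newVar 0 (signedSeed ℓ q s u v) = u' := by
    rw [newVar_zero q hs, normFrame_eq, normFrame_eq]
    have : u' = u⁻¹ * (1 + ((q ^ s : Aˣ) : A) • v) := by rw [← h, inv_mul_cancel_left₀ hu]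
    rw [this]
    simp [mul_add, add_comm]
  apply seed_ext
  · ext f
    have e : Function.update f 0 0 = ![0, f 1] := by
      ext i; fin_cases i <;> simp
    simp only [Seed.mutate, mutFrame, mutForm_signedSeed q hs, hnew, bichar_formA2]
    rw [← Int.cast_neg, epsPow_intCast hq, e]
    simp only [signedSeed, normFrame_eq]
    rw [normFrame]
    have h2 := h'.symm.zpow_comm (f 1) (f 0)
    simp only [zero_mul, neg_zero, zpow_zero, Units.val_one, one_smul, one_mul]
    rw [h2, smul_smul, ← Units.val_mul]
    congr 2
    rw [← zpow_neg, ← zpow_mul, ← zpow_mul, ← zpow_add]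
    congr 1
    simp [stdVec]
    ring
  · exact mutForm_signedSeed q hs u v 0
  · exact mutExch_signedSeed hs 0

theorem mutate_one {q : Aˣ} (hq : q ^ ℓ = 1) {s : ℤ} (hs : s = 1 ∨ s = -1) {u v v' : F}
    (hv : v ≠ 0) (h : v' * v = 1 + ((q ^ s : Aˣ) : A) • u) :
    (signedSeed ℓ q s u v).mutate q 1 = signedSeed ℓ q (-s) u v' := by
  have hnew : newVar 1 (signedSeed ℓ q s u v) = v' := by
    rw [newVar_one q hs, normFrame_eq, normFrame_eq]
    have : v' = (1 + ((q ^ s : Aˣ) : A) • u) * v⁻¹ := by rw [← h, mul_inv_cancel_right₀ hv]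
    rw [this]
    simp [add_mul, add_comm]
  apply seed_ext
  · ext f
    have e : Function.update f 1 0 = ![f 0, 0] := by
      ext i; fin_cases i <;> simp
    simp only [Seed.mutate, mutFrame, mutForm_signedSeed q hs, hnew, bichar_formA2]
    rw [← Int.cast_neg, epsPow_intCast hq, e]
    simp only [signedSeed, normFrame_eq]
    rw [normFrame]
    simp only [mul_zero, neg_zero, zpow_zero, Units.val_one, one_smul, mul_one]
    congr 2
    rw [← zpow_mul]
    congr 1
    simp [stdVec]
  · exact mutForm_signedSeed q hs u v 1
  · exact mutExch_signedSeed hs 1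

end Powers

/-! ## The five cluster variables of type `A₂` -/

section Pentagon

variable {A : Type*} [CommRing A] {F : Type*} [DivisionRing F] [Algebra A F] {ℓ : ℕ}

/-- The cyclically ordered cluster variables of type `A₂`. -/
structure Pentagon (q : Aˣ) (z : Fin 5 → F) : Prop where
  ne : ∀ i, z i ≠ 0
  comm : ∀ i, z i * z (i + 1) = ((q ^ (2 : ℤ) : Aˣ) : A) • (z (i + 1) * z i)
  left : ∀ i, z i * z (i + 2) = 1 + (q : A) • z (i + 1)
  right : ∀ i, z (i + 2) * z i = 1 + ((q⁻¹ : Aˣ) : A) • z (i + 1)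

namespace A2Relations

variable {q : Aˣ} {x1 x2 y1 y2 : F}

/-- The relation z₃z₀ = 1 + q z₄ forces z₄ = q⁻¹(y₁y₂ - 1). All other relations follow by reducing
products with y₁y₂ to ordered words. The variables y₁, y₂ and z₄ are nonzero because each divides
one of the elements 1 + q z assumed nonzero. -/
theorem pentagon (h : A2Relations q x1 x2 y1 y2)
    (hx1 : x1 ≠ 0) (hx2 : x2 ≠ 0) (hy1 : 1 + (q : A) • y1 ≠ 0) (hx1' : 1 + (q : A) • x1 ≠ 0)
    (hx2' : 1 + (q : A) • x2 ≠ 0) :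
    Pentagon q ![y2, x1, x2, y1, ((q⁻¹ : Aˣ) : A) • (y1 * y2 - 1)] := by
  have e1 : (q : A) * ((q⁻¹ : Aˣ) : A) = 1 := q.mul_inv
  have e2 : ((q ^ (2 : ℤ) : Aˣ) : A) = (q : A) * q := by
    rw [zpow_ofNat, Units.val_pow_eq_pow_val, sq]
  have e3 : ((q ^ (-2 : ℤ) : Aˣ) : A) = ((q⁻¹ : Aˣ) : A) * ((q⁻¹ : Aˣ) : A) := by
    rw [zpow_neg, ← inv_zpow, zpow_ofNat, Units.val_pow_eq_pow_val, sq]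
  obtain ⟨h1, h2, h3, h4, h5, h6, h7, h8⟩ := h
  rw [e2] at h2 h3
  rw [e3] at h1 h8
  rw [Algebra.algebraMap_eq_smul_one] at h8
  generalize hqb : ((q⁻¹ : Aˣ) : A) = b at *
  generalize hqa : (q : A) = a at *
  have hx2yy : x2 * (y1 * y2) = (a * a) • (y1 * (1 + b • x1)) := by
    rw [← mul_assoc, h3, smul_mul_assoc, mul_assoc, h6]
  have hyyx2 : y1 * y2 * x2 = y1 * (1 + a • x1) := by rw [mul_assoc, h7]
  have hyyx1 : y1 * y2 * x1 = (a * a) • ((1 + b • x2) * y2) := by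
    rw [mul_assoc, h2, mul_smul_comm, ← mul_assoc, h5]
  have hx1yy : x1 * (y1 * y2) = (1 + a • x2) * y2 := by rw [← mul_assoc, h4]
  have hyyy1 : y1 * y2 * y1 = (b * b) • (y1 * (y1 * y2)) + (1 - b * b) • y1 := by
    rw [mul_assoc, h8, mul_add, mul_smul_comm, mul_smul_comm, mul_one]
  have hy2yy : y2 * (y1 * y2) = (b * b) • (y1 * y2 * y2) + (1 - b * b) • y2 := by
    rw [← mul_assoc, h8, add_mul, smul_mul_assoc, smul_mul_assoc, one_mul]
  have hx2w : x2 * (b • (y1 * y2 - 1)) = 1 + a • y1 := by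
    rw [mul_smul_comm, mul_sub, mul_one, hx2yy, mul_add, mul_one, mul_smul_comm, h5]
    match_scalars <;> grind
  have hwx2 : (b • (y1 * y2 - 1)) * x2 = 1 + b • y1 := by
    rw [smul_mul_assoc, sub_mul, one_mul, hyyx2, mul_add, mul_one, mul_smul_comm, h5]
    match_scalars <;> grind
  have hwx1 : (b • (y1 * y2 - 1)) * x1 = 1 + a • y2 := by
    rw [smul_mul_assoc, sub_mul, one_mul, hyyx1, add_mul, one_mul, smul_mul_assoc, h6]
    match_scalars <;> grind
  have hx1w : x1 * (b • (y1 * y2 - 1)) = 1 + b • y2 := by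
    rw [mul_smul_comm, mul_sub, mul_one, hx1yy, add_mul, one_mul, smul_mul_assoc, h6]
    match_scalars <;> grind
  have hy1w : y1 * (b • (y1 * y2 - 1)) = (a * a) • ((b • (y1 * y2 - 1)) * y1) := by
    rw [mul_smul_comm, smul_mul_assoc, sub_mul, one_mul, hyyy1, mul_sub, mul_one]
    match_scalars <;> grind
  have hwy2 : (b • (y1 * y2 - 1)) * y2 = (a * a) • (y2 * (b • (y1 * y2 - 1))) := by
    rw [mul_smul_comm, smul_mul_assoc, sub_mul, one_mul, mul_sub, hy2yy, mul_one]
    match_scalars <;> grind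
  have hy12 : y1 * y2 = 1 + a • b • (y1 * y2 - 1) := by
    match_scalars <;> grind
  have hy21 : y2 * y1 = 1 + b • b • (y1 * y2 - 1) := by
    rw [h8]
    match_scalars <;> grind
  have h1' : x1 * x2 = (a * a) • (x2 * x1) := by
    rw [h1]
    match_scalars
    grind
  constructor
  · intro i
    fin_cases i
    · exact fun h0 => hx1' (by rw [← h7, show y2 = 0 from h0, zero_mul])
    · exact hx1
    · exact hx2
    · exact fun h0 => hx2' (by rw [← h4, show y1 = 0 from h0, mul_zero])
    · exact fun h0 => hy1 (by rw [← hx2w, show b • (y1 * y2 - 1) = 0 from h0, mul_zero])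
  · rw [e2]
    intro i
    fin_cases i
    exacts [h2, h1', h3, hy1w, hwy2]
  · intro i
    rw [hqa]
    fin_cases i
    exacts [h7, h4, hx2w, hy12, hwx1]
  · intro i
    rw [hqb]
    fin_cases i
    exacts [h6, h5, hwx2, hy21, hx1w]

end A2Relations

namespace Pentagon

variable {q : Aˣ} {z : Fin 5 → F}

theorem quasiComm (hz : Pentagon q z) (i : Fin 5) : QuasiComm (q ^ (2 : ℤ)) (z i) (z (i + 1)) :=
  ⟨hz.ne _, hz.ne _, hz.comm i⟩

/-- A subalgebra that contains two neighbouring cluster variables and their inverses contains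
all cluster variables. -/
theorem mem_of_mem (hz : Pentagon q z) (i : Fin 5) (B : Subalgebra A F) (h0 : z i ∈ B)
    (h0' : (z i)⁻¹ ∈ B) (h1 : z (i + 1) ∈ B) (h1' : (z (i + 1))⁻¹ ∈ B) (j : Fin 5) :
    z j ∈ B := by
  have h2 : z (i + 2) ∈ B := by
    have : z (i + 2) = (z i)⁻¹ * (1 + (q : A) • z (i + 1)) := by
      rw [← hz.left, inv_mul_cancel_left₀ (hz.ne i)]
    rw [this]
    exact mul_mem h0' (add_mem (one_mem B) (B.smul_mem h1 _))
  have h4 : z (i + 4) ∈ B := by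
    have e := hz.left (i + 4)
    have e1 : i + 4 + 2 = i + 1 := by rw [add_assoc]; rfl
    have e2 : i + 4 + 1 = i := by rw [add_assoc]; exact add_zero i
    rw [e1, e2] at e
    have : z (i + 4) = (1 + (q : A) • z i) * (z (i + 1))⁻¹ := by
      rw [← e, mul_inv_cancel_right₀ (hz.ne _)]
    rw [this]
    exact mul_mem (add_mem (one_mem B) (B.smul_mem h0 _)) h1'
  -- No further inverse is needed: z_{i+3} is a polynomial in its two neighbours, by z_{i+2} z_{i+4}
  -- = 1 + q z_{i+3}.
  have h3 : z (i + 3) ∈ B := by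
    have e := hz.left (i + 2)
    have e1 : i + 2 + 2 = i + 4 := by rw [add_assoc]; rfl
    have e2 : i + 2 + 1 = i + 3 := by rw [add_assoc]; rfl
    rw [e1, e2] at e
    have : z (i + 3) = ((q⁻¹ : Aˣ) : A) • (z (i + 2) * z (i + 4) - 1) := by
      rw [e, add_sub_cancel_left, smul_smul, Units.inv_mul, one_smul]
    rw [this]
    exact B.smul_mem (sub_mem (mul_mem h2 h4) (one_mem B)) _
  have key : ∀ i j : Fin 5, j = i ∨ j = i + 1 ∨ j = i + 2 ∨ j = i + 3 ∨ j = i + 4 := by decide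
  rcases key i j with rfl | rfl | rfl | rfl | rfl <;> assumption

/-- The seeds that are mutation-equivalent to a seed of type `A₂`. -/
theorem exists_of_mutEquiv (hz : Pentagon q z) (hq : q ^ ℓ = 1) (i : Fin 5)
    {t : Seed (Fin 2) ℓ F} (ht : MutEquiv q (signedSeed ℓ q 1 (z i) (z (i + 1))) t) :
    ∃ j, t = signedSeed ℓ q 1 (z j) (z (j + 1)) ∨ t = signedSeed ℓ q (-1) (z (j + 1)) (z j) := by
  have d1 : ∀ j : Fin 5, j + 1 + 1 = j + 2 := by decide
  have d2 : ∀ j : Fin 5, j + 4 + 1 = j := by decide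
  have d3 : ∀ j : Fin 5, j + 4 + 2 = j + 1 := by decide
  induction ht with
  | refl => exact ⟨i, Or.inl rfl⟩
  | tail _ hst ih =>
    obtain ⟨k, rfl⟩ := hst
    -- From the pair {z_j, z_{j+1}} one mutation exchanges z_j for z_{j+2}, the other exchanges
    -- z_{j+1} for z_{j-1}, written z_{j+4}. Either way the sign flips and so does the cyclic order
    -- of the pair.
    obtain ⟨j, rfl | rfl⟩ := ih
    · fin_cases k
      · refine ⟨j + 1, Or.inr ?_⟩
        rw [d1]
        refine mutate_zero hq (Or.inl rfl) (hz.ne _) ?_ ?_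
        · simpa using hz.left j
        · have := (hz.quasiComm (j + 1)).symm
          rw [d1] at this
          simpa using this
      · refine ⟨j + 4, Or.inr ?_⟩
        rw [d2]
        refine mutate_one hq (Or.inl rfl) (hz.ne _) ?_
        have := hz.left (j + 4)
        rw [d2, d3] at this
        simpa using this
    · fin_cases k
      · refine ⟨j + 4, Or.inl ?_⟩
        rw [d2]
        have e := mutate_zero (ℓ := ℓ) hq (s := -1) (u := z (j + 1)) (v := z j) (u' := z (j + 4))
          (Or.inr rfl) (hz.ne _) ?_ ?_
        · exact e
        · have := hz.right (j + 4)
          rw [d2, d3] at this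
          simpa using this
        · have := hz.quasiComm (j + 4)
          rw [d2] at this
          simpa using this
      · refine ⟨j + 1, Or.inl ?_⟩
        rw [d1]
        have e := mutate_one (ℓ := ℓ) hq (s := -1) (u := z (j + 1)) (v := z j) (v' := z (j + 2))
          (Or.inr rfl) (hz.ne _) ?_
        · exact e
        · simpa using hz.right j

theorem normFrame_stdVec_zero (t : Aˣ) (u v : F) : normFrame t u v (stdVec 0) = u := by
  simp [normFrame, stdVec]

theorem normFrame_stdVec_one (t : Aˣ) (u v : F) : normFrame t u v (stdVec 1) = v := by
  simp [normFrame, stdVec]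

theorem mem_quantumTorus (hz : Pentagon q z) (t : Aˣ) (i j : Fin 5) :
    z j ∈ quantumTorus A (normFrame t (z i) (z (i + 1))) ∧
      z j ∈ quantumTorus A (normFrame t (z (i + 1)) (z i)) := by
  have key : ∀ a b : F, a ∈ quantumTorus A (normFrame t a b) ∧
      a⁻¹ ∈ quantumTorus A (normFrame t a b) ∧ b ∈ quantumTorus A (normFrame t a b) ∧
      b⁻¹ ∈ quantumTorus A (normFrame t a b) := by
    intro a b
    have h : ∀ f, normFrame t a b f ∈ quantumTorus A (normFrame t a b) :=
      fun f => Algebra.subset_adjoin ⟨f, rfl⟩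
    refine ⟨?_, ?_, ?_, ?_⟩
    · simpa [normFrame_eq] using h ![1, 0]
    · simpa [normFrame_eq] using h ![-1, 0]
    · simpa [normFrame_eq] using h ![0, 1]
    · simpa [normFrame_eq] using h ![0, -1]
  obtain ⟨a1, a2, a3, a4⟩ := key (z i) (z (i + 1))
  obtain ⟨b1, b2, b3, b4⟩ := key (z (i + 1)) (z i)
  exact ⟨hz.mem_of_mem i _ a1 a2 a3 a4 j, hz.mem_of_mem i _ b3 b4 b1 b2 j⟩

/-- The outer variables z_{i+2} and z_{i+4} come from the two one-step mutations of the initial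
seed, and the fifth variable is a polynomial in these two. -/
theorem clusterAlgebra_eq (hz : Pentagon q z) (hq : q ^ ℓ = 1) (i : Fin 5) :
    clusterAlgebra q (signedSeed ℓ q 1 (z i) (z (i + 1))) =
      Algebra.adjoin A {z i, z (i + 1), z (i + 2), z (i + 4)} := by
  have d2 : ∀ j : Fin 5, j + 4 + 1 = j := by decide
  have d3 : ∀ j : Fin 5, j + 4 + 2 = j + 1 := by decide
  apply le_antisymm
  · have hall : ∀ j, z j ∈ Algebra.adjoin A {z i, z (i + 1), z (i + 2), z (i + 4)} := by
      have key : ∀ i j : Fin 5, j = i ∨ j = i + 1 ∨ j = i + 2 ∨ j = i + 4 ∨ j = i + 3 := by decide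
      intro j
      rcases key i j with rfl | rfl | rfl | rfl | rfl
      · exact Algebra.subset_adjoin (by simp)
      · exact Algebra.subset_adjoin (by simp)
      · exact Algebra.subset_adjoin (by simp)
      · exact Algebra.subset_adjoin (by simp)
      · have e := hz.left (i + 2)
        have e1 : i + 2 + 2 = i + 4 := by rw [add_assoc]; rfl
        have e2 : i + 2 + 1 = i + 3 := by rw [add_assoc]; rfl
        rw [e1, e2] at e
        have : z (i + 3) = ((q⁻¹ : Aˣ) : A) • (z (i + 2) * z (i + 4) - 1) := by
          rw [e, add_sub_cancel_left, smul_smul, Units.inv_mul, one_smul]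
        rw [this]
        exact Subalgebra.smul_mem _ (sub_mem (mul_mem (Algebra.subset_adjoin (by simp))
          (Algebra.subset_adjoin (by simp))) (one_mem _)) _
    refine Algebra.adjoin_le ?_
    rintro _ ⟨t, ht, k, rfl⟩
    obtain ⟨j, rfl | rfl⟩ := hz.exists_of_mutEquiv hq i ht <;> fin_cases k
    · change normFrame (q ^ (1 : ℤ)) (z j) (z (j + 1)) (stdVec 0) ∈ _
      rw [normFrame_stdVec_zero]
      exact hall _
    · change normFrame (q ^ (1 : ℤ)) (z j) (z (j + 1)) (stdVec 1) ∈ _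
      rw [normFrame_stdVec_one]
      exact hall _
    · change normFrame (q ^ (-1 : ℤ)) (z (j + 1)) (z j) (stdVec 0) ∈ _
      rw [normFrame_stdVec_zero]
      exact hall _
    · change normFrame (q ^ (-1 : ℤ)) (z (j + 1)) (z j) (stdVec 1) ∈ _
      rw [normFrame_stdVec_one]
      exact hall _
  · refine Algebra.adjoin_le ?_
    rintro _ (rfl | rfl | rfl | rfl)
    · exact Algebra.subset_adjoin ⟨_, Relation.ReflTransGen.refl, 0,
        (normFrame_stdVec_zero _ _ _).symm⟩
    · exact Algebra.subset_adjoin ⟨_, Relation.ReflTransGen.refl, 1,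
        (normFrame_stdVec_one _ _ _).symm⟩
    · refine Algebra.subset_adjoin ⟨_, Relation.ReflTransGen.single ⟨0, rfl⟩, 0, ?_⟩
      rw [mutate_zero hq (Or.inl rfl) (hz.ne _) (u' := z (i + 2))]
      · exact (normFrame_stdVec_zero _ _ _).symm
      · simpa using hz.left i
      · have := (hz.quasiComm (i + 1)).symm
        rw [add_assoc] at this
        simpa using this
    · refine Algebra.subset_adjoin ⟨_, Relation.ReflTransGen.single ⟨1, rfl⟩, 1, ?_⟩
      rw [mutate_one hq (Or.inl rfl) (hz.ne _) (v' := z (i + 4))]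
      · exact (normFrame_stdVec_one _ _ _).symm
      · have := hz.left (i + 4)
        rw [d2, d3] at this
        simpa using this

theorem clusterAlgebra_le_upper (hz : Pentagon q z) (hq : q ^ ℓ = 1) (i : Fin 5) :
    clusterAlgebra q (signedSeed ℓ q 1 (z i) (z (i + 1))) ≤
      upperClusterAlgebra q (signedSeed ℓ q 1 (z i) (z (i + 1))) := by
  rw [hz.clusterAlgebra_eq hq]
  refine le_iInf₂ fun t ht => Algebra.adjoin_le ?_
  obtain ⟨j, rfl | rfl⟩ := hz.exists_of_mutEquiv hq i ht
  · rintro _ (rfl | rfl | rfl | rfl) <;> exact (hz.mem_quantumTorus _ j _).1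
  · rintro _ (rfl | rfl | rfl | rfl) <;> exact (hz.mem_quantumTorus _ j _).2

/-- The upper cluster algebra lies in the tori of the initial cluster and of its neighbours. -/
theorem mem_of_mem_upper (hz : Pentagon q z) (hq : q ^ ℓ = 1) (i : Fin 5) {x : F}
    (hx : x ∈ upperClusterAlgebra q (signedSeed ℓ q 1 (z i) (z (i + 1)))) :
    x ∈ spanOn A (mon (z i) (z (i + 1))) Set.univ ∧
      x ∈ spanOn A (mon (z (i + 2)) (z (i + 1))) Set.univ ∧
      x ∈ spanOn A (mon (z i) (z (i + 4))) Set.univ := by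
  have d1 : ∀ j : Fin 5, j + 1 + 1 = j + 2 := by decide
  have d2 : ∀ j : Fin 5, j + 4 + 1 = j := by decide
  have d3 : ∀ j : Fin 5, j + 4 + 2 = j + 1 := by decide
  have hx' : ∀ t, MutEquiv q (signedSeed ℓ q 1 (z i) (z (i + 1))) t →
      x ∈ quantumTorus A t.frame := by
    simpa only [upperClusterAlgebra, Algebra.mem_iInf] using hx
  have c1 := (hz.quasiComm (i + 1)).symm
  have c2 := (hz.quasiComm (i + 4)).symm
  rw [d1] at c1
  rw [d2] at c2
  refine ⟨?_, ?_, ?_⟩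
  · have h := hx' _ Relation.ReflTransGen.refl
    exact (mem_quantumTorus_normFrame _ (hz.quasiComm i)).1 h
  · have h := hx' _ (Relation.ReflTransGen.single ⟨0, rfl⟩)
    rw [mutate_zero hq (Or.inl rfl) (hz.ne _) (u' := z (i + 2))] at h
    · exact (mem_quantumTorus_normFrame _ c1).1 h
    · simpa using hz.left i
    · simpa using c1
  · have h := hx' _ (Relation.ReflTransGen.single ⟨1, rfl⟩)
    rw [mutate_one hq (Or.inl rfl) (hz.ne _) (v' := z (i + 4))] at h
    · exact (mem_quantumTorus_normFrame _ c2).1 h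
    · have := hz.left (i + 4)
      rw [d2, d3] at this
      simpa using this

end Pentagon

end Pentagon

section Frame

variable {A : Type*} [CommRing A] {F : Type*} [DivisionRing F] [Algebra A F] {ℓ : ℕ}

/-! ## The toric frame of the initial seed -/

namespace IsToricFrame

variable {q : Aˣ} {M : (Fin 2 → ℤ) → F}

theorem mul_eq (hM : IsToricFrame q (formA2 ℓ) M) (hq : q ^ ℓ = 1) (a b c d : ℤ) :
    M ![a, b] * M ![c, d] = ((q ^ (a * d - b * c) : Aˣ) : A) • M ![a + c, b + d] := by
  rw [hM.mul]
  have e : bichar (formA2 ℓ) ![a, b] ![c, d] = ((a * d - b * c : ℤ) : ZMod ℓ) := by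
    have := bichar_formA2 (ℓ := ℓ) 1 ![a, b] ![c, d]
    simpa using this
  rw [e, epsPow_intCast hq]
  simp

theorem apply_zero [Nontrivial A] (hM : IsToricFrame q (formA2 ℓ) M) (hq : q ^ ℓ = 1) :
    M ![0, 0] = 1 := by
  have h := hM.mul_eq hq 0 0 0 0
  have h0 : M ![0, 0] ≠ 0 := hM.linearIndependent.ne_zero _
  simp only [mul_zero, sub_zero, zpow_zero, Units.val_one, one_smul, add_zero] at h
  exact mul_left_cancel₀ h0 (by rw [h, mul_one])

theorem eq_zpow_of_map_add {g : ℤ → F} (h0 : g 0 = 1) (h : ∀ a b, g (a + b) = g a * g b)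
    (n : ℤ) : g n = g 1 ^ n := by
  have h1 : g 1 ≠ 0 := by
    intro e
    have := h 1 (-1)
    rw [e, zero_mul, add_neg_cancel, h0] at this
    exact one_ne_zero this
  induction n using Int.induction_on with
  | zero => simp [h0]
  | succ n ih => rw [h, ih, zpow_add_one₀ h1]
  | pred n ih =>
    rw [zpow_sub_one₀ h1, ← ih, eq_mul_inv_iff_mul_eq₀ h1, ← h, sub_add_cancel]

/-- On each coordinate axis the form vanishes, so the frame is multiplicative there and consists of
powers; the product rule gives all other values. -/
theorem eq_normFrame [Nontrivial A] (hM : IsToricFrame q (formA2 ℓ) M) (hq : q ^ ℓ = 1) :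
    M = normFrame q (M ![1, 0]) (M ![0, 1]) := by
  have h1 : ∀ n : ℤ, M ![n, 0] = M ![1, 0] ^ n :=
    eq_zpow_of_map_add (g := fun n => M ![n, 0]) (hM.apply_zero hq)
      (fun a b => by simp [hM.mul_eq hq])
  have h2 : ∀ n : ℤ, M ![0, n] = M ![0, 1] ^ n :=
    eq_zpow_of_map_add (g := fun n => M ![0, n]) (hM.apply_zero hq)
      (fun a b => by simp [hM.mul_eq hq])
  ext f
  have h3 := hM.mul_eq hq (f 0) 0 0 (f 1)
  rw [h1, h2] at h3
  have h4 : f = ![f 0, f 1] := by ext i; fin_cases i <;> rfl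
  rw [normFrame, h3, smul_smul, ← Units.val_mul, ← zpow_add]
  simp [← h4]

theorem seedA2_eq [Nontrivial A] (hM : IsToricFrame q (formA2 ℓ) M) (hq : q ^ ℓ = 1) :
    seedA2 ℓ M = signedSeed ℓ q 1 (M ![1, 0]) (M ![0, 1]) := by
  apply seed_ext
  · simp only [seedA2, signedSeed, zpow_one]
    exact hM.eq_normFrame hq
  · simp [seedA2, signedSeed]
  · simp [seedA2, signedSeed]

theorem linearIndependent_mon [Nontrivial A] (hM : IsToricFrame q (formA2 ℓ) M)
    (hq : q ^ ℓ = 1) : LinearIndependent A (mon (M ![1, 0]) (M ![0, 1])) := by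
  have h1 : LinearIndependent A (fun p : ℤ × ℤ => M ![p.1, p.2]) :=
    hM.linearIndependent.comp (fun p : ℤ × ℤ => ![p.1, p.2]) (by
      rintro ⟨a, b⟩ ⟨c, d⟩ h
      exact Prod.ext (congrFun h 0) (congrFun h 1))
  convert h1.units_smul (fun p : ℤ × ℤ => q ^ (p.1 * p.2)) using 1
  ext p
  have h2 := congrFun (hM.eq_normFrame hq) ![p.1, p.2]
  rw [normFrame_eq] at h2
  rw [Pi.smul_apply', h2, Units.smul_def, smul_smul, ← Units.val_mul, ← zpow_add]
  simp [mon]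

theorem quasiComm [Nontrivial A] (hM : IsToricFrame q (formA2 ℓ) M) (hq : q ^ ℓ = 1) :
    QuasiComm (q ^ (2 : ℤ)) (M ![1, 0]) (M ![0, 1]) where
  left_ne := hM.linearIndependent.ne_zero _
  right_ne := hM.linearIndependent.ne_zero _
  comm := by
    rw [hM.mul_eq hq, hM.mul_eq hq, smul_smul, ← Units.val_mul, ← zpow_add]
    simp

theorem relations [Nontrivial A] (hM : IsToricFrame q (formA2 ℓ) M) (hq : q ^ ℓ = 1) :
    A2Relations q (M ![1, 0]) (M ![0, 1]) (M ![-1, 1] + M ![-1, 0])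
      (M ![1, -1] + M ![0, -1]) := by
  have h0 := hM.apply_zero hq
  have e1 : (q : A) * ((q⁻¹ : Aˣ) : A) = 1 := q.mul_inv
  constructor
  · simp [hM.mul_eq hq, smul_smul]
    match_scalars
    grind
  · simp [hM.mul_eq hq, smul_smul, add_mul, mul_add]
    match_scalars <;> grind
  · simp [hM.mul_eq hq, smul_smul, add_mul, mul_add]
    match_scalars <;> grind
  · simp [hM.mul_eq hq, h0, mul_add, add_comm]
  · simp [hM.mul_eq hq, h0, add_mul, add_comm]
  · simp [hM.mul_eq hq, h0, mul_add, add_comm]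
  · simp [hM.mul_eq hq, h0, add_mul, add_comm]
  · rw [Algebra.algebraMap_eq_smul_one]
    simp [hM.mul_eq hq, h0, add_mul, mul_add]
    match_scalars <;> grind

end IsToricFrame

/-! ## Linear independence of the monomials -/

section LinearIndependence

variable {s : Aˣ} {x1 x2 y1 y2 : F}

theorem hasLead_mon (p : ℤ × ℤ) :
    HasLead A (mon x1 x2) (-lexDegree) ((-lexDegree) p) (mon x1 x2 p) (mon x1 x2 p) :=
  HasLead.of_lead (mem_spanOn _ rfl)

theorem linearIndependent_pbwMonomial (h : QuasiComm s x1 x2)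
    (li : LinearIndependent A (mon x1 x2)) {a b : A} (hy1 : y1 = x1⁻¹ * (1 + a • x2))
    (hy2 : y2 = (1 + b • x1) * x2⁻¹) : LinearIndependent A (pbwMonomial x1 x2 y1 y2) := by
  have tb := h.twistedBasis li
  -- The negated lexicographic order makes x₁⁻¹ dominate x₁⁻¹x₂ in y₁ and makes x₂⁻¹ dominate x₁x₂⁻¹
  -- in y₂.
  have l1 : HasLead A (mon x1 x2) (-lexDegree) ((-lexDegree) (-1, 0)) (x1 ^ (-1 : ℤ)) y1 := by
    constructor
    · exact Submodule.subset_span ⟨(-1, 0), rfl, by simp [mon]⟩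
    · have e : y1 - x1 ^ (-1 : ℤ) = a • mon x1 x2 (-1, 1) := by
        rw [hy1]
        simp [mon, mul_add]
      rw [e]
      refine Submodule.smul_mem _ _ (mem_spanOn _ ?_)
      change (-lexDegree) (-1, 1) < (-lexDegree) (-1, 0)
      rw [AddMonoidHom.neg_apply, AddMonoidHom.neg_apply, neg_lt_neg_iff]
      exact Prod.Lex.toLex_lt_toLex.2 (Or.inr ⟨rfl, by norm_num⟩)
  have l2 : HasLead A (mon x1 x2) (-lexDegree) ((-lexDegree) (0, -1)) (x2 ^ (-1 : ℤ)) y2 := by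
    constructor
    · exact Submodule.subset_span ⟨(0, -1), rfl, by simp [mon]⟩
    · have e : y2 - x2 ^ (-1 : ℤ) = b • mon x1 x2 (1, -1) := by
        rw [hy2]
        simp [mon, add_mul]
      rw [e]
      refine Submodule.smul_mem _ _ (mem_spanOn _ ?_)
      change (-lexDegree) (1, -1) < (-lexDegree) (0, -1)
      rw [AddMonoidHom.neg_apply, AddMonoidHom.neg_apply, neg_lt_neg_iff]
      exact Prod.Lex.toLex_lt_toLex.2 (Or.inl (by norm_num))
  have l3 := hasLead_mon (A := A) (x1 := x1) (x2 := x2) (1, 0)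
  have l4 := hasLead_mon (A := A) (x1 := x1) (x2 := x2) (0, 1)
  refine linearIndependent_of_hasLead tb (d := -lexDegree)
    (fun x y hxy => lexDegree_injective (neg_injective hxy)) _
    (fun p : PBWIndex => ((p.1.2.1 : ℤ) - p.1.1, (p.1.2.2.1 : ℤ) - p.1.2.2.2)) ?_ (fun _ => 1) ?_
  -- The differences n₁ - m₁ and n₂ - m₂ recover all four exponents, since one of each pair is zero.
  · rintro ⟨⟨a, b, c, d⟩, h1, h2⟩ ⟨⟨a', b', c', d'⟩, h3, h4⟩ he
    simp only [Prod.mk.injEq] at he h1 h2 h3 h4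
    simp only [Subtype.mk.injEq, Prod.mk.injEq]
    omega
  · rintro ⟨⟨m1, n1, n2, m2⟩, -⟩
    have l5 := (((l1.pow tb m1).mul tb (l3.pow tb n1)).mul tb (l4.pow tb n2)).mul tb
      (l2.pow tb m2)
    rw [Units.val_one, one_smul]
    convert l5 using 1
    · simp only [← map_nsmul, ← map_add]
      congr 1
      ext <;> simp <;> ring
    · simp only [mon, zpow_one, zpow_zero, one_mul, mul_one]
      rw [sub_eq_neg_add, sub_eq_add_neg, zpow_add₀ h.left_ne, zpow_add₀ h.right_ne, ← zpow_natCast,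
        ← zpow_natCast, ← zpow_natCast, ← zpow_natCast, ← zpow_mul, ← zpow_mul]
      simp only [neg_mul, one_mul, mul_assoc]
    · simp [mon, pbwMonomial]

end LinearIndependence

/-! ## The intersection of three tori -/

section Upper

variable {s : Aˣ} {u v u' : F}

theorem spanOn_mon_comm (h : QuasiComm s u v) :
    spanOn A (mon u v) Set.univ = spanOn A (mon v u) Set.univ := by
  have key : ∀ {t : Aˣ} {a b : F}, QuasiComm t a b →
      spanOn A (mon a b) Set.univ ≤ spanOn A (mon b a) Set.univ := by
    intro t a b h
    refine spanOn_induction fun f _ => ?_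
    rw [mon, h.zpow_comm]
    exact Submodule.smul_mem _ _ (mem_spanOn (mon b a) (f := (f.2, f.1)) (Set.mem_univ _))
  exact le_antisymm (key h) (key h.symm)

/-- Only finitely many negative powers of v occur. Asking for all large `N` lets the bounds of
several summands be combined. -/
theorem exists_pow_mul_mem (h : QuasiComm s u v) (B : Subalgebra A F) (hu : u ∈ B) (hv : v ∈ B)
    {x : F} (hx : x ∈ spanOn A (mon u v) {f | 0 ≤ f.1}) :
    ∃ N₀ : ℕ, ∀ N ≥ N₀, v ^ N * x ∈ B := by
  induction hx using Submodule.span_induction with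
  | mem x hx =>
    obtain ⟨f, hf, rfl⟩ := hx
    refine ⟨(-f.2).toNat, fun N hN => ?_⟩
    have e := h.mon_mul (0, N) f
    have e2 : mon u v (0, (N : ℤ)) = v ^ N := by simp [mon]
    rw [e2] at e
    rw [e]
    refine B.smul_mem (mul_mem ?_ ?_) _
    · have hf' : 0 ≤ f.1 := hf
      obtain ⟨i, hi⟩ := Int.eq_ofNat_of_zero_le hf'
      simp only [Prod.fst_add, zero_add, hi, zpow_natCast]
      exact pow_mem hu _
    · obtain ⟨i, hi⟩ : ∃ i : ℕ, (N : ℤ) + f.2 = i := Int.eq_ofNat_of_zero_le (by omega)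
      simp only [Prod.snd_add, hi, zpow_natCast]
      exact pow_mem hv _
  | zero => exact ⟨0, fun N _ => by rw [mul_zero]; exact zero_mem _⟩
  | add x y _ _ hx hy =>
    obtain ⟨a, ha⟩ := hx
    obtain ⟨b, hb⟩ := hy
    refine ⟨max a b, fun N hN => ?_⟩
    rw [mul_add]
    exact add_mem (ha N (le_of_max_le_left hN)) (hb N (le_of_max_le_right hN))
  | smul r x _ hx =>
    obtain ⟨a, ha⟩ := hx
    refine ⟨a, fun N hN => ?_⟩
    rw [mul_smul_comm]
    exact B.smul_mem (ha N hN) r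

/-- An element of the tori of `(u, v)` and `(u', v)` lies, up to a power of `v`, in the algebra
generated by `u`, `u'` and `v`. -/
theorem exists_pow_mul_mem_of_mem_inter (h : QuasiComm s u v) (h' : QuasiComm s⁻¹ u' v)
    (li : LinearIndependent A (mon u v)) (hu' : u' ∈ spanOn A (mon u v) {f | f.1 = -1})
    (B : Subalgebra A F) (hB : u ∈ B) (hB' : u' ∈ B) (hBv : v ∈ B) {x : F}
    (hx : x ∈ spanOn A (mon u v) Set.univ) (hx' : x ∈ spanOn A (mon u' v) Set.univ) :
    ∃ N₀ : ℕ, ∀ N ≥ N₀, v ^ N * x ∈ B := by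
  have tb := h.twistedBasis li
  set d : ℤ × ℤ →+ ℤ := -AddMonoidHom.fst ℤ ℤ with hd
  have hdf : ∀ f, d f = -f.1 := fun f => rfl
  have lead' : HasLead A (mon u v) d 1 u' u' := HasLead.of_lead (spanOn_mono (fun f hf => by
    change d f = 1
    rw [hdf, show f.1 = -1 from hf, neg_neg]) hu')
  have hmon : ∀ f : ℤ × ℤ, 0 ≤ f.1 → mon u' v f ∈ spanOn A (mon u v) {g | d g = f.1} := by
    intro f hf
    obtain ⟨i, hi⟩ := Int.eq_ofNat_of_zero_le hf
    have h1 := (lead'.pow tb i).lead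
    have h2 : v ^ f.2 ∈ spanOn A (mon u v) {g | d g = 0} :=
      Submodule.subset_span ⟨(0, f.2), by simp [hdf], by simp [mon]⟩
    have h3 := tb.mul_mem (U := {g | d g = f.1}) (fun a ha b hb => by
      simp only [Set.mem_ofPred_eq] at *
      rw [map_add, ha, hb, hi]
      simp) h1 h2
    rw [mon, hi, zpow_natCast]
    rwa [hi] at h3
  -- Split by the sign of the exponent of u'. The part `g` lies in the torus of (u, v) because u'
  -- does, hence so does `f₀`.
  obtain ⟨g, hg, f₀, hf₀, rfl⟩ := exists_add_of_mem_spanOn (S₁ := {f | 0 ≤ f.1})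
    (S₂ := {f | f.1 ≤ 0}) (fun f _ => le_total 0 f.1) hx'
  have hgT : g ∈ spanOn A (mon u v) Set.univ :=
    spanOn_induction (S := {f | 0 ≤ f.1}) (m := mon u' v)
      (fun f hf => spanOn_mono (Set.subset_univ _) (hmon f hf)) hg
  have hf₀T : f₀ ∈ spanOn A (mon u v) Set.univ := by
    have := Submodule.sub_mem _ hx hgT
    rwa [add_sub_cancel_left] at this
  -- Claim: `f₀` involves no negative power of u. Here `d` is minus the exponent of u, and u' is
  -- homogeneous of degree 1, so a positive leading degree γ has to be excluded.
  have hf₀' : f₀ ∈ spanOn A (mon u v) {f | 0 ≤ f.1} := by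
    by_cases h0 : f₀ = 0
    · rw [h0]
      exact Submodule.zero_mem _
    obtain ⟨γ, k, hk, -, hlead⟩ := exists_hasLead (mon u v) d hf₀T h0
    by_cases hγ : γ ≤ 0
    · refine spanOn_mono ?_ hlead.mem_le
      intro f hf
      have hf' : d f ≤ γ := hf
      rw [hdf] at hf'
      change 0 ≤ f.1
      omega
    exfalso
    obtain ⟨t, ht, hft⟩ := exists_finset_of_mem_spanOn hf₀
    obtain ⟨c, hc⟩ : ∃ c : ℕ, ∀ f ∈ t, -(c : ℤ) ≤ f.1 := by
      refine ⟨t.sup fun f => (-f.1).toNat, fun f hf => ?_⟩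
      have := Finset.le_sup (f := fun f : ℤ × ℤ => (-f.1).toNat) hf
      omega
    -- The exponents of u' in `u' ^ c * f₀` lie between 0 and c, so its degree is at most c; yet its
    -- leading degree is c + γ > c.
    have hmem : u' ^ c * f₀ ∈ spanOn A (mon u v) {f | d f ≤ c} := by
      have h1 : spanOn A (mon u' v) (t : Set (ℤ × ℤ)) ≤
          (spanOn A (mon u v) {f | d f ≤ c}).comap (LinearMap.mulLeft A (u' ^ c)) := by
        refine spanOn_induction fun f hf => ?_
        rw [Submodule.mem_comap, LinearMap.mulLeft_apply]
        have e : u' ^ c * mon u' v f = mon u' v (c + f.1, f.2) := by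
          rw [mon, mon, zpow_add₀ h'.left_ne, zpow_natCast, mul_assoc]
        rw [e]
        have h2 := hc f hf
        have h3 : f.1 ≤ 0 := ht hf
        refine spanOn_mono ?_ (hmon _ (by simp only; omega))
        intro g hg
        have : d g = c + f.1 := hg
        change d g ≤ c
        omega
      exact h1 hft
    have hl := (lead'.pow tb c).mul tb hlead
    obtain ⟨f, hf, hf2⟩ := hl.exists_mem tb
      (mul_ne_zero (pow_ne_zero _ h'.left_ne) hk) hmem
    have hf1 : d f ≤ c := hf
    simp only [nsmul_eq_mul, mul_one] at hf2
    omega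
  obtain ⟨a, ha⟩ := exists_pow_mul_mem h' B hB' hBv hg
  obtain ⟨b, hb⟩ := exists_pow_mul_mem h B hB hBv hf₀'
  refine ⟨max a b, fun N hN => ?_⟩
  rw [mul_add]
  exact add_mem (ha N (le_of_max_le_left hN)) (hb N (le_of_max_le_right hN))

/-- If `u u' = 1 + r v`, then an element lies in a subalgebra containing `u`, `v`, `u'` as soon as
its products with powers of `u` and of `v` do. -/
theorem mem_of_pow_mul_mem (h : QuasiComm s u v) {r : A} (hr : u * u' = 1 + r • v)
    (B : Subalgebra A F) (hu : u ∈ B) (hu' : u' ∈ B) (hv : v ∈ B) {x : F} (a b : ℕ)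
    (ha : u ^ a * x ∈ B) (hb : v ^ b * x ∈ B) : x ∈ B := by
  -- Coprimality of u and v: multiplying 1 = uu' - rv by g gives g = u(u'g - rk).
  have step : ∀ g ∈ B, ∀ k ∈ B, v * g = u * k → ∃ g' ∈ B, g = u * g' := by
    intro g hg k hk e
    refine ⟨u' * g - r • k, sub_mem (mul_mem hu' hg) (B.smul_mem hk _), ?_⟩
    rw [mul_sub, ← mul_assoc, hr, mul_smul_comm, ← e, add_mul, one_mul, smul_mul_assoc,
      add_sub_cancel_right]
  have steps : ∀ n : ℕ, ∀ g ∈ B, ∀ k ∈ B, v ^ n * g = u * k → ∃ g' ∈ B, g = u * g' := by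
    intro n
    induction n with
    | zero => exact fun g _ k hk e => ⟨k, hk, by simpa using e⟩
    | succ n ih =>
      intro g hg k hk e
      rw [pow_succ', mul_assoc] at e
      obtain ⟨g', hg', e'⟩ := step _ (mul_mem (pow_mem hv n) hg) k hk e
      exact ih g hg g' hg' e'
  induction a with
  | zero => simpa using ha
  | succ a ih =>
    have e : v ^ b * u ^ (a + 1) = ((s⁻¹ ^ ((b : ℤ) * (a + 1 : ℕ)) : Aˣ) : A) •
        (u ^ (a + 1) * v ^ b) := by
      have := h.symm.zpow_comm b (a + 1 : ℕ)
      simpa only [zpow_natCast] using this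
    -- Up to a unit, v^b · u^{a+1}x equals u · u^a v^b x, so u divides u^{a+1}x inside `B`;
    -- cancelling it lowers the exponent.
    obtain ⟨g', hg', e'⟩ := steps b _ ha
      (((s⁻¹ ^ ((b : ℤ) * (a + 1 : ℕ)) : Aˣ) : A) • (u ^ a * (v ^ b * x)))
      (B.smul_mem (mul_mem (pow_mem hu a) hb) _) (by
        rw [← mul_assoc, e, smul_mul_assoc, mul_smul_comm, pow_succ']
        simp only [mul_assoc])
    rw [pow_succ', mul_assoc] at e'
    exact ih (by rw [mul_left_cancel₀ h.left_ne e']; exact hg')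

end Upper

namespace A2Relations

variable {q : Aˣ} {x1 x2 y1 y2 : F}

theorem y1_eq (h : A2Relations q x1 x2 y1 y2) (hx1 : x1 ≠ 0) :
    y1 = x1⁻¹ * (1 + (q : A) • x2) := by
  rw [← h.x1y1, inv_mul_cancel_left₀ hx1]

theorem y2_eq (h : A2Relations q x1 x2 y1 y2) (hx2 : x2 ≠ 0) :
    y2 = (1 + (q : A) • x1) * x2⁻¹ := by
  rw [← h.y2x2, mul_inv_cancel_right₀ hx2]

theorem y2_eq' (h : A2Relations q x1 x2 y1 y2) (hx2 : x2 ≠ 0) :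
    y2 = x2⁻¹ * (1 + ((q⁻¹ : Aˣ) : A) • x1) := by
  rw [← h.x2y2, inv_mul_cancel_left₀ hx2]

/-- The intersection of the tori of the three clusters `(x₁, x₂)`, `(y₁, x₂)`, `(x₁, y₂)` is
generated by `x₁, x₂, y₁, y₂`. -/
theorem mem_adjoin_of_mem_tori (h : A2Relations q x1 x2 y1 y2)
    (h12 : QuasiComm (q ^ (2 : ℤ)) x1 x2) (h12' : QuasiComm (q ^ (2 : ℤ))⁻¹ y1 x2)
    (h1'2 : QuasiComm (q ^ (2 : ℤ)) y2 x1) (li : LinearIndependent A (mon x1 x2))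
    (li' : LinearIndependent A (mon x2 x1)) {x : F}
    (hx : x ∈ spanOn A (mon x1 x2) Set.univ) (hx1 : x ∈ spanOn A (mon y1 x2) Set.univ)
    (hx2 : x ∈ spanOn A (mon x1 y2) Set.univ) : x ∈ Algebra.adjoin A {x1, x2, y1, y2} := by
  have b1 : x1 ∈ Algebra.adjoin A {x1, x2, y1, y2} := Algebra.subset_adjoin (by simp)
  have b2 : x2 ∈ Algebra.adjoin A {x1, x2, y1, y2} := Algebra.subset_adjoin (by simp)
  have b3 : y1 ∈ Algebra.adjoin A {x1, x2, y1, y2} := Algebra.subset_adjoin (by simp)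
  have b4 : y2 ∈ Algebra.adjoin A {x1, x2, y1, y2} := Algebra.subset_adjoin (by simp)
  have m1 : y1 ∈ spanOn A (mon x1 x2) {f | f.1 = -1} := by
    have e : y1 = mon x1 x2 (-1, 0) + (q : A) • mon x1 x2 (-1, 1) := by
      rw [h.y1_eq h12.left_ne]
      simp [mon, mul_add]
    rw [e]
    exact Submodule.add_mem _ (mem_spanOn _ rfl) (Submodule.smul_mem _ _ (mem_spanOn _ rfl))
  have m2 : y2 ∈ spanOn A (mon x2 x1) {f | f.1 = -1} := by
    have e : y2 = mon x2 x1 (-1, 0) + ((q⁻¹ : Aˣ) : A) • mon x2 x1 (-1, 1) := by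
      rw [h.y2_eq' h12.right_ne]
      simp [mon, mul_add]
    rw [e]
    exact Submodule.add_mem _ (mem_spanOn _ rfl) (Submodule.smul_mem _ _ (mem_spanOn _ rfl))
  obtain ⟨N, hN⟩ := exists_pow_mul_mem_of_mem_inter h12 h12' li m1 _ b1 b3 b2 hx hx1
  obtain ⟨N', hN'⟩ := exists_pow_mul_mem_of_mem_inter h12.symm (by simpa using h1'2) li' m2 _ b2 b4
    b1 (by rwa [← spanOn_mon_comm h12]) (by rwa [spanOn_mon_comm h1'2])
  exact mem_of_pow_mul_mem h12 h.x1y1 _ b1 b3 b2 N' N (hN' _ le_rfl) (hN _ le_rfl)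

end A2Relations

end Frame

/-! ## Maximality of quantum tori -/

section MaximalTorus

variable {A : Type*} [CommRing A] {F : Type*} [DivisionRing F] [Algebra A F]
variable {c : ℤ × ℤ → ℤ × ℤ → Aˣ} {m : ℤ × ℤ → F}

namespace TwistedBasis

theorem mem_inter (hm : TwistedBasis c m) {S S' : Set (ℤ × ℤ)} {x : F}
    (hx : x ∈ spanOn A m S) (hx' : x ∈ spanOn A m S') : x ∈ spanOn A m (S ∩ S') := by
  obtain ⟨y, hy, z, hz, rfl⟩ := exists_add_of_mem_spanOn (S₁ := S ∩ S') (S₂ := S \ S')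
    (fun f hf => by by_cases h : f ∈ S'; exacts [Or.inl ⟨hf, h⟩, Or.inr ⟨hf, h⟩]) hx
  have hz' : z ∈ spanOn A m S' := by
    have := Submodule.sub_mem _ hx' (spanOn_mono Set.inter_subset_right hy)
    rwa [add_sub_cancel_left] at this
  have : z = 0 := hm.eq_zero_of_disjoint Set.disjoint_sdiff_left hz hz'
  rwa [this, add_zero]

theorem mem_of_mul_mem (hm : TwistedBasis c m) {f : ℤ × ℤ} {x : F}
    (hx : m f * x ∈ spanOn A m Set.univ) : x ∈ spanOn A m Set.univ := by
  have h1 := hm.mul_mem (U := Set.univ) (fun _ _ _ _ => Set.mem_univ _)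
    (mem_spanOn m (Set.mem_univ (-f))) hx
  have h2 := Submodule.smul_mem _ (((c (-f) f)⁻¹ : Aˣ) : A) h1
  rwa [← mul_assoc, ← smul_mul_assoc, hm.smul_neg_mul, one_mul] at h2

theorem mem_of_pow_mul_mem (hm : TwistedBasis c m) {f : ℤ × ℤ} {x : F} (n : ℕ)
    (hx : m f ^ n * x ∈ spanOn A m Set.univ) : x ∈ spanOn A m Set.univ := by
  induction n with
  | zero => simpa using hx
  | succ n ih =>
    rw [pow_succ', mul_assoc] at hx
    exact ih (hm.mem_of_mul_mem hx)

theorem pow_mem_le {Γ : Type*} [AddCommGroup Γ] [LinearOrder Γ] [IsOrderedAddMonoid Γ]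
    (hm : TwistedBasis c m) {d : ℤ × ℤ →+ Γ} {γ : Γ} {x : F}
    (hx : x ∈ spanOn A m {f | d f ≤ γ}) (n : ℕ) : x ^ n ∈ spanOn A m {f | d f ≤ n • γ} := by
  induction n with
  | zero =>
    rw [pow_zero, ← hm.one]
    exact mem_spanOn m (by simp)
  | succ n ih =>
    rw [pow_succ]
    refine hm.mul_mem ?_ ih hx
    intro f hf g hg
    simp only [Set.mem_ofPred_eq] at *
    rw [map_add, succ_nsmul]
    exact add_le_add hf hg

theorem commute_of_forall {x y : F} (h : ∀ f, Commute x (m f))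
    (hy : y ∈ spanOn A m Set.univ) : Commute x y := by
  induction hy using Submodule.span_induction with
  | mem y hy =>
    obtain ⟨f, -, rfl⟩ := hy
    exact h f
  | zero => exact Commute.zero_right x
  | add y z _ _ hy hz => exact hy.add_right hz
  | smul a y _ hy => exact hy.smul_right a

end TwistedBasis

/-- The leading part of a central element is central. -/
theorem HasLead.commute {Γ : Type*} [AddCommGroup Γ] [LinearOrder Γ] [IsOrderedAddMonoid Γ]
    (hm : TwistedBasis c m) {d : ℤ × ℤ →+ Γ} {γ : Γ} {h x : F} (hx : HasLead A m d γ h x)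
    (hc : ∀ f, Commute x (m f)) (f : ℤ × ℤ) : Commute h (m f) := by
  have hf : HasLead A m d (d f) (m f) (m f) := HasLead.of_lead (mem_spanOn m rfl)
  have h1 := hx.mul hm hf
  have h2 := hf.mul hm hx
  rw [add_comm, ← (hc f).eq] at h2
  exact h1.unique hm h2

/-! ### Overrings of a torus with a common central denominator -/

section Order

variable {R : Subring F} {e : F}

/-- Powers with bounded denominators `e` force a quotient of small degree to vanish. -/
theorem TwistedBasis.eq_zero_of_commute_mul_mem (hm : TwistedBasis c m) {d : ℤ × ℤ →+ ℤ}
    {e w h r y : F} {D : ℤ} (he : e ≠ 0) (heT : e ∈ spanOn A m Set.univ)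
    (hey : ∀ n : ℕ, e * y ^ n ∈ spanOn A m Set.univ)
    (hw : HasLead A m d D h w) (hh : h ≠ 0) (hwe : Commute w e) (hwy : Commute w y)
    (hr : w * y = r) (hrD : r ∈ spanOn A m {f | d f ≤ D - 1})
    {b : ℤ} {h' : F} (hw' : HasLead A m (-d) b h' w) (hh' : h' ≠ 0)
    (hr' : r ∈ spanOn A m {f | (-d) f ≤ b}) : y = 0 := by
  by_contra hy
  obtain ⟨E, e₁, -, -, hE⟩ := exists_hasLead m d heT he
  obtain ⟨E', e₂, -, -, hE'⟩ := exists_hasLead m (-d) heT he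
  -- Formally y = r/w has top degree at most -1 and lowest degree at least 0. The denominator `e`
  -- blurs both bounds for yⁿ by a fixed total E + E', while the gap between them grows like n.
  obtain ⟨n, hn⟩ : ∃ n : ℕ, E + E' < n := ⟨(E + E' + 1).toNat, by omega⟩
  have hs0 : e * y ^ n ≠ 0 := mul_ne_zero he (pow_ne_zero _ hy)
  have key : w ^ n * (e * y ^ n) = e * r ^ n := by
    rw [← hr, hwy.mul_pow, ← mul_assoc, (hwe.pow_left n).eq, mul_assoc]
  obtain ⟨τ, k, hk, -, hτ⟩ := exists_hasLead m d (hey n) hs0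
  obtain ⟨β, k', hk', -, hβ⟩ := exists_hasLead m (-d) (hey n) hs0
  have h1 := (hw.pow hm n).mul hm hτ
  have h2 := (hw'.pow hm n).mul hm hβ
  rw [key] at h1 h2
  have h3 : e * r ^ n ∈ spanOn A m {f | d f ≤ E + n • (D - 1)} :=
    hm.mul_mem (fun f hf g hg => by
      simp only [Set.mem_ofPred_eq] at *
      rw [map_add]; exact add_le_add hf hg) hE.mem_le (hm.pow_mem_le hrD n)
  have h4 : e * r ^ n ∈ spanOn A m {f | (-d) f ≤ E' + n • b} :=
    hm.mul_mem (fun f hf g hg => by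
      simp only [Set.mem_ofPred_eq] at *
      rw [map_add]; exact add_le_add hf hg) hE'.mem_le (hm.pow_mem_le hr' n)
  obtain ⟨f, hf, hf'⟩ := h1.exists_mem hm (mul_ne_zero (pow_ne_zero _ hh) hk) h3
  obtain ⟨g, hg, hg'⟩ := h2.exists_mem hm (mul_ne_zero (pow_ne_zero _ hh') hk') h4
  have hf2 : d f ≤ E + n • (D - 1) := hf
  have hg2 : (-d) g ≤ E' + n • b := hg
  -- The lowest degree of a nonzero element does not exceed its top degree.
  have hτβ : -β ≤ τ := by
    by_contra hlt
    have h5 := hm.mem_inter hτ.mem_le hβ.mem_le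
    apply hs0
    refine spanOn_empty_eq_zero (A := A) (m := m) (spanOn_mono ?_ h5)
    intro f hf
    have hf3 : d f ≤ τ := hf.1
    have hf4 : -d f ≤ β := hf.2
    exfalso
    omega
  simp only [nsmul_eq_mul, mul_sub, mul_one] at hf' hf2 hg' hg2
  omega

/-- Division with remainder by a central element, up to powers of its leading part. -/
theorem TwistedBasis.exists_pow_mul_sub_mem (hm : TwistedBasis c m) {d : ℤ × ℤ →+ ℤ} {w h : F}
    {D : ℤ} (hw : HasLead A m d D h w) (hwT : ∀ f, Commute w (m f)) {g : ℤ × ℤ} (hg : d g = -D)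
    {b : ℤ} (hb : w ∈ spanOn A m {f | (-d) f ≤ b}) (n : ℕ) :
    ∀ x ∈ spanOn A m ({f | (-d) f ≤ b} ∩ {f | d f < D + n}), ∃ k : ℕ,
      ∃ p ∈ spanOn A m Set.univ,
        (h * m g) ^ k * x - p * w ∈ spanOn A m ({f | (-d) f ≤ b} ∩ {f | d f < D}) := by
  -- Removing the leading part does not introduce degrees below the lowest degree allowed for w.
  have hb' : w - h ∈ spanOn A m ({f | (-d) f ≤ b} ∩ {f | d f < D}) := by
    by_cases hh : h = 0
    · subst hh
      have := hw.rest
      rw [sub_zero] at this ⊢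
      exact hm.mem_inter hb this
    obtain ⟨y, hy, z, hz, hyz⟩ := exists_add_of_mem_spanOn
      (S₁ := {f | (-d) f ≤ b} ∩ {f | d f = D}) (S₂ := {f | (-d) f ≤ b} ∩ {f | d f < D})
      (fun f hf => (le_iff_eq_or_lt.1 (show d f ≤ D from hf.2)).imp (fun h => ⟨hf.1, h⟩)
        (fun h => ⟨hf.1, h⟩)) (hm.mem_inter hb hw.mem_le)
    have hyw : HasLead A m d D y w :=
      ⟨spanOn_mono Set.inter_subset_right hy, by
        rw [hyz, add_sub_cancel_left]; exact spanOn_mono Set.inter_subset_right hz⟩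
    rw [hw.unique hm hyw, hyz, add_sub_cancel_left]
    exact hz
  have hhm : h * m g ∈ spanOn A m {f | d f = 0} :=
    hm.mul_mem (fun f hf f' hf' => by
      simp only [Set.mem_ofPred_eq, Set.mem_singleton_iff] at *
      rw [map_add, hf, hf', hg, add_neg_cancel]) hw.lead (mem_spanOn m (Set.mem_singleton g))
  induction n with
  | zero =>
    intro x hx
    exact ⟨0, 0, Submodule.zero_mem _, by simpa using hx⟩
  | succ n ih =>
    intro x hx
    obtain ⟨y, hy, z, hz, rfl⟩ := exists_add_of_mem_spanOn
      (S₁ := {f | d f = D + n})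
      (S₂ := {f | (-d) f ≤ b} ∩ {f | d f < D + n})
      (fun f hf => by
        have h1 : d f < D + (n + 1 : ℕ) := hf.2
        push_cast at h1
        have h2 : d f = D + n ∨ d f < D + n := by omega
        exact h2.imp (fun h => h) (fun h => ⟨hf.1, h⟩)) hx
    have hv : m g * y ∈ spanOn A m {f | d f = n} :=
      hm.mul_mem (fun f hf f' hf' => by
        simp only [Set.mem_ofPred_eq, Set.mem_singleton_iff] at *
        rw [map_add, hf, hf', hg, neg_add_cancel_left]) (mem_spanOn m (Set.mem_singleton g)) hy
    have hcomm : h * (m g * y) = m g * y * h :=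
      TwistedBasis.commute_of_forall (hw.commute hm hwT) (spanOn_mono (Set.subset_univ _) hv)
    -- The factor `h * m g` has degree 0, and h is central in the torus, so subtracting `m g * y *
    -- w` cancels the top component y. The quotient term has degree n ≥ 0, so the lower degree bound
    -- survives.
    have hnew : h * m g * (y + z) - m g * y * w ∈
        spanOn A m ({f | (-d) f ≤ b} ∩ {f | d f < D + n}) := by
      have e : h * m g * (y + z) - m g * y * w = h * m g * z - m g * y * (w - h) := by
        rw [mul_add, mul_assoc h, hcomm, mul_sub]
        abel
      rw [e]
      refine Submodule.sub_mem _ (hm.mul_mem ?_ hhm hz) (hm.mul_mem ?_ hv hb')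
      · intro f hf f' hf'
        have h1 : d f = 0 := hf
        have h2 : -d f' ≤ b := hf'.1
        have h3 : d f' < D + n := hf'.2
        refine ⟨?_, ?_⟩
        · change -d (f + f') ≤ b
          rw [map_add]; omega
        · change d (f + f') < D + n
          rw [map_add]; omega
      · intro f hf f' hf'
        have h1 : d f = n := hf
        have h2 : -d f' ≤ b := hf'.1
        have h3 : d f' < D := hf'.2
        refine ⟨?_, ?_⟩
        · change -d (f + f') ≤ b
          rw [map_add]; omega
        · change d (f + f') < D + n
          rw [map_add]; omega
    obtain ⟨k, p, hp, hkp⟩ := ih _ hnew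
    refine ⟨k + 1, (h * m g) ^ k * (m g * y) + p, Submodule.add_mem _ ?_ hp, ?_⟩
    · exact hm.torus.mul_mem (hm.torus.pow_mem (spanOn_mono (Set.subset_univ _) hhm) k)
        (spanOn_mono (Set.subset_univ _) hv)
    · convert hkp using 1
      rw [pow_succ, mul_sub, add_mul]
      simp only [mul_assoc]
      abel

/-- Let `R` be a ring between a quantum torus and its division ring of fractions, with `e R` in the
torus for a central `e`. The leading part of a central denominator is again a denominator, up to
powers. -/
theorem TwistedBasis.exists_pow_lead_mul_mem (hm : TwistedBasis c m)
    (hT : ∀ f, m f ∈ R) (hA : ∀ a : A, algebraMap A F a ∈ R) (he : e ≠ 0)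
    (heR : ∀ y ∈ R, e * y ∈ spanOn A m Set.univ) (heT : e ∈ spanOn A m Set.univ)
    {d : ℤ × ℤ →+ ℤ} (hd : Function.Surjective d) {w h : F} {D : ℤ}
    (hwT : w ∈ spanOn A m Set.univ) (hwR : ∀ y ∈ R, Commute w y) (hw : HasLead A m d D h w)
    (hh : h ≠ 0) {x : F} (hx : x ∈ R) (hwx : w * x ∈ spanOn A m Set.univ) :
    ∃ k : ℕ, h ^ k * x ∈ spanOn A m Set.univ := by
  have hTR : ∀ y ∈ spanOn A m Set.univ, y ∈ R := by
    intro y hy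
    induction hy using Submodule.span_induction with
    | mem y hy => obtain ⟨f, -, rfl⟩ := hy; exact hT f
    | zero => exact zero_mem _
    | add y z _ _ hy hz => exact add_mem hy hz
    | smul a y _ hy => rw [Algebra.smul_def]; exact R.mul_mem (hA a) hy
  have hwm : ∀ f, Commute w (m f) := fun f => hwR _ (hT f)
  have hw0 := hw.ne_zero hm hh
  have hhT : h ∈ spanOn A m Set.univ := spanOn_mono (Set.subset_univ _) hw.lead
  obtain ⟨b, h', hh', -, hb⟩ := exists_hasLead m (-d) hwT hw0
  obtain ⟨g, hg⟩ := hd (-D)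
  obtain ⟨t, -, ht⟩ := exists_finset_of_mem_spanOn hwx
  obtain ⟨N, hN⟩ : ∃ N : ℕ, ∀ f ∈ t, -d f ≤ b + N := by
    refine ⟨t.sup fun f => (-d f - b).toNat, fun f hf => ?_⟩
    have := Finset.le_sup (f := fun f => (-d f - b).toNat) hf
    omega
  -- A monomial of degree N shifts `w * x` up until its lowest degree is at least that of w, as the
  -- division requires.
  obtain ⟨f₀, hf₀⟩ := hd N
  obtain ⟨n, hn⟩ : ∃ n : ℕ, ∀ f ∈ t, d f + N < D + n := by
    refine ⟨t.sup fun f => (d f + N - D + 1).toNat, fun f hf => ?_⟩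
    have := Finset.le_sup (f := fun f => (d f + N - D + 1).toNat) hf
    omega
  have hx₁R : m f₀ * x ∈ R := R.mul_mem (hT f₀) hx
  have ht' : w * (m f₀ * x) ∈ spanOn A m ({f | (-d) f ≤ b} ∩ {f | d f < D + n}) := by
    rw [← mul_assoc, (hwm f₀).eq, mul_assoc]
    refine hm.mul_mem (S := {f₀}) ?_ (mem_spanOn m (Set.mem_singleton f₀)) ht
    rintro _ rfl f hf
    have h1 := hN f hf
    have h2 := hn f hf
    refine ⟨?_, ?_⟩
    · change -d (_ + f) ≤ b
      rw [map_add]; omega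
    · change d (_ + f) < D + n
      rw [map_add]; omega
  obtain ⟨k, p, hp, hkp⟩ := hm.exists_pow_mul_sub_mem hw hwm hg hb.mem_le n _ ht'
  have hhmT : h * m g ∈ spanOn A m Set.univ :=
    hm.torus.mul_mem hhT (mem_spanOn m (Set.mem_univ g))
  have hwp : Commute w p := hwR _ (hTR _ hp)
  have hwh : Commute w ((h * m g) ^ k) := hwR _ (pow_mem (hTR _ hhmT) k)
  have hyR : (h * m g) ^ k * (m f₀ * x) - p ∈ R :=
    sub_mem (R.mul_mem (pow_mem (hTR _ hhmT) k) hx₁R) (hTR _ hp)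
  -- Multiplied by w, this element of `R` becomes the remainder of the division, whose degrees are
  -- below the top and not below the lowest degree of w; hence it vanishes.
  have hy : (h * m g) ^ k * (m f₀ * x) - p = 0 := by
    refine hm.eq_zero_of_commute_mul_mem (d := d) (D := D) (h := h) he heT
      (fun n => heR _ (pow_mem hyR n)) hw hh (hwR _ (hTR _ heT)) (hwR _ hyR) rfl ?_ hb hh' ?_
    all_goals
      have e1 : w * ((h * m g) ^ k * (m f₀ * x) - p) =
          (h * m g) ^ k * (w * (m f₀ * x)) - p * w := by
        rw [mul_sub, ← mul_assoc, hwh.eq, mul_assoc, hwp.eq]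
      rw [e1]
    · refine spanOn_mono ?_ hkp
      intro f hf
      have : d f < D := hf.2
      change d f ≤ D - 1
      omega
    · exact spanOn_mono (fun f hf => hf.1) hkp
  have h1 : m g ^ k * (m f₀ * (h ^ k * x)) ∈ spanOn A m Set.univ := by
    have hc : ∀ f, Commute h (m f) := hw.commute hm hwm
    rw [sub_eq_zero] at hy
    have e2 : m g ^ k * (m f₀ * (h ^ k * x)) = (h * m g) ^ k * (m f₀ * x) := by
      rw [(hc g).mul_pow, ← mul_assoc (m f₀), ← ((hc f₀).pow_left k).eq, mul_assoc (h ^ k),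
        ← mul_assoc (m g ^ k), ← ((hc g).pow_pow k k).eq, mul_assoc]
    rw [e2, hy]
    exact hp
  exact ⟨k, hm.mem_of_mul_mem (hm.mem_of_pow_mul_mem k h1)⟩

/-- A central denominator can be replaced by one in the coefficient ring. -/
theorem TwistedBasis.exists_smul_mem (hm : TwistedBasis c m)
    (hT : ∀ f, m f ∈ R) (hA : ∀ a : A, algebraMap A F a ∈ R) (he : e ≠ 0)
    (heR : ∀ y ∈ R, e * y ∈ spanOn A m Set.univ) (hec : ∀ y ∈ R, Commute e y) {x : F}
    (hx : x ∈ R) : ∃ (a : A) (n : ℕ), a • (1 : F) ≠ 0 ∧ a ^ n • x ∈ spanOn A m Set.univ := by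
  have heT : e ∈ spanOn A m Set.univ := by simpa using heR 1 R.one_mem
  -- The leading part for the first exponent, followed by that of its power for the second exponent,
  -- leaves a single term a · m(kD, D'), whose monomial is invertible in the torus.
  obtain ⟨D, h, hh, -, hl⟩ := exists_hasLead m (AddMonoidHom.fst ℤ ℤ) heT he
  obtain ⟨k, hk⟩ := hm.exists_pow_lead_mul_mem hT hA he heR heT (d := AddMonoidHom.fst ℤ ℤ)
    (fun n => ⟨(n, 0), rfl⟩) heT hec hl hh hx (heR x hx)
  -- h commutes with the torus, hence with e and e y; cancelling e extends this to y in `R`.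
  have hh' : ∀ y ∈ R, Commute h y := by
    intro y hy
    have h1 : Commute h (e * y) :=
      TwistedBasis.commute_of_forall (hl.commute hm fun f => hec _ (hT f)) (heR y hy)
    have h2 : Commute h e :=
      TwistedBasis.commute_of_forall (hl.commute hm fun f => hec _ (hT f)) heT
    have h3 : e * (h * y) = e * (y * h) := by
      rw [← mul_assoc, ← h2.eq, mul_assoc, h1.eq, mul_assoc]
    exact mul_left_cancel₀ he h3
  have hkR : ∀ y ∈ R, Commute (h ^ k) y := fun y hy => (hh' y hy).pow_left k
  have hk0 : h ^ k ≠ 0 := pow_ne_zero _ hh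
  have hkT : h ^ k ∈ spanOn A m {f | (AddMonoidHom.fst ℤ ℤ) f = k • D} := (hl.pow hm k).lead
  have hkT' : h ^ k ∈ spanOn A m Set.univ := spanOn_mono (Set.subset_univ _) hkT
  obtain ⟨D', h', hh2, hmem, hl'⟩ := exists_hasLead m (AddMonoidHom.snd ℤ ℤ) hkT hk0
  obtain ⟨n, hn⟩ := hm.exists_pow_lead_mul_mem hT hA he heR heT (d := AddMonoidHom.snd ℤ ℤ)
    (fun n => ⟨(0, n), rfl⟩) hkT' hkR hl' hh2 hx hk
  obtain ⟨a, ha⟩ : ∃ a : A, h' = a • m (k • D, D') := by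
    refine mem_spanOn_singleton.1 (spanOn_mono ?_ (hm.mem_inter hmem hl'.lead))
    rintro f ⟨hf, hf'⟩
    exact Prod.ext hf hf'
  refine ⟨a, n, ?_, ?_⟩
  · intro h0
    apply hh2
    rw [ha, ← one_mul (m _), ← smul_mul_assoc, h0, zero_mul]
  · rw [ha, smul_pow, smul_mul_assoc, ← mul_smul_comm] at hn
    exact hm.mem_of_pow_mul_mem n hn

/-- Over a completely integrally closed domain, an element of `R` with a denominator in the
coefficient ring lies in the torus. -/
theorem TwistedBasis.mem_of_smul_mem [IsDomain A] (hm : TwistedBasis c m)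
    (hcic : ∀ a b r : A, a ≠ 0 → r ≠ 0 → (∀ n : ℕ, a ^ n ∣ r * b ^ n) → a ∣ b)
    (hT : ∀ f, m f ∈ R) (hA : ∀ a : A, algebraMap A F a ∈ R) (he : e ≠ 0)
    (heR : ∀ y ∈ R, e * y ∈ spanOn A m Set.univ) {a : A} (ha : a ≠ 0) (s : Finset (ℤ × ℤ)) :
    ∀ x ∈ R, a • x ∈ spanOn A m (s : Set (ℤ × ℤ)) → x ∈ spanOn A m Set.univ := by
  have hsmul0 : ∀ b : A, ∀ f, b • m f = 0 → b = 0 := by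
    intro b f hb
    exact linearIndependent_iff'.1 hm.li {f} (fun _ => b) (by simpa using hb) f
      (Finset.mem_singleton_self _)
  have ha1 : algebraMap A F a ≠ 0 := by
    intro h
    apply ha
    apply hsmul0 a 0
    rw [Algebra.smul_def, h, zero_mul]
  have heT : e ∈ spanOn A m Set.univ := by simpa using heR 1 R.one_mem
  induction s using Finset.strongInduction with
  | H s ih =>
    intro x hx hax
    by_cases hx0 : x = 0
    · rw [hx0]
      exact Submodule.zero_mem _
    have hax0 : a • x ≠ 0 := by
      rw [Algebra.smul_def]
      exact mul_ne_zero ha1 hx0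
    obtain ⟨γ, h, hh, h1, h2⟩ := exists_hasLead_of_mem_finset m lexDegree s hax hax0
    have hl : HasLead A m lexDegree γ h (a • x) :=
      ⟨spanOn_mono (fun f hf => hf.2) h1, spanOn_mono (fun f hf => hf.2) h2⟩
    obtain ⟨f, hγ, b, rfl⟩ := hl.exists_smul lexDegree_injective hh
    rw [hγ] at hl h1 h2
    have hfs : f ∈ s := by
      by_contra hfs
      refine hh (spanOn_empty_eq_zero (A := A) (m := m) (spanOn_mono ?_ h1))
      rintro f' ⟨hf', hf''⟩
      exact hfs (lexDegree_injective hf'' ▸ hf')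
    have hab : a ∣ b := by
      obtain ⟨γ', h', hh', -, hl'⟩ := exists_hasLead m lexDegree heT he
      obtain ⟨g, hγ', r, rfl⟩ := hl'.exists_smul lexDegree_injective hh'
      rw [hγ'] at hl'
      have hr : r ≠ 0 := by
        rintro rfl
        exact hh' (zero_smul _ _)
      have hmf : HasLead A m lexDegree (lexDegree (-f)) (m (-f)) (m (-f)) :=
        HasLead.of_lead (mem_spanOn m rfl)
      have hl2 := hl.mul hm hmf
      rw [← map_add, add_neg_cancel, map_zero, smul_mul_assoc, hm.mul, add_neg_cancel, hm.one,
        smul_smul] at hl2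
      -- Normalise the leading exponent of a x to 0 by `m (-f)`. If r is the leading coefficient of
      -- e at exponent g, comparing coefficients at g in aⁿ · e(x m(-f))ⁿ shows that aⁿ divides r
      -- times the n-th power of the normalised leading coefficient.
      have hdvd : a ∣ b * (c f (-f) : A) := by
        refine hcic a _ r ha hr fun n => ?_
        have hy : e * (x * m (-f)) ^ n ∈ spanOn A m Set.univ :=
          heR _ (pow_mem (R.mul_mem hx (hT _)) n)
        obtain ⟨y, hy1, z, hz1, hyz⟩ := exists_add_of_mem_spanOn (S₁ := {g}) (S₂ := {g}ᶜ)
          (fun f _ => by rw [Set.union_compl_self]; trivial) hy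
        obtain ⟨α, rfl⟩ := mem_spanOn_singleton.1 hy1
        have hl3 := hl'.mul hm (hl2.pow hm n)
        rw [nsmul_zero, add_zero, smul_mul_assoc, smul_pow, one_pow, smul_mul_assoc, smul_pow,
          mul_smul_comm, mul_smul_comm, hyz, mul_one, smul_smul] at hl3
        have h5 : (a ^ n * α - r * (b * (c f (-f) : A)) ^ n) • m g = 0 := by
          refine hm.eq_zero_of_disjoint (S := {g}) (S' := {g}ᶜ) disjoint_compl_right
            (Submodule.smul_mem _ _ (mem_spanOn m (Set.mem_singleton g))) ?_
          have h6 := Submodule.sub_mem _ (spanOn_mono (S' := {g}ᶜ) (by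
            rintro f' hf' rfl
            exact lt_irrefl (lexDegree f') hf') hl3.rest) (Submodule.smul_mem _ (a ^ n) hz1)
          convert h6 using 1
          rw [sub_smul, smul_add, mul_smul]
          abel
        exact ⟨α, (sub_eq_zero.1 (hsmul0 _ _ h5)).symm⟩
      exact (Units.dvd_mul_right).1 hdvd
    obtain ⟨b, rfl⟩ := hab
    have hbm : b • m f ∈ spanOn A m Set.univ := Submodule.smul_mem _ _ (mem_spanOn m trivial)
    -- Now b denotes the quotient by a; subtracting the term `b • m f` stays in `R` and removes f
    -- from the support of the multiple by a.
    have hrest := ih (s.filter fun g => lexDegree g < lexDegree f)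
      (Finset.filter_ssubset.2 ⟨f, hfs, lt_irrefl _⟩) (x - b • m f)
      (sub_mem hx (by rw [Algebra.smul_def]; exact R.mul_mem (hA b) (hT f)))
      (by rw [smul_sub, smul_smul]; simpa using h2)
    simpa using Submodule.add_mem _ hrest hbm

/-- The central denominator is first moved into the coefficient ring, where complete integral
closedness disposes of it. -/
theorem TwistedBasis.mem_of_mul_mem_of_commute [IsDomain A] (hm : TwistedBasis c m)
    (hcic : ∀ a b r : A, a ≠ 0 → r ≠ 0 → (∀ n : ℕ, a ^ n ∣ r * b ^ n) → a ∣ b)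
    (hT : ∀ f, m f ∈ R) (hA : ∀ a : A, algebraMap A F a ∈ R) (he : e ≠ 0)
    (heR : ∀ y ∈ R, e * y ∈ spanOn A m Set.univ) (hec : ∀ y ∈ R, Commute e y) {x : F}
    (hx : x ∈ R) : x ∈ spanOn A m Set.univ := by
  obtain ⟨a, n, ha, hax⟩ := hm.exists_smul_mem hT hA he heR hec hx
  have ha0 : a ≠ 0 := by
    rintro rfl
    exact ha (zero_smul _ _)
  obtain ⟨s, -, hs⟩ := exists_finset_of_mem_spanOn hax
  exact hm.mem_of_smul_mem hcic hT hA he heR (pow_ne_zero n ha0) s x hx hs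

end Order

/-! ### The central monomial u^ℓ v^ℓ and localisation to a torus -/

namespace QuasiComm

variable {s : Aˣ} {u v : F} {ℓ : ℕ}

theorem commute_mon (h : QuasiComm s u v) (hs : s ^ ℓ = 1) (f : ℤ × ℤ) :
    Commute (mon u v (ℓ, ℓ)) (mon u v f) := by
  have hsl : s ^ (ℓ : ℤ) = 1 := by rw [zpow_natCast, hs]
  have h1 : ∀ i : ℤ, s ^ (-(i * ℓ)) = 1 := fun i => by
    rw [mul_comm, ← mul_neg, zpow_mul, hsl, one_zpow]
  have h2 : ∀ i : ℤ, s ^ (-((ℓ : ℤ) * i)) = 1 := fun i => by rw [mul_comm, h1]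
  rw [Commute, SemiconjBy, h.mon_mul, h.mon_mul]
  simp only [h1, h2]
  rw [add_comm]

theorem mon_mem (ℓ : ℕ) {B : Subalgebra A F} (hu : u ∈ B) (hv : v ∈ B) :
    mon u v (ℓ, ℓ) ∈ B := by
  simp only [mon, zpow_natCast]
  exact mul_mem (pow_mem hu _) (pow_mem hv _)

/-- Multiplication by a high power of u^ℓ v^ℓ makes all exponents nonnegative: inverting this one
monomial in `B` reaches the whole torus. -/
theorem exists_mon_pow_mul_mem (h : QuasiComm s u v) (hℓ : 0 < ℓ) {B : Subalgebra A F}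
    (hu : u ∈ B) (hv : v ∈ B) {x : F} (hx : x ∈ spanOn A (mon u v) Set.univ) :
    ∃ N : ℕ, mon u v (ℓ, ℓ) ^ N * x ∈ B := by
  have hwB := mon_mem (A := A) ℓ hu hv
  induction hx using Submodule.span_induction with
  | mem x hx =>
    obtain ⟨f, -, rfl⟩ := hx
    obtain ⟨N, hN1, hN2⟩ : ∃ N : ℕ, 0 ≤ N * (ℓ : ℤ) + f.1 ∧ 0 ≤ N * (ℓ : ℤ) + f.2 := by
      have hℓ' : (1 : ℤ) ≤ ℓ := by exact_mod_cast hℓ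
      have h0 : ((f.1.natAbs + f.2.natAbs : ℕ) : ℤ) * 1 ≤ (f.1.natAbs + f.2.natAbs : ℕ) * (ℓ : ℤ) :=
        mul_le_mul_of_nonneg_left hℓ' (by positivity)
      exact ⟨f.1.natAbs + f.2.natAbs, by omega, by omega⟩
    have hwN : ∀ N : ℕ, ∃ a : A, mon u v (ℓ, ℓ) ^ N = a • mon u v (N * ℓ, N * ℓ) := by
      intro N
      induction N with
      | zero => exact ⟨1, by simp [mon]⟩
      | succ N ih =>
        obtain ⟨a, ha⟩ := ih
        refine ⟨a * ((s ^ (-((ℓ : ℤ) * (N * ℓ))) : Aˣ) : A), ?_⟩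
        rw [pow_succ, ha, smul_mul_assoc, h.mon_mul, smul_smul, Prod.mk_add_mk]
        push_cast
        rw [add_mul, one_mul]
    refine ⟨N, ?_⟩
    obtain ⟨a, ha⟩ := hwN N
    rw [ha, smul_mul_assoc, h.mon_mul]
    refine B.smul_mem (B.smul_mem ?_ _) _
    obtain ⟨i, hi⟩ := Int.eq_ofNat_of_zero_le hN1
    obtain ⟨j, hj⟩ := Int.eq_ofNat_of_zero_le hN2
    simp only [mon, Prod.fst_add, Prod.snd_add, hi, hj, zpow_natCast]
    exact mul_mem (pow_mem hu _) (pow_mem hv _)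
  | zero => exact ⟨0, by simp⟩
  | add x y _ _ hx hy =>
    obtain ⟨N, hN⟩ := hx
    obtain ⟨N', hN'⟩ := hy
    refine ⟨N + N', ?_⟩
    have e1 : mon u v (ℓ, ℓ) ^ (N + N') * (x + y) =
        mon u v (ℓ, ℓ) ^ N' * (mon u v (ℓ, ℓ) ^ N * x) +
          mon u v (ℓ, ℓ) ^ N * (mon u v (ℓ, ℓ) ^ N' * y) := by
      rw [mul_add, ← mul_assoc, ← mul_assoc, ← pow_add, ← pow_add, add_comm N']
    rw [e1]
    exact add_mem (mul_mem (pow_mem hwB _) hN) (mul_mem (pow_mem hwB _) hN')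
  | smul a x _ hx =>
    obtain ⟨N, hN⟩ := hx
    exact ⟨N, by rw [mul_smul_comm]; exact B.smul_mem hN a⟩

end QuasiComm

/-- Let `B` be a subalgebra of a quantum torus that contains the two generators. A ring between `B`
and a multiple `e⁻¹ B` with `e` central lies in the torus. -/
theorem QuasiComm.mem_spanOn_of_mul_mem [IsDomain A] {s : Aˣ} {u v : F} {ℓ : ℕ}
    (h : QuasiComm s u v) (hs : s ^ ℓ = 1) (hℓ : 0 < ℓ) (li : LinearIndependent A (mon u v))
    (hcic : ∀ a b r : A, a ≠ 0 → r ≠ 0 → (∀ n : ℕ, a ^ n ∣ r * b ^ n) → a ∣ b)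
    (B : Subalgebra A F) (hu : u ∈ B) (hv : v ∈ B) (hBT : ∀ x ∈ B, x ∈ spanOn A (mon u v) Set.univ)
    (R : Subring F) (hBR : ∀ x ∈ B, x ∈ R) {e : F} (he : e ≠ 0)
    (heR : ∀ y ∈ R, e * y ∈ B) (hec : ∀ y ∈ R, Commute e y) {x : F} (hx : x ∈ R) :
    x ∈ spanOn A (mon u v) Set.univ := by
  have tb := h.twistedBasis li
  set w := mon u v (ℓ, ℓ) with hw
  have hwm : ∀ f, Commute w (mon u v f) := h.commute_mon hs
  have hwB : w ∈ B := QuasiComm.mon_mem ℓ hu hv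
  have hwR : ∀ y ∈ R, Commute w y := by
    intro y hy
    have h1 : Commute w (e * y) := TwistedBasis.commute_of_forall hwm (hBT _ (heR y hy))
    have h2 : Commute w e := (hec w (hBR w hwB)).symm
    have h3 : e * (w * y) = e * (y * w) := by
      rw [← mul_assoc, ← h2.eq, mul_assoc, h1.eq, mul_assoc]
    exact mul_left_cancel₀ he h3
  -- The localisation of `R` at w. The commutation conditions make it closed under products; it
  -- contains the torus, and e multiplies it into the torus.
  let R' : Subring F :=
    { carrier := {y | Commute w y ∧ Commute e y ∧ ∃ N : ℕ, w ^ N * y ∈ R}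
      mul_mem' := by
        rintro y z ⟨hy1, hy2, N, hN⟩ ⟨hz1, hz2, N', hN'⟩
        refine ⟨hy1.mul_right hz1, hy2.mul_right hz2, N + N', ?_⟩
        have e1 : w ^ (N + N') * (y * z) = (w ^ N * y) * (w ^ N' * z) := by
          rw [pow_add, mul_assoc, mul_assoc, ← mul_assoc (w ^ N') y, (hy1.pow_left N').eq,
            mul_assoc]
        rw [e1]
        exact R.mul_mem hN hN'
      one_mem' := ⟨Commute.one_right _, Commute.one_right _, 0, by simp⟩
      add_mem' := by
        rintro y z ⟨hy1, hy2, N, hN⟩ ⟨hz1, hz2, N', hN'⟩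
        refine ⟨hy1.add_right hz1, hy2.add_right hz2, N + N', ?_⟩
        have e1 : w ^ (N + N') * (y + z) = w ^ N' * (w ^ N * y) + w ^ N * (w ^ N' * z) := by
          rw [mul_add, ← mul_assoc, ← mul_assoc, ← pow_add, ← pow_add, add_comm N']
        rw [e1]
        exact R.add_mem (R.mul_mem (pow_mem (hBR w hwB) _) hN)
          (R.mul_mem (pow_mem (hBR w hwB) _) hN')
      zero_mem' := ⟨Commute.zero_right _, Commute.zero_right _, 0, by simp⟩
      neg_mem' := by
        rintro y ⟨hy1, hy2, N, hN⟩
        exact ⟨hy1.neg_right, hy2.neg_right, N, by rw [mul_neg]; exact R.neg_mem hN⟩ }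
  have hRR' : ∀ y ∈ R, y ∈ R' := fun y hy => ⟨hwR y hy, hec y hy, 0, by simpa using hy⟩
  refine tb.mem_of_mul_mem_of_commute (R := R') (e := e) hcic ?_ ?_ he ?_ ?_ (hRR' x hx)
  · intro f
    have heu : Commute e u := hec u (hBR u hu)
    have hev : Commute e v := hec v (hBR v hv)
    refine ⟨hwm f, (heu.zpow_right₀ _).mul_right (hev.zpow_right₀ _), ?_⟩
    obtain ⟨N, hN⟩ := h.exists_mon_pow_mul_mem hℓ hu hv (mem_spanOn (mon u v) (Set.mem_univ f))
    exact ⟨N, hBR _ hN⟩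
  · intro a
    exact hRR' _ (hBR _ (B.algebraMap_mem a))
  · rintro y ⟨hy1, hy2, N, hN⟩
    refine tb.mem_of_pow_mul_mem N (f := (ℓ, ℓ)) ?_
    have e1 : mon u v (ℓ, ℓ) ^ N * (e * y) = e * (w ^ N * y) := by
      rw [← hw, ← mul_assoc, ← mul_assoc, ((hec w (hBR w hwB)).pow_right N).eq]
    rw [e1]
    exact hBT _ (heR _ hN)
  · exact fun y hy => hy.2.1

end MaximalTorus

/-! ## Division rings of fractions -/

section Fractions

open scoped nonZeroDivisors

variable {D : Type*} [Ring D] [Nontrivial D] [NoZeroDivisors D]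

/-- b is algebraic over the centre, so it divides a nonzero central element. The cofactor commutes
with b because b(b'b) = zb = bz. -/
theorem exists_mul_eq_center [Module.Finite (Subring.center D) D] {b : D} (hb : b ≠ 0) :
    ∃ b' z : D, z ≠ 0 ∧ (∀ y, Commute z y) ∧ b * b' = z ∧ b' * b = z := by
  have hb' : b ∈ D⁰ := mem_nonZeroDivisors_of_ne_zero hb
  have halg : IsAlgebraic (Subring.center D) b := (IsIntegral.of_finite _ b).isAlgebraic
  obtain ⟨z, hz, b', hb'⟩ := halg.exists_nonzero_dvd hb'
  have hz' : (algebraMap (Subring.center D) D z : D) = z := rfl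
  rw [hz'] at hb'
  have hzc : ∀ y, Commute (z : D) y := fun y => (Subring.mem_center_iff.1 z.2 y).symm
  refine ⟨b', z, fun h => hz (Subtype.ext h), hzc, hb'.symm, ?_⟩
  apply mul_left_cancel₀ hb
  rw [← mul_assoc, ← hb', (hzc b).eq]

/-- A domain that is finite over its center embeds in a division ring in which every element is a
fraction with central denominator. -/
theorem exists_divisionRing {A : Type u} [CommRing A] {D : Type w} [Ring D] [Algebra A D]
    [Nontrivial D] [NoZeroDivisors D] [Module.Finite (Subring.center D) D] :
    ∃ (F : Type w) (_ : DivisionRing F) (_ : Algebra A F) (φ : D →ₐ[A] F),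
      Function.Injective φ ∧ Module.Finite (Subring.center F) F ∧
      ∀ x : F, ∃ t z : D, z ≠ 0 ∧ (∀ y, Commute (φ z) y) ∧ x = φ t * (φ z)⁻¹ := by
  have hore : Nonempty (OreLocalization.OreSet D⁰) := by
    -- The Ore condition holds because every nonzero s has a left multiple b's = z that is central:
    -- (r b')s = z r.
    rw [OreLocalization.nonempty_oreSet_iff_of_noZeroDivisors]
    intro r s
    obtain ⟨b', z, hz, hzc, -, h2⟩ := exists_mul_eq_center (nonZeroDivisors.ne_zero s.2)
    exact ⟨r * b', ⟨z, mem_nonZeroDivisors_of_ne_zero hz⟩, by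
      rw [mul_assoc, h2]; exact hzc r⟩
  obtain ⟨_⟩ := hore
  let φ : D →ₐ[A] OreLocalization D⁰ D :=
    { OreLocalization.numeratorRingHom with commutes' := fun a => rfl }
  have hφ : Function.Injective φ := 
    OreLocalization.numeratorHom_inj inf_le_left
  have hfrac : ∀ x : OreLocalization D⁰ D, ∃ s r : D, s ≠ 0 ∧ φ s * x = φ r := by
    intro x
    induction x using OreLocalization.ind with
    | _ r s =>
      exact ⟨s, r, nonZeroDivisors.ne_zero s.2, OreLocalization.mul_cancel⟩
  have hc : ∀ z : D, (∀ y, Commute z y) → ∀ x, Commute (φ z) x := by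
    intro z hz x
    obtain ⟨s, r, hs, hsr⟩ := hfrac x
    have hs' : φ s ≠ 0 := by rwa [Ne, map_eq_zero_iff φ hφ]
    apply mul_left_cancel₀ hs'
    rw [← mul_assoc, ← map_mul, ← (hz s).eq, map_mul, mul_assoc, hsr, ← mul_assoc, hsr, ← map_mul,
      ← map_mul, (hz r).eq]
  have hfrac' : ∀ x, ∃ t z : D, z ≠ 0 ∧ (∀ y, Commute (φ z) y) ∧ x = φ t * (φ z)⁻¹ := ?_
  · refine ⟨OreLocalization D⁰ D, inferInstance, inferInstance, φ, hφ, ?_, hfrac'⟩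
    obtain ⟨S, hS⟩ := Module.Finite.fg_top (R := Subring.center D) (M := D)
    have hmem : ∀ t : D, φ t ∈ Submodule.span (Subring.center (OreLocalization D⁰ D))
        (φ '' (S : Set D)) := by
      intro t
      have ht : t ∈ Submodule.span (Subring.center D) (S : Set D) := hS ▸ Submodule.mem_top
      induction ht using Submodule.span_induction with
      | mem t ht => exact Submodule.subset_span ⟨t, ht, rfl⟩
      | zero => rw [map_zero]; exact Submodule.zero_mem _
      | add x y _ _ hx hy => rw [map_add]; exact Submodule.add_mem _ hx hy
      | smul c t _ ht =>
        have e : φ (c • t) = φ c * φ t := map_mul φ _ _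
        rw [e]
        exact Submodule.smul_mem _ (⟨φ c, Subring.mem_center_iff.2 fun y =>
          (hc c (fun y => (Subring.mem_center_iff.1 c.2 y).symm) y).symm⟩ :
            Subring.center (OreLocalization D⁰ D)) ht
    refine ⟨Submodule.fg_def.2 ⟨φ '' (S : Set D), S.finite_toSet.image _,
      top_unique fun x _ => ?_⟩⟩
    obtain ⟨t, z, -, hzc, rfl⟩ := hfrac' x
    rw [← ((hzc (φ t)).inv_left₀).eq]
    exact Submodule.smul_mem _ (⟨(φ z)⁻¹, Subring.mem_center_iff.2 fun y =>
      ((hzc y).inv_left₀).symm⟩ : Subring.center (OreLocalization D⁰ D)) (hmem t)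
  intro x
  obtain ⟨s, r, hs, hsr⟩ := hfrac x
  obtain ⟨b', z, hz, hzc, -, h2⟩ := exists_mul_eq_center hs
  have hz' : φ z ≠ 0 := by rwa [Ne, map_eq_zero_iff φ hφ]
  -- From s x = r and b's = z one gets z x = b'r, a central denominator.
  refine ⟨b' * r, z, hz, hc z hzc, ?_⟩
  rw [eq_mul_inv_iff_mul_eq₀ hz', ← (hc z hzc x).eq, ← h2, map_mul, map_mul, mul_assoc, hsr]

end Fractions

/-! ## A toric frame of type `A₂` -/

section ConcreteTorus

variable {A : Type w} [CommRing A]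

/-- The translation of the group algebra of `ℤ²` by `f`, twisted by powers of `q`. -/
noncomputable def twistedTranslation (q : Aˣ) (f : ℤ × ℤ) : Module.End A ((ℤ × ℤ) →₀ A) :=
  Finsupp.linearCombination A fun g =>
    ((q ^ (f.1 * g.2 - f.2 * g.1) : Aˣ) : A) • Finsupp.single (f + g) (1 : A)

theorem twistedTranslation_single (q : Aˣ) (f g : ℤ × ℤ) :
    twistedTranslation q f (Finsupp.single g 1) =
      ((q ^ (f.1 * g.2 - f.2 * g.1) : Aˣ) : A) • Finsupp.single (f + g) (1 : A) := by
  rw [twistedTranslation, Finsupp.linearCombination_single, one_smul]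

/-- Realising the torus by operators makes associativity automatic. The twist is bimultiplicative,
so translations compose with the same twist; independence is seen on the basis vector at 0. -/
theorem twistedTranslation_twistedBasis (q : Aˣ) :
    TwistedBasis (fun f g => q ^ (f.1 * g.2 - f.2 * g.1)) (twistedTranslation q) where
  one := by
    refine Finsupp.lhom_ext' fun g => LinearMap.ext_ring ?_
    simp [twistedTranslation_single]
  mul f g := by
    refine Finsupp.lhom_ext' fun h => LinearMap.ext_ring ?_
    simp only [LinearMap.comp_apply, Finsupp.lsingle_apply, Module.End.mul_apply,
      LinearMap.smul_apply, twistedTranslation_single, map_smul, smul_smul, ← Units.val_mul,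
      ← zpow_add, add_assoc]
    congr 3
    simp only [Prod.fst_add, Prod.snd_add]
    ring
  li := by
    have h : LinearIndependent A fun f : ℤ × ℤ => Finsupp.single f (1 : A) :=
      Finsupp.linearIndependent_single_one A (ℤ × ℤ)
    refine LinearIndependent.of_comp
      (LinearMap.applyₗ (Finsupp.single (0 : ℤ × ℤ) (1 : A)) :
        Module.End A ((ℤ × ℤ) →₀ A) →ₗ[A] _) ?_
    convert h using 1
    ext1 f
    simp [twistedTranslation_single]

/-- Lexicographic leading terms are single terms, and their coefficients multiply to a nonzero
element of a domain, up to a unit. -/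
theorem TwistedBasis.mul_ne_zero [IsDomain A] {E : Type*} [Ring E] [Algebra A E]
    {c : ℤ × ℤ → ℤ × ℤ → Aˣ} {m : ℤ × ℤ → E} (hm : TwistedBasis c m) {x y : E}
    (hx : x ∈ spanOn A m Set.univ) (hy : y ∈ spanOn A m Set.univ) (hx0 : x ≠ 0) (hy0 : y ≠ 0) :
    x * y ≠ 0 := by
  obtain ⟨γ, h, hh, -, hl⟩ := exists_hasLead m lexDegree hx hx0
  obtain ⟨f, hγ, a, rfl⟩ := hl.exists_smul lexDegree_injective hh
  obtain ⟨γ', h', hh', -, hl'⟩ := exists_hasLead m lexDegree hy hy0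
  obtain ⟨g, hγ', b, rfl⟩ := hl'.exists_smul lexDegree_injective hh'
  refine (hl.mul hm hl').ne_zero hm ?_
  rw [smul_mul_assoc, mul_smul_comm, hm.mul, smul_smul, smul_smul]
  intro h0
  have h1 := linearIndependent_iff'.1 hm.li {f + g} (fun _ => a * (b * (c f g : A)))
    (by simpa [mul_assoc] using h0) (f + g) (Finset.mem_singleton_self _)
  rcases mul_eq_zero.1 h1 with rfl | h2
  · exact hh (zero_smul _ _)
  · rw [(c f g).isUnit.mul_left_eq_zero] at h2
    subst h2
    exact hh' (zero_smul _ _)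

/-- There is a division algebra with a toric frame of type `A₂` whose elements are fractions with
central denominators. -/
theorem exists_isToricFrame_of_twistedBasis [IsDomain A] {E : Type w} [Ring E] [Algebra A E]
    {q : Aˣ} {ℓ : ℕ} {m₀ : ℤ × ℤ → E}
    (tb : TwistedBasis (fun f g => q ^ (f.1 * g.2 - f.2 * g.1)) m₀) (hℓ : 0 < ℓ)
    (hq : q ^ ℓ = 1) :
    ∃ (F : Type w) (_ : DivisionRing F) (_ : Algebra A F) (M : (Fin 2 → ℤ) → F),
      IsToricFrame q (formA2 ℓ) M ∧ Module.Finite (Subring.center F) F ∧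
      ∀ x : F, ∃ t ∈ quantumTorus A M, ∃ z ∈ quantumTorus A M, z ≠ 0 ∧ (∀ y, Commute z y) ∧
        x = t * z⁻¹ := by
  let D := tb.torus
  let m : ℤ × ℤ → D := fun f => ⟨m₀ f, mem_spanOn _ (Set.mem_univ f)⟩
  have hmul : ∀ f g, m f * m g = ((q ^ (f.1 * g.2 - f.2 * g.1) : Aˣ) : A) • m (f + g) :=
    fun f g => Subtype.ext (tb.mul f g)
  have hspan : ∀ x : D, x ∈ Submodule.span A (Set.range m) := by
    rintro ⟨x, hx⟩
    have hx' : x ∈ spanOn A m₀ Set.univ := hx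
    have h1 : spanOn A m₀ Set.univ ≤
        (Submodule.span A (Set.range m)).map D.val.toLinearMap :=
      spanOn_induction fun f _ => ⟨m f, Submodule.subset_span ⟨f, rfl⟩, rfl⟩
    obtain ⟨y, hy, hyx⟩ := h1 hx'
    have : y = ⟨x, hx⟩ := Subtype.ext hyx
    rwa [← this]
  have hq' : q ^ (ℓ : ℤ) = 1 := by rw [zpow_natCast, hq]
  -- Both twists are powers of q^ℓ = 1.
  have hcentral : ∀ f : ℤ × ℤ, m (ℓ * f.1, ℓ * f.2) ∈ Subring.center D := by
    intro f
    rw [Subring.mem_center_iff]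
    intro y
    have hy := hspan y
    induction hy using Submodule.span_induction with
    | mem y hy =>
      obtain ⟨g, rfl⟩ := hy
      rw [hmul, hmul, add_comm]
      have e1 : g.1 * (ℓ * f.2) - g.2 * (ℓ * f.1) = ℓ * (g.1 * f.2 - g.2 * f.1) := by ring
      have e2 : ℓ * f.1 * g.2 - ℓ * f.2 * g.1 = ℓ * (f.1 * g.2 - f.2 * g.1) := by ring
      simp only [e1, e2]
      rw [zpow_mul, zpow_mul, hq', one_zpow, one_zpow]
    | zero => simp
    | add x y _ _ hx hy => rw [add_mul, mul_add, hx, hy]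
    | smul a x _ hx => rw [smul_mul_assoc, mul_smul_comm, hx]
  have hnt : Nontrivial D := by
    refine ⟨⟨m 0, 0, fun h => ?_⟩⟩
    exact tb.li.ne_zero 0 (congrArg Subtype.val h)
  have hnzd : NoZeroDivisors D := by
    refine ⟨fun {x y} h => ?_⟩
    by_contra! H
    exact tb.mul_ne_zero x.2 y.2 (fun h => H.1 (Subtype.ext h)) (fun h => H.2 (Subtype.ext h))
      (congrArg Subtype.val h)
  -- Reducing exponents modulo ℓ leaves ℓ² monomials, which span over the centre.
  have hfin : Module.Finite (Subring.center D) D := by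
    have hspanC : ∀ x : D, x ∈ Submodule.span (Subring.center D)
        (Set.range fun p : Fin ℓ × Fin ℓ => m ((p.1 : ℕ), (p.2 : ℕ))) := by
      have hA : ∀ a : A, algebraMap A D a ∈ Subring.center D := fun a =>
        Subring.mem_center_iff.2 fun y => (Algebra.commutes a y).symm
      intro x
      have hx := hspan x
      induction hx using Submodule.span_induction with
      | mem y hy =>
        obtain ⟨g, rfl⟩ := hy
        have hℓ' : (0 : ℤ) < ℓ := by exact_mod_cast hℓ
        have hr : ∀ n : ℤ, ∃ i : Fin ℓ, ((i : ℕ) : ℤ) = n % ℓ := by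
          intro n
          have h0 := Int.emod_nonneg n hℓ'.ne'
          have h1 := Int.emod_lt_of_pos n hℓ'
          exact ⟨⟨(n % ℓ).toNat, by omega⟩, by simp only; omega⟩
        obtain ⟨i, hi⟩ := hr g.1
        obtain ⟨j, hj⟩ := hr g.2
        have e := hmul (ℓ * (g.1 / ℓ), ℓ * (g.2 / ℓ)) ((i : ℕ), (j : ℕ))
        rw [Prod.mk_add_mk, hi, hj, Int.mul_ediv_add_emod, Int.mul_ediv_add_emod] at e
        have e2 : m g = (((q ^ (ℓ * (g.1 / ℓ) * (g.2 % ℓ) - ℓ * (g.2 / ℓ) * (g.1 % ℓ)))⁻¹ : Aˣ) : A) •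
            (m (ℓ * (g.1 / ℓ), ℓ * (g.2 / ℓ)) * m ((i : ℕ), (j : ℕ))) := by
          rw [hi, hj, e, smul_smul, Units.inv_mul, one_smul]
        rw [e2, Algebra.smul_def, ← mul_assoc]
        exact Submodule.smul_mem _ (⟨_, mul_mem (hA _) (hcentral (g.1 / ℓ, g.2 / ℓ))⟩ :
          Subring.center D) (Submodule.subset_span ⟨(i, j), rfl⟩)
      | zero => exact Submodule.zero_mem _
      | add x y _ _ hx hy => exact Submodule.add_mem _ hx hy
      | smul a x _ hx =>
        rw [Algebra.smul_def]
        exact Submodule.smul_mem _ (⟨_, hA a⟩ : Subring.center D) hx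
    exact ⟨Submodule.fg_def.2 ⟨_, Set.finite_range _, top_unique fun x _ => hspanC x⟩⟩
  obtain ⟨F, iF, iA, φ, hφ, hF, hfrac⟩ := exists_divisionRing (A := A) (D := D)
  let M : (Fin 2 → ℤ) → F := fun f => φ (m (f 0, f 1))
  have hT : ∀ t : D, φ t ∈ quantumTorus A M := by
    intro t
    have ht := hspan t
    induction ht using Submodule.span_induction with
    | mem y hy =>
      obtain ⟨g, rfl⟩ := hy
      exact Algebra.subset_adjoin ⟨![g.1, g.2], rfl⟩
    | zero => rw [map_zero]; exact zero_mem _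
    | add x y _ _ hx hy => rw [map_add]; exact add_mem hx hy
    | smul a x _ hx => rw [map_smul]; exact Subalgebra.smul_mem _ hx a
  refine ⟨F, iF, iA, M, ⟨?_, ?_, ?_⟩, hF, ?_⟩
  · intro f g
    have e : bichar (formA2 ℓ) f g = ((f 0 * g 1 - f 1 * g 0 : ℤ) : ZMod ℓ) := by
      have := bichar_formA2 (ℓ := ℓ) 1 f g
      simpa using this
    rw [e, epsPow_intCast hq, ← map_mul, hmul, map_smul]
    rfl
  · have h1 : LinearIndependent A m :=
      LinearIndependent.of_comp D.val.toLinearMap tb.li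
    have h2 := (h1.comp (fun f : Fin 2 → ℤ => (f 0, f 1)) (by
      intro f g h
      ext i
      fin_cases i
      · exact congrArg Prod.fst h
      · exact congrArg Prod.snd h)).map' φ.toLinearMap (LinearMap.ker_eq_bot.2 hφ)
    exact h2
  · intro x
    obtain ⟨t, z, hz, -, rfl⟩ := hfrac x
    exact ⟨_, hT t, _, hT z, by rwa [Ne, map_eq_zero_iff φ hφ], rfl⟩
  · intro x
    obtain ⟨t, z, hz, hzc, rfl⟩ := hfrac x
    exact ⟨_, hT t, _, hT z, by rwa [Ne, map_eq_zero_iff φ hφ], hzc, rfl⟩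

theorem exists_isToricFrame [IsDomain A] {q : Aˣ} {ℓ : ℕ} (hℓ : 0 < ℓ) (hq : q ^ ℓ = 1) :
    ∃ (F : Type w) (_ : DivisionRing F) (_ : Algebra A F) (M : (Fin 2 → ℤ) → F),
      IsToricFrame q (formA2 ℓ) M ∧ Module.Finite (Subring.center F) F ∧
      ∀ x : F, ∃ t ∈ quantumTorus A M, ∃ z ∈ quantumTorus A M, z ≠ 0 ∧ (∀ y, Commute z y) ∧
        x = t * z⁻¹ :=
  exists_isToricFrame_of_twistedBasis (twistedTranslation_twistedBasis q) hℓ hq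

end ConcreteTorus

/-! ## The cluster algebra of a toric frame of type `A₂` -/

section Main

/-- The hypothesis says that r · (b/a)ⁿ is integral over nothing more than the ring itself for every
n, that is, it lies in the ring; so b/a does too. -/
theorem dvd_of_completelyIntegrallyClosed {A : Type*} [CommRing A] [IsDomain A]
    (hA : IsCompletelyIntegrallyClosed A) (a b r : A) (ha : a ≠ 0) (hr : r ≠ 0)
    (h : ∀ n : ℕ, a ^ n ∣ r * b ^ n) : a ∣ b := by
  have ha' : algebraMap A (FractionRing A) a ≠ 0 := by
    rwa [Ne, IsFractionRing.to_map_eq_zero_iff]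
  have hmem : algebraMap A (FractionRing A) b / algebraMap A (FractionRing A) a ∈
      completeIntegralClosure A (FractionRing A) := by
    refine ⟨r, mem_nonZeroDivisors_of_ne_zero hr, fun n => ?_⟩
    obtain ⟨t, ht⟩ := h n
    refine ⟨t, ?_⟩
    rw [Algebra.smul_def, div_pow, ← mul_div_assoc, eq_div_iff (pow_ne_zero _ ha'), ← map_pow,
      ← map_pow, ← map_mul, ← map_mul, ht, mul_comm]
  rw [show completeIntegralClosure A (FractionRing A) = ⊥ from hA, Algebra.mem_bot] at hmem
  obtain ⟨t, ht⟩ := hmem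
  refine ⟨t, IsFractionRing.injective A (FractionRing A) ?_⟩
  rw [map_mul, ht, mul_div_cancel₀ _ ha']

variable {A : Type w} [CommRing A] {F : Type*} [DivisionRing F] [Algebra A F] {ℓ : ℕ} {q : Aˣ}

theorem add_smul_ne_zero [Nontrivial A] {ι : Type*} {b : ι → F} (hb : LinearIndependent A b)
    {i j : ι} (hij : i ≠ j) (a : A) : b i + a • b j ≠ 0 := by
  intro h
  classical
  have h1 := linearIndependent_iff'.1 hb {i, j} (fun k => if k = i then 1 else a)
    (by rw [Finset.sum_pair hij]; simpa [hij.symm] using h) i (by simp)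
  simp at h1

/-- Multiplying a relation by u^N on the left and v^N on the right clears all negative exponents. -/
theorem linearIndependent_mon_of_nat {s : Aˣ} {u v : F} (h : QuasiComm s u v)
    (li : LinearIndependent A fun p : ℕ × ℕ => u ^ p.1 * v ^ p.2) :
    LinearIndependent A (mon u v) := by
  classical
  rw [linearIndependent_iff']
  intro t g hg
  obtain ⟨N, hN⟩ : ∃ N : ℕ, ∀ p ∈ t, 0 ≤ p.1 + N ∧ 0 ≤ p.2 + N := by
    refine ⟨t.sup fun p => p.1.natAbs + p.2.natAbs, fun p hp => ?_⟩
    have := Finset.le_sup (f := fun p : ℤ × ℤ => p.1.natAbs + p.2.natAbs) hp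
    omega
  have h1 : ∑ p ∈ t, g p • (u ^ (p.1 + N).toNat * v ^ (p.2 + N).toNat) = 0 := by
    have e : u ^ N * (∑ p ∈ t, g p • mon u v p) * v ^ N = 0 := by
      rw [hg, mul_zero, zero_mul]
    rw [← e, Finset.mul_sum, Finset.sum_mul]
    refine Finset.sum_congr rfl fun p hp => ?_
    obtain ⟨h2, h3⟩ := hN p hp
    rw [mul_smul_comm, smul_mul_assoc, mon, ← zpow_natCast u, ← zpow_natCast v,
      Int.toNat_of_nonneg h2, Int.toNat_of_nonneg h3, add_comm p.1, zpow_add₀ h.left_ne,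
      zpow_add₀ h.right_ne, zpow_natCast, zpow_natCast]
    simp only [mul_assoc]
  let φ : ℤ × ℤ → ℕ × ℕ := fun p => ((p.1 + N).toNat, (p.2 + N).toNat)
  let ψ : ℕ × ℕ → ℤ × ℤ := fun p => ((p.1 : ℤ) - N, (p.2 : ℤ) - N)
  have hψ : ∀ p ∈ t, ψ (φ p) = p := by
    intro p hp
    obtain ⟨h2, h3⟩ := hN p hp
    refine Prod.ext ?_ ?_ <;> simp only [ψ, φ] <;> omega
  have h4 : ∑ p ∈ t.image φ, g (ψ p) • (u ^ p.1 * v ^ p.2) = 0 := by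
    rw [Finset.sum_image fun p hp p' hp' hpp => by rw [← hψ p hp, hpp, hψ p' hp'], ← h1]
    exact Finset.sum_congr rfl fun p hp => by rw [hψ p hp]
  intro p hp
  have := linearIndependent_iff'.1 li _ _ h4 (φ p) (Finset.mem_image_of_mem φ hp)
  rwa [hψ p hp] at this

namespace IsToricFrame

variable [IsDomain A] {M : (Fin 2 → ℤ) → F}

theorem linearIndependent_pbw (hM : IsToricFrame q (formA2 ℓ) M) (hq : q ^ ℓ = 1) :
    LinearIndependent A (pbwMonomial (M ![1, 0]) (M ![0, 1]) (M ![-1, 1] + M ![-1, 0])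
      (M ![1, -1] + M ![0, -1])) :=
  linearIndependent_pbwMonomial (hM.quasiComm hq) (hM.linearIndependent_mon hq)
    ((hM.relations hq).y1_eq (hM.quasiComm hq).left_ne)
    ((hM.relations hq).y2_eq (hM.quasiComm hq).right_ne)

theorem pentagon (hM : IsToricFrame q (formA2 ℓ) M) (hq : q ^ ℓ = 1) :
    Pentagon q ![M ![1, -1] + M ![0, -1], M ![1, 0], M ![0, 1], M ![-1, 1] + M ![-1, 0],
      ((q⁻¹ : Aˣ) : A) • ((M ![-1, 1] + M ![-1, 0]) * (M ![1, -1] + M ![0, -1]) - 1)] := by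
  have li := hM.linearIndependent_pbw hq
  refine (hM.relations hq).pentagon (hM.quasiComm hq).left_ne (hM.quasiComm hq).right_ne ?_ ?_ ?_
  · have := add_smul_ne_zero li (i := ⟨(0, 0, 0, 0), by simp⟩) (j := ⟨(1, 0, 0, 0), by simp⟩)
      (by simp) (q : A)
    simpa [pbwMonomial] using this
  · have := add_smul_ne_zero li (i := ⟨(0, 0, 0, 0), by simp⟩) (j := ⟨(0, 1, 0, 0), by simp⟩)
      (by simp) (q : A)
    simpa [pbwMonomial] using this
  · have := add_smul_ne_zero li (i := ⟨(0, 0, 0, 0), by simp⟩) (j := ⟨(0, 0, 1, 0), by simp⟩)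
      (by simp) (q : A)
    simpa [pbwMonomial] using this

theorem clusterAlgebra_eq (hM : IsToricFrame q (formA2 ℓ) M) (hq : q ^ ℓ = 1) :
    clusterAlgebra q (seedA2 ℓ M) = Algebra.adjoin A {M ![1, 0], M ![0, 1],
      M ![-1, 1] + M ![-1, 0], M ![1, -1] + M ![0, -1]} := by
  rw [hM.seedA2_eq hq]
  -- The initial cluster sits at position 1 of the cycle, so positions 1, 2, 3 and 1 + 4 = 0 carry
  -- x₁, x₂, y₁, y₂.
  exact (hM.pentagon hq).clusterAlgebra_eq hq 1

theorem quasiComm_y1 (hM : IsToricFrame q (formA2 ℓ) M) (hq : q ^ ℓ = 1) :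
    QuasiComm (q ^ (2 : ℤ))⁻¹ (M ![-1, 1] + M ![-1, 0]) (M ![0, 1]) :=
  ((hM.pentagon hq).quasiComm 2).symm

theorem quasiComm_y2 (hM : IsToricFrame q (formA2 ℓ) M) (hq : q ^ ℓ = 1) :
    QuasiComm (q ^ (2 : ℤ)) (M ![1, -1] + M ![0, -1]) (M ![1, 0]) :=
  (hM.pentagon hq).quasiComm 0

theorem linearIndependent_mon_swap (hM : IsToricFrame q (formA2 ℓ) M) (hq : q ^ ℓ = 1) :
    LinearIndependent A (mon (M ![0, 1]) (M ![1, 0])) := by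
  have h := hM.quasiComm hq
  have h1 := ((hM.linearIndependent_mon hq).comp Prod.swap Prod.swap_injective).units_smul
    (fun p : ℤ × ℤ => (q ^ (2 : ℤ))⁻¹ ^ (p.1 * p.2))
  convert h1 using 1
  ext p
  exact h.symm.zpow_comm p.1 p.2

theorem mem_clusterAlgebra_of_mem_tori (hM : IsToricFrame q (formA2 ℓ) M) (hq : q ^ ℓ = 1) {x : F}
    (h1 : x ∈ spanOn A (mon (M ![1, 0]) (M ![0, 1])) Set.univ)
    (h2 : x ∈ spanOn A (mon (M ![-1, 1] + M ![-1, 0]) (M ![0, 1])) Set.univ)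
    (h3 : x ∈ spanOn A (mon (M ![1, 0]) (M ![1, -1] + M ![0, -1])) Set.univ) :
    x ∈ clusterAlgebra q (seedA2 ℓ M) := by
  rw [hM.clusterAlgebra_eq hq]
  exact (hM.relations hq).mem_adjoin_of_mem_tori (hM.quasiComm hq) (hM.quasiComm_y1 hq)
    (hM.quasiComm_y2 hq) (hM.linearIndependent_mon hq) (hM.linearIndependent_mon_swap hq) h1 h2 h3

theorem mem_tori_of_mem_upper (hM : IsToricFrame q (formA2 ℓ) M) (hq : q ^ ℓ = 1) {x : F}
    (hx : x ∈ upperClusterAlgebra q (seedA2 ℓ M)) :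
    x ∈ spanOn A (mon (M ![1, 0]) (M ![0, 1])) Set.univ ∧
      x ∈ spanOn A (mon (M ![-1, 1] + M ![-1, 0]) (M ![0, 1])) Set.univ ∧
      x ∈ spanOn A (mon (M ![1, 0]) (M ![1, -1] + M ![0, -1])) Set.univ := by
  rw [hM.seedA2_eq hq] at hx
  exact (hM.pentagon hq).mem_of_mem_upper hq 1 hx

theorem clusterAlgebra_eq_upper (hM : IsToricFrame q (formA2 ℓ) M) (hq : q ^ ℓ = 1) :
    clusterAlgebra q (seedA2 ℓ M) = upperClusterAlgebra q (seedA2 ℓ M) := by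
  apply le_antisymm
  · rw [hM.seedA2_eq hq]
    exact (hM.pentagon hq).clusterAlgebra_le_upper hq 1
  · intro x hx
    obtain ⟨h1, h2, h3⟩ := hM.mem_tori_of_mem_upper hq hx
    exact hM.mem_clusterAlgebra_of_mem_tori hq h1 h2 h3

/-- The presented algebra is isomorphic to the cluster algebra. -/
noncomputable def equivClusterAlgebra (hM : IsToricFrame q (formA2 ℓ) M) (hq : q ^ ℓ = 1) :
    PresentedAlgebra q ≃ₐ[A] clusterAlgebra q (seedA2 ℓ M) :=
  (AlgEquiv.ofInjective _ ((hM.relations hq).toHom_injective (hM.linearIndependent_pbw hq))).trans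
    (Subalgebra.equivOfEq _ _ ((hM.relations hq).range_toHom.trans (hM.clusterAlgebra_eq hq).symm))

theorem coe_equivClusterAlgebra (hM : IsToricFrame q (formA2 ℓ) M) (hq : q ^ ℓ = 1)
    (x : PresentedAlgebra q) : (hM.equivClusterAlgebra hq x : F) = (hM.relations hq).toHom x :=
  rfl

/-- If every element of `F` is a fraction of elements of the torus with central denominator, then
it is such a fraction of elements of the cluster algebra. -/
theorem exists_mem_clusterAlgebra (hM : IsToricFrame q (formA2 ℓ) M) (hq : q ^ ℓ = 1)
    (hℓ : 0 < ℓ) (hF : ∀ x : F, ∃ t ∈ quantumTorus A M, ∃ z ∈ quantumTorus A M, z ≠ 0 ∧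
      (∀ y, Commute z y) ∧ x = t * z⁻¹) (x : F) :
    ∃ t ∈ clusterAlgebra q (seedA2 ℓ M), ∃ z ∈ clusterAlgebra q (seedA2 ℓ M), z ≠ 0 ∧
      (∀ y, Commute z y) ∧ x = t * z⁻¹ := by
  have h := hM.quasiComm hq
  have hT : ∀ t ∈ quantumTorus A M, t ∈ spanOn A (mon (M ![1, 0]) (M ![0, 1])) Set.univ := by
    intro t ht
    rw [hM.eq_normFrame hq] at ht
    exact (mem_quantumTorus_normFrame q h).1 ht
  have hs : (q ^ (2 : ℤ)) ^ ℓ = 1 := by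
    rw [← zpow_natCast, zpow_comm, zpow_natCast, hq, one_zpow]
  have hu : M ![1, 0] ∈ clusterAlgebra q (seedA2 ℓ M) := by
    rw [hM.clusterAlgebra_eq hq]
    exact Algebra.subset_adjoin (by simp)
  have hv : M ![0, 1] ∈ clusterAlgebra q (seedA2 ℓ M) := by
    rw [hM.clusterAlgebra_eq hq]
    exact Algebra.subset_adjoin (by simp)
  -- A power of this central monomial carries both numerator and denominator from the torus into the
  -- cluster algebra.
  set W := mon (M ![1, 0]) (M ![0, 1]) (ℓ, ℓ) with hW
  have hWm := QuasiComm.mon_mem (A := A) ℓ hu hv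
  rw [← hW] at hWm
  have hW0 : W ≠ 0 := h.mon_ne_zero _
  have hWT : ∀ t ∈ quantumTorus A M, Commute W t := fun t ht =>
    TwistedBasis.commute_of_forall (h.commute_mon hs) (hT t ht)
  have hWc : ∀ y, Commute W y := by
    intro y
    obtain ⟨t, ht, z, hz, -, -, rfl⟩ := hF y
    exact (hWT t ht).mul_right (hWT z hz).inv_right₀
  obtain ⟨t, ht, z, hz, hz0, hzc, rfl⟩ := hF x
  obtain ⟨N, hN⟩ := h.exists_mon_pow_mul_mem hℓ hu hv (hT t ht)
  obtain ⟨N', hN'⟩ := h.exists_mon_pow_mul_mem hℓ hu hv (hT z hz)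
  rw [← hW] at hN hN'
  have hWp : W ^ (N' + N) ≠ 0 := pow_ne_zero _ hW0
  refine ⟨W ^ (N' + N) * t, ?_, W ^ (N' + N) * z, ?_, mul_ne_zero hWp hz0,
    fun y => ((hWc y).pow_left _).mul_left (hzc y), ?_⟩
  · rw [pow_add, mul_assoc]
    exact mul_mem (pow_mem hWm _) hN
  · rw [add_comm, pow_add, mul_assoc]
    exact mul_mem (pow_mem hWm _) hN'
  · rw [((hWc t).pow_left _).eq, mul_inv_rev, ((hWc z⁻¹).pow_left _).inv_left₀.symm.eq, mul_assoc,
      mul_inv_cancel_left₀ hWp]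

theorem isMaximalOrderIn (hM : IsToricFrame q (formA2 ℓ) M) (hq : q ^ ℓ = 1)
    (hℓ : 0 < ℓ) (hF : ∀ x : F, ∃ t ∈ quantumTorus A M, ∃ z ∈ quantumTorus A M, z ≠ 0 ∧
      (∀ y, Commute z y) ∧ x = t * z⁻¹) (hA : IsCompletelyIntegrallyClosed A) :
    IsMaximalOrderIn (clusterAlgebra q (seedA2 ℓ M)).toSubring := by
  have hfrac := hM.exists_mem_clusterAlgebra hq hℓ hF
  refine ⟨fun x => ?_, ?_⟩
  · obtain ⟨t, ht, z, hz, hz0, hzc, rfl⟩ := hfrac x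
    refine ⟨⟨t, ht, Units.mk0 z hz0, hz, rfl⟩, ⟨Units.mk0 z hz0, hz, t, ht, ?_⟩⟩
    exact ((hzc t).inv_left₀).eq.symm
  rintro R' - ⟨-, -, a, b, -, hab⟩ hRR'
  refine le_antisymm ?_ hRR'
  -- Central denominators z₁, z₂ of a⁻¹ and b⁻¹ turn the two-sided condition a R' b ⊆ R into the
  -- central one: z₁z₂y = t₁(a y b)t₂.
  obtain ⟨t₁, ht₁, z₁, hz₁, hz₁0, hz₁c, e₁⟩ := hfrac ((a⁻¹ : Fˣ) : F)
  obtain ⟨t₂, ht₂, z₂, hz₂, hz₂0, hz₂c, e₂⟩ := hfrac ((b⁻¹ : Fˣ) : F)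
  have f₁ : t₁ * a = z₁ := by
    rw [eq_mul_inv_iff_mul_eq₀ hz₁0] at e₁
    rw [← e₁, ← (hz₁c _).eq, mul_assoc, Units.inv_mul, mul_one]
  have f₂ : b * t₂ = z₂ := by
    rw [eq_mul_inv_iff_mul_eq₀ hz₂0] at e₂
    rw [← e₂, Units.mul_inv_cancel_left]
  have he0 : z₁ * z₂ ≠ 0 := mul_ne_zero hz₁0 hz₂0
  have hec : ∀ y, Commute (z₁ * z₂) y := fun y => (hz₁c y).mul_left (hz₂c y)
  have heR : ∀ y ∈ R', z₁ * z₂ * y ∈ clusterAlgebra q (seedA2 ℓ M) := by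
    intro y hy
    have e : z₁ * z₂ * y = t₁ * (a * y * b) * t₂ := by
      rw [mul_assoc, (hz₂c y).eq, ← f₁, ← f₂]
      simp only [mul_assoc]
    rw [e]
    exact mul_mem (mul_mem ht₁ (hab y hy)) ht₂
  have hs : (q ^ (2 : ℤ)) ^ ℓ = 1 := by
    rw [← zpow_natCast, zpow_comm, zpow_natCast, hq, one_zpow]
  have hs' : (q ^ (2 : ℤ))⁻¹ ^ ℓ = 1 := by rw [inv_pow, hs, inv_one]
  have hsub : ∀ {x}, x ∈ ({M ![1, 0], M ![0, 1], M ![-1, 1] + M ![-1, 0],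
      M ![1, -1] + M ![0, -1]} : Set F) → x ∈ clusterAlgebra q (seedA2 ℓ M) := by
    rw [hM.clusterAlgebra_eq hq]
    exact fun hx => Algebra.subset_adjoin hx
  have htori : ∀ x ∈ clusterAlgebra q (seedA2 ℓ M), _ := fun x hx =>
    hM.mem_tori_of_mem_upper hq (x := x) (by rwa [← hM.clusterAlgebra_eq_upper hq])
  have hcic := dvd_of_completelyIntegrallyClosed hA
  have li := hM.linearIndependent_pbw hq
  -- The monomials y₁^i x₂^j, and below x₁^i y₂^j, with nonnegative exponents occur among the
  -- independent monomials of the cluster algebra.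
  have li₁ : LinearIndependent A (mon (M ![-1, 1] + M ![-1, 0]) (M ![0, 1])) := by
    refine linearIndependent_mon_of_nat (hM.quasiComm_y1 hq) ?_
    have := li.comp (fun p : ℕ × ℕ => (⟨(p.1, 0, p.2, 0), by simp⟩ : PBWIndex))
      (fun p p' hp => by simpa [Prod.ext_iff] using hp)
    convert this using 1
    ext p
    simp [pbwMonomial]
  have li₂ : LinearIndependent A (mon (M ![1, 0]) (M ![1, -1] + M ![0, -1])) := by
    refine linearIndependent_mon_of_nat (hM.quasiComm_y2 hq).symm ?_
    have := li.comp (fun p : ℕ × ℕ => (⟨(0, p.1, 0, p.2), by simp⟩ : PBWIndex))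
      (fun p p' hp => by simpa [Prod.ext_iff] using hp)
    convert this using 1
    ext p
    simp [pbwMonomial]
  intro x hx
  refine hM.mem_clusterAlgebra_of_mem_tori hq ?_ ?_ ?_
  · exact (hM.quasiComm hq).mem_spanOn_of_mul_mem hs hℓ (hM.linearIndependent_mon hq) hcic
      (clusterAlgebra q (seedA2 ℓ M)) (hsub (by simp)) (hsub (by simp))
      (fun x hx => (htori x hx).1) R' hRR' he0 heR (fun y _ => hec y) hx
  · exact (hM.quasiComm_y1 hq).mem_spanOn_of_mul_mem hs' hℓ li₁ hcic
      (clusterAlgebra q (seedA2 ℓ M)) (hsub (by simp)) (hsub (by simp))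
      (fun x hx => (htori x hx).2.1) R' hRR' he0 heR (fun y _ => hec y) hx
  · exact (hM.quasiComm_y2 hq).symm.mem_spanOn_of_mul_mem hs' hℓ li₂ hcic
      (clusterAlgebra q (seedA2 ℓ M)) (hsub (by simp)) (hsub (by simp))
      (fun x hx => (htori x hx).2.2) R' hRR' he0 heR (fun y _ => hec y) hx

end IsToricFrame

/-- No toric frame is given here, so one is constructed. Its division ring is finite over its centre
and serves as the central simple algebra. -/
theorem isMaximalOrder_presentedAlgebra {A : Type w} [CommRing A] [IsDomain A] {q : Aˣ} {ℓ : ℕ}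
    (hℓ : 0 < ℓ) (hq : q ^ ℓ = 1) (hA : IsCompletelyIntegrallyClosed A) :
    IsMaximalOrder (PresentedAlgebra q) := by
  obtain ⟨F, _, _, M, hM, hfin, hF⟩ := exists_isToricFrame (A := A) hℓ hq
  refine ⟨Subring.center F, F, inferInstance, inferInstance, inferInstance, ?_, inferInstance,
    hfin, ((hM.relations hq).toHom : PresentedAlgebra q →+* F), ?_, ?_⟩
  · refine ⟨fun x hx => ?_⟩
    rw [Algebra.mem_bot]
    exact ⟨⟨x, Subring.mem_center_iff.2 fun y => Subalgebra.mem_center_iff.1 hx y⟩, rfl⟩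
  · exact (hM.relations hq).toHom_injective (hM.linearIndependent_pbw hq)
  · have e : ((hM.relations hq).toHom : PresentedAlgebra q →+* F).range =
        (clusterAlgebra q (seedA2 ℓ M)).toSubring := by
      rw [hM.clusterAlgebra_eq hq, ← (hM.relations hq).range_toHom]
      rfl
    rw [e]
    exact hM.isMaximalOrderIn hq hℓ hF hA

theorem epsHalf_pow {k : Type u} [CommRing k] {K : Type w} [Field K] [Algebra k K] {ℓ : ℕ}
    (hℓ : 0 < ℓ) {ζ : K} (hζ : IsPrimitiveRoot ζ ℓ) : epsHalf k hℓ hζ ^ ℓ = 1 :=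
  Units.ext (Subtype.ext hζ.pow_eq_one)

end Main

end RootCluster

open RootCluster
theorem mainTheorem10 {k : Type u} [CommRing k] [IsDomain k] [CharZero k]
    {K : Type w} [Field K] [Algebra k K] [Algebra (FractionRing k) K]
    [IsScalarTower k (FractionRing k) K] [IsAlgClosure (FractionRing k) K]
    (ℓ : ℕ) (hℓ : 0 < ℓ) (ζ : K) (hζ : IsPrimitiveRoot ζ ℓ) :
    (∀ (F : Type v) [DivisionRing F] [Algebra (BaseRing k ζ) F] (M : (Fin 2 → ℤ) → F),
      IsToricFrame (epsHalf k hℓ hζ) (formA2 ℓ) M →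
        (∃ θ : PresentedAlgebra (epsHalf k hℓ hζ) ≃ₐ[BaseRing k ζ]
              clusterAlgebra (epsHalf k hℓ hζ) (seedA2 ℓ M),
          (θ (gen (epsHalf k hℓ hζ) Gen.x1) : F) = M ![1, 0] ∧
          (θ (gen (epsHalf k hℓ hζ) Gen.x2) : F) = M ![0, 1] ∧
          (θ (gen (epsHalf k hℓ hζ) Gen.y1) : F) = M ![-1, 1] + M ![-1, 0] ∧
          (θ (gen (epsHalf k hℓ hζ) Gen.y2) : F) = M ![1, -1] + M ![0, -1]) ∧
        clusterAlgebra (epsHalf k hℓ hζ) (seedA2 ℓ M) =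
          upperClusterAlgebra (epsHalf k hℓ hζ) (seedA2 ℓ M) ∧
        (∃ b : Module.Basis PBWIndex (BaseRing k ζ)
              (clusterAlgebra (epsHalf k hℓ hζ) (seedA2 ℓ M)),
          ∀ p, (b p : F) = pbwMonomial (M ![1, 0]) (M ![0, 1])
            (M ![-1, 1] + M ![-1, 0]) (M ![1, -1] + M ![0, -1]) p)) ∧
    (∃ b : Module.Basis PBWIndex (BaseRing k ζ) (PresentedAlgebra (epsHalf k hℓ hζ)),
      ∀ p, b p = pbwMonomial (gen (epsHalf k hℓ hζ) Gen.x1) (gen (epsHalf k hℓ hζ) Gen.x2)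
        (gen (epsHalf k hℓ hζ) Gen.y1) (gen (epsHalf k hℓ hζ) Gen.y2) p) ∧
    (IsCompletelyIntegrallyClosed (BaseRing k ζ) →
      IsMaximalOrder (PresentedAlgebra (epsHalf k hℓ hζ))) := by
  have hq := epsHalf_pow (k := k) hℓ hζ
  refine ⟨fun F _ _ M hM => ⟨⟨hM.equivClusterAlgebra hq, ?_, ?_, ?_, ?_⟩,
    hM.clusterAlgebra_eq_upper hq, ?_⟩, ?_, isMaximalOrder_presentedAlgebra hℓ hq⟩
  · rw [hM.coe_equivClusterAlgebra, (hM.relations hq).toHom_x1]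
  · rw [hM.coe_equivClusterAlgebra, (hM.relations hq).toHom_x2]
  · rw [hM.coe_equivClusterAlgebra, (hM.relations hq).toHom_y1]
  · rw [hM.coe_equivClusterAlgebra, (hM.relations hq).toHom_y2]
  · refine ⟨((hM.relations hq).pbwBasis (hM.linearIndependent_pbw hq)).map
      (hM.equivClusterAlgebra hq).toLinearEquiv, fun p => ?_⟩
    rw [Module.Basis.map_apply, A2Relations.pbwBasis_apply, ← (hM.relations hq).toHom_pbwMonomial]
    exact hM.coe_equivClusterAlgebra hq _
  -- Independence in the presented algebra is detected in the constructed frame, as this part of the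
  -- statement supplies none.
  · obtain ⟨F, _, _, M, hM, -⟩ := exists_isToricFrame hℓ hq
    exact ⟨(hM.relations hq).pbwBasis (hM.linearIndependent_pbw hq),
      A2Relations.pbwBasis_apply _ _⟩
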